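/- **Setting.** Let $I$ be an index set, $A=(a_{ij})_{i,j\in I}$ an integer matrix with $a_{ii}\in\{2,0,-2,-4,\dots\}$ and $a_{ij}\le 0$ for $i\ne j$, and $d_i$ $(i\in I)$ positive integers with $d_ia_{ij}=d_ja_{ji}$. Let $P$ be a free abelian group, $P^\vee=\operatorname{Hom}(P,\mathbb Z)$, $\alpha_i\in P$ linearly independent over $\mathbb C$, and $h_i\in P^\vee$ with $\langle h_i,\alpha_j\rangle=a_{ij}$, such that for every $i$ there is $\Lambda_i\in P$ with $\langle h_j,\Lambda_i\rangle=\delta_{ij}$ for all $j$. Let $p:I\to\mathbb Z/2$ be a parity function such that $a_{ij}$ is even for all $j$ whenever $p(i)=1$. Put $(\alpha_i,\alpha_j)=d_ia_{ij}$, $q_i=q^{d_i}$, and let $I^\infty$ be the set of pairs $(i,l)$ with $l\ge1$, and $l=1$ if $a_{ii}=2$. Put $p(li)=l\,p(i)$ and $|(i,l)|=l\alpha_i$. Let $F$ be the free $\mathbb Q(q)$-superalgebra on $a_{il}$, $(i,l)\in I^\infty$, of parity $p(li)$ and degree $(i,l)\in\mathbb N I^\infty$. Let $(\cdot,\cdot)$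 be the symmetric bilinear form on $F$ with $(1,1)=1$, $(a_{il},a_{jk})=\delta_{ij}\delta_{lk}\tau_{il}$ where $\tau_{il}=(1-(-1)^{p(li)}q_i^{2l})^{-1}$, and $(x,yy')=(\varrho(x),y\otimes y')$, where $\varrho(a_{il})=a_{il}\otimes1+1\otimes a_{il}$ extends to an algebra homomorphism from $F$ to $F\otimes F$ with the product $(x_1\otimes x_2)(x_3\otimes x_4)=(-1)^{p(x_2)p(x_3)}q^{(|x_2|,|x_3|)}x_1x_3\otimes x_2x_4$. Let $\mathscr R$ be its radical, and let $(F/\mathscr R)_\nu$ be the image of the degree $\nu$ part $F_\nu$, $\nu\in\mathbb N I^\infty$. Let $U$ be the $\mathbb Q(q)$-superalgebra generated by $a_{il},b_{il}$ $((i,l)\in I^\infty$, parity $p(li))$ and $q^h$ $(h\in P^\vee$, even$)$, with $K_i^{l}=q^{ld_ih_i}$ and the relations $q^0=1$, $q^hq^{h'}=q^{h+h'}$, $q^ha_{il}q^{-h}=q^{l\langle h,\alpha_i\rangle}a_{il}$, $q^hb_{il}q^{-h}=q^{-l\langle h,\alpha_i\rangle}b_{il}$; $a_{il}b_{jk}-(-1)^{p(li)p(kj)}b_{jk}a_{il}=\delta_{ij}\delta_{kl}\,\tau_{il}(K_i^l-K_i^{-l})$;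 $a_{il}a_{jk}=(-1)^{p(li)p(kj)}a_{jk}a_{il}$ if $a_{ij}=0$; $\sum_{t+t'=1-ka_{ij}}(-1)^{t'}(-1)^{p(i)(t'p(kj)+\binom{t'}2)}\begin{bmatrix}1-ka_{ij}\\t'\end{bmatrix}_i a_{i1}^{t}a_{jk}a_{i1}^{t'}=0$ if $a_{ii}=2$ and $(i,1)\neq(j,k)$, where $\begin{bmatrix}a\\t\end{bmatrix}_i=\prod_{s=0}^{t-1}\frac{((-1)^{p(i)}q_i)^{a-s}-q_i^{s-a}}{((-1)^{p(i)}q_i)^{s+1}-q_i^{-s-1}}$; the last two families also with $b$ in place of $a$; and $x^+=x^-=0$ for $x\in\mathscr R$, where $x\mapsto x^+$, $x\mapsto x^-$ are the algebra homomorphisms $F\to U$ with $a_{il}^+=a_{il}$, $a_{il}^-=b_{il}$. Thus $x\mapsto x^\pm$ is defined on $F/\mathscr R$. Let $U^\pm$ and $U^{\pm}_\nu$ be the images of $F/\mathscr R$ and $(F/\mathscr R)_\nu$ under $x\mapsto x^\pm$, and $U^0$ the span of the $q^h$. Regard $U\otimes U$ as a superalgebra in the standard way, $(x_1\otimes x_2)(x_3\otimes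 x_4)=(-1)^{p(x_2)p(x_3)}x_1x_3\otimes x_2x_4$. Let $U\hat\otimes U$ be the completion of $U\otimes U$ with respect to the subspaces $$H_S=\Bigl(U^+U^0\sum_{\nu\notin S}U^-_\nu\Bigr)\otimes U+U\otimes\Bigl(U^-U^0\sum_{\nu\notin S}U^+_\nu\Bigr),\qquad S\subset\mathbb N I^\infty\text{ finite},$$ on which $U\otimes U$ acts by left and right multiplication, extended by continuity. For $\nu=\sum\nu_{il}(i,l)\in\mathbb N I^\infty$ let $\operatorname{ht}(\nu)=\sum\nu_{il}$ and $e(\nu)=\binom n2$, where $n=\sum_{p(li)=1}\nu_{il}$ is the number of odd terms of $\nu$. **Statement.** There are unique algebra homomorphisms $\Delta,\bar\Delta:U\to U\otimes U$ with $$\Delta(q^h)=q^h\otimes q^h,\quad\Delta(a_{il})=a_{il}\otimes1+K_i^l\otimes a_{il},\quad\Delta(b_{il})=b_{il}\otimes K_i^{-l}+1\otimes b_{il},$$ $$\bar\Delta(q^h)=q^h\otimes q^h,\quad\bar\Delta(a_{il})=a_{il}\otimes1+K_i^{-l}\otimes a_{il},\quad\bar\Delta(b_{il})=b_{il}\otimes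 K_i^{l}+1\otimes b_{il}.$$ There is a unique family $\Theta_\nu\in U^-_\nu\otimes U^+_\nu$ $(\nu\in\mathbb N I^\infty)$ such that $\Theta_0=1\otimes1$, the sum $\Theta=\sum_\nu\Theta_\nu$ converges in $U\hat\otimes U$, and $\Delta(u)\Theta=\Theta\bar\Delta(u)$ for all $u\in U$. Moreover, for every $\nu$ the space $(F/\mathscr R)_\nu$ is finite-dimensional, every basis $B_\nu$ of it has a dual basis $\{b^*\}$ with respect to $(\cdot,\cdot)$, and $$\Theta_\nu=(-1)^{\operatorname{ht}(\nu)+e(\nu)}\sum_{b\in B_\nu}b^-\otimes (b^{*})^{+}.$$ -/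

import Mathlib

open scoped TensorProduct

/-- The ground field `ℚ(q)`. -/
abbrev QField : Type := RatFunc ℚ

/-- The indeterminate `q`. -/
noncomputable abbrev qVar : QField := RatFunc.X

/-- The sign `(-1)^x` of a parity `x ∈ ℤ/2`. -/
noncomputable def sgn (x : ZMod 2) : QField := (-1) ^ x.val

/-- A super Borcherds–Cartan datum: a symmetrizable Borcherds–Cartan matrix `A` with its
symmetrizer `d`, a free abelian weight lattice `P` with dual lattice `P^∨ = Hom(P, ℤ)`, simple
roots, simple coroots, and a parity function `p : I → ℤ/2` (so `I` is the disjoint union of the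
even indices `p i = 0` and the odd indices `p i = 1`). -/
structure SuperBorcherdsCartanDatum (I : Type*) (P : Type*) [AddCommGroup P]
    [Module.Free ℤ P] where
  A : I → I → ℤ
  diag : ∀ i, A i i = 2 ∨ (A i i ≤ 0 ∧ Even (A i i))
  off_diag : ∀ i j, i ≠ j → A i j ≤ 0
  d : I → ℕ
  d_pos : ∀ i, 0 < d i
  symmetrizable : ∀ i j, (d i : ℤ) * A i j = d j * A j i
  root : I → P
  coroot : I → Module.Dual ℤ P
  pairing : ∀ i j, coroot i (root j) = A i j
  root_independent : LinearIndependent ℂ fun i => (1 : ℂ) ⊗ₜ[ℤ] root i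
  p : I → ZMod 2
  odd_even : ∀ i, p i = 1 → ∀ j, Even (A i j)
  exists_fundamental : ∀ i, ∃ Λ : P, ∀ j, (j = i → coroot j Λ = 1) ∧ (j ≠ i → coroot j Λ = 0)

namespace SuperBorcherdsCartanDatum

variable {I : Type*} {P : Type*} [AddCommGroup P] [Module.Free ℤ P]

/-- The index set `I^∞`: the pairs `(i, l)` with `l ≥ 1`, and with `l = 1` when `i` is real. -/
def Iinf (D : SuperBorcherdsCartanDatum I P) : Type _ :=
  {x : I × ℕ // 0 < x.2 ∧ (D.A x.1 x.1 = 2 → x.2 = 1)}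

variable (D : SuperBorcherdsCartanDatum I P)

noncomputable instance : DecidableEq D.Iinf := Classical.decEq _

/-- The index `i` of `g = (i, l) ∈ I^∞`. -/
def idx (g : D.Iinf) : I := g.1.1

/-- The level `l` of `g = (i, l) ∈ I^∞`. -/
def lev (g : D.Iinf) : ℕ := g.1.2

/-- The parity `p(a_{il}) = l p(i)`. -/
def par (g : D.Iinf) : ZMod 2 := D.lev g * D.p (D.idx g)

/-- The integer `(l α_i, k α_j) = l k d_i a_{ij}`. -/
def pair (g h : D.Iinf) : ℤ := D.lev g * D.lev h * (D.d (D.idx g) * D.A (D.idx g) (D.idx h))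

/-- `q_i = q^{d_i}`. -/
noncomputable def qi (i : I) : QField := qVar ^ D.d i

/-- The value `(a_{il}, a_{il}) = (1 - (-1)^{p(li)} q_i^{2l})⁻¹`. -/
noncomputable def tau (g : D.Iinf) : QField :=
  (1 - sgn (D.par g) * D.qi (D.idx g) ^ (2 * D.lev g))⁻¹

/-- The commutation factor `(-1)^{p(g) p(h)} q^{(|g|, |h|)}`. -/
noncomputable def braid (g h : D.Iinf) : QField := sgn (D.par g * D.par h) * qVar ^ D.pair g h

/-- The free algebra `F` on the `a_{il}`, `(i, l) ∈ I^∞`. -/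
abbrev F : Type _ := FreeAlgebra QField D.Iinf

/-- The generator `a_{il}` of `F`. -/
noncomputable abbrev gen (g : D.Iinf) : D.F := FreeAlgebra.ι QField g

/-- Multiplication of a homogeneous `x ∈ F` by `(-1)^{p(g) p(x)} q^{(|g|, |x|)}`. -/
noncomputable def twist (g : D.Iinf) : D.F →ₐ[QField] D.F :=
  FreeAlgebra.lift QField fun h => D.braid g h • D.gen h

/-- Left multiplication by `a_g ⊗ 1 + 1 ⊗ a_g` in the twisted superalgebra `F ⊗ F`, where
`(x₁ ⊗ x₂)(x₃ ⊗ x₄) = (-1)^{p(x₂) p(x₃)} q^{(|x₂|, |x₃|)} x₁x₃ ⊗ x₂x₄`. -/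
noncomputable def primMul (g : D.Iinf) : Module.End QField (D.F ⊗[QField] D.F) :=
  TensorProduct.map (LinearMap.mulLeft QField (D.gen g)) LinearMap.id +
    TensorProduct.map (D.twist g).toLinearMap (LinearMap.mulLeft QField (D.gen g))

/-- The algebra homomorphism `ϱ` from `F` to the twisted superalgebra `F ⊗ F` with
`ϱ(a_g) = a_g ⊗ 1 + 1 ⊗ a_g`: a product of generators is sent to the product of their images. -/
noncomputable def rho : D.F →ₗ[QField] D.F ⊗[QField] D.F :=
  LinearMap.applyₗ (1 ⊗ₜ[QField] 1) ∘ₗ (FreeAlgebra.lift QField D.primMul).toLinearMap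

/-- The functional `ξ_g` on `F`: it takes the value `(a_g, a_g)` on `a_g` and vanishes on all the
other words in the generators (it is `(a_g, a_g)` times the coefficient of `a_g`). -/
noncomputable def xi (g : D.Iinf) : D.F →ₗ[QField] QField :=
  D.tau g • (TrivSqZeroExt.sndHom QField QField ∘ₗ
    (FreeAlgebra.lift QField fun h =>
      (TrivSqZeroExt.inr (if h = g then 1 else 0) :
        TrivSqZeroExt QField QField)).toLinearMap)

/-- The operator `f ↦ ξ_g f` on the dual of `F`, where the product of functionals is the transpose
of `ϱ`: `(f f')(x) = (f ⊗ f')(ϱ(x))`. -/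
noncomputable def xiMul (g : D.Iinf) : Module.End QField (Module.Dual QField D.F) where
  toFun f := LinearMap.mul' QField QField ∘ₗ TensorProduct.map (D.xi g) f ∘ₗ D.rho
  map_add' f f' := by ext x; simp [TensorProduct.map_add_right]
  map_smul' c f := by ext x; simp [TensorProduct.map_smul_right]

/-- The bilinear form on `F`, `(x, y) = φ(y)(x)`, where `φ` is the algebra homomorphism from `F`
to its dual with `φ(a_g) = ξ_g` (so `φ(1)` is the counit). -/
noncomputable def form : D.F →ₗ[QField] D.F →ₗ[QField] QField :=
  (LinearMap.applyₗ (FreeAlgebra.algebraMapInv (R := QField) (X := D.Iinf)).toLinearMap ∘ₗ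
    (FreeAlgebra.lift QField D.xiMul).toLinearMap).flip

theorem F_induction {C : D.F → Prop} (one : C 1) (add : ∀ x y, C x → C y → C (x + y))
    (smul : ∀ (r : QField) x, C x → C (r • x)) (mul : ∀ g x, C x → C (D.gen g * x)) (x : D.F) :
    C x := by
  have key : ∀ y : D.F, ∀ x, C x → C (y * x) := by
    intro y
    induction y using FreeAlgebra.induction with
    | grade0 r => intro x hx; rw [← Algebra.smul_def]; exact smul r x hx
    | grade1 g => intro x hx; exact mul g x hx
    | mul a b ha hb => intro x hx; rw [mul_assoc]; exact ha _ (hb _ hx)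
    | add a b ha hb => intro x hx; rw [add_mul]; exact add _ _ (ha _ hx) (hb _ hx)
  simpa using key x 1 one

theorem pair_comm (g h : D.Iinf) : D.pair g h = D.pair h g := by
  have := D.symmetrizable (D.idx g) (D.idx h)
  unfold pair; rw [this]; ring

theorem braid_comm (g h : D.Iinf) : D.braid g h = D.braid h g := by
  unfold braid; rw [D.pair_comm, mul_comm (D.par g)]

theorem rho_one : D.rho 1 = 1 ⊗ₜ 1 := by simp [rho]

theorem rho_gen_mul (g : D.Iinf) (x : D.F) : D.rho (D.gen g * x) = D.primMul g (D.rho x) := by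
  simp [rho]

theorem form_one (x : D.F) : D.form x 1 = FreeAlgebra.algebraMapInv x := by
  simp [form]

theorem form_gen_mul (g : D.Iinf) (x y : D.F) :
    D.form x (D.gen g * y) =
      LinearMap.mul' QField QField (TensorProduct.map (D.xi g) (D.form.flip y) (D.rho x)) := by
  simp [form, xiMul]

theorem xi_gen_mul (g h : D.Iinf) (x : D.F) :
    D.xi g (D.gen h * x) =
      if h = g then D.tau g * FreeAlgebra.algebraMapInv x else 0 := by
  have key : ∀ x, TrivSqZeroExt.fst ((FreeAlgebra.lift QField fun h =>
      (TrivSqZeroExt.inr (if h = g then 1 else 0) : TrivSqZeroExt QField QField)) x) =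
      FreeAlgebra.algebraMapInv x := by
    intro x
    induction x using D.F_induction with
    | one => simp
    | add x y hx hy => simp only [map_add, TrivSqZeroExt.fst_add, hx, hy]
    | smul r x hx => simp only [map_smul, TrivSqZeroExt.fst_smul, hx]
    | mul k x hx => simp [FreeAlgebra.algebraMapInv]; split_ifs <;> simp
  rw [← key x]
  simp only [xi, LinearMap.smul_apply, LinearMap.comp_apply, AlgHom.toLinearMap_apply, map_mul,
    FreeAlgebra.lift_ι_apply, TrivSqZeroExt.sndHom_apply, TrivSqZeroExt.snd_mul,
    TrivSqZeroExt.fst_inr, TrivSqZeroExt.snd_inr, zero_smul, zero_add]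
  split_ifs <;> simp

theorem xi_one (g : D.Iinf) : D.xi g 1 = 0 := by simp [xi]

theorem counit_twist (g : D.Iinf) (x : D.F) :
    FreeAlgebra.algebraMapInv (D.twist g x) = FreeAlgebra.algebraMapInv (R := QField) x := by
  induction x using D.F_induction with
  | one => simp
  | add x y hx hy => simp [hx, hy]
  | smul r x hx => simp [hx]
  | mul h x hx => simp [twist, FreeAlgebra.algebraMapInv]

theorem xi_twist (g h : D.Iinf) (x : D.F) : D.xi g (D.twist h x) = D.braid h g * D.xi g x := by
  induction x using D.F_induction with
  | one => simp [xi_one]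
  | add x y hx hy => simp [hx, hy, mul_add]
  | smul r x hx => simp [hx]; ring
  | mul k x hx =>
    have : D.twist h (D.gen k) = D.braid h k • D.gen k := by simp [twist]
    rw [map_mul, this, smul_mul_assoc, map_smul, xi_gen_mul, xi_gen_mul, counit_twist]
    split_ifs with hk
    · subst hk; simp
    · simp

/-- The operator `(ξ_g ⊗ id) ∘ ϱ` on `F`. -/
noncomputable def contr (g : D.Iinf) : D.F →ₗ[QField] D.F :=
  (TensorProduct.lid QField D.F).toLinearMap ∘ₗ
    TensorProduct.map (D.xi g) LinearMap.id ∘ₗ D.rho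

theorem contr_one (g : D.Iinf) : D.contr g 1 = 0 := by simp [contr, rho_one, xi_one]

theorem counit_rho (x : D.F) : TensorProduct.lid QField D.F (TensorProduct.map
    (FreeAlgebra.algebraMapInv (R := QField) (X := D.Iinf)).toLinearMap LinearMap.id (D.rho x)) =
      x := by
  induction x using D.F_induction with
  | one => simp [rho_one]
  | add x y hx hy => simp [hx, hy]
  | smul r x hx => simp [hx]
  | mul g x hx =>
    rw [rho_gen_mul]
    conv_rhs => rw [← hx]
    generalize D.rho x = z
    induction z using TensorProduct.induction_on with
    | zero => simp
    | add a b ha hb => simp only [map_add, ha, hb, mul_add]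
    | tmul a b =>
      have h0 : FreeAlgebra.algebraMapInv (D.gen g) = (0 : QField) := by
        simp [FreeAlgebra.algebraMapInv]
      simp [primMul, h0, counit_twist]

theorem contr_gen_mul (g h : D.Iinf) (x : D.F) :
    D.contr g (D.gen h * x) =
      (if h = g then D.tau g • x else 0) + D.braid h g • (D.gen h * D.contr g x) := by
  have h1 : (if h = g then D.tau g • x else 0) = (if h = g then D.tau g else 0) •
      TensorProduct.lid QField D.F (TensorProduct.map
    (FreeAlgebra.algebraMapInv (R := QField) (X := D.Iinf)).toLinearMap LinearMap.id (D.rho x)) := by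
    rw [counit_rho]; split_ifs <;> simp
  rw [h1]
  simp only [contr, LinearMap.comp_apply, rho_gen_mul]
  generalize D.rho x = z
  induction z using TensorProduct.induction_on with
  | zero => simp
  | add a b ha hb => simp only [map_add, ha, hb, mul_add, smul_add]; abel
  | tmul a b =>
    simp [primMul, xi_gen_mul, xi_twist, smul_smul]

theorem form_gen_mul' (g : D.Iinf) (x y : D.F) :
    D.form x (D.gen g * y) = D.form (D.contr g x) y := by
  rw [form_gen_mul]
  simp only [contr, LinearMap.comp_apply]
  generalize D.rho x = z
  induction z using TensorProduct.induction_on with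
  | zero => simp
  | add a b ha hb => simp only [map_add, ha, hb, LinearMap.add_apply]
  | tmul a b => simp

theorem form_one_left (x : D.F) : D.form 1 x = FreeAlgebra.algebraMapInv x := by
  induction x using D.F_induction with
  | one => simp [form_one]
  | add x y hx hy => simp [hx, hy]
  | smul r x hx => simp [hx]
  | mul g x hx =>
    rw [form_gen_mul', contr_one]; simp [FreeAlgebra.algebraMapInv]

theorem form_gen_mul_left (g : D.Iinf) (x y : D.F) :
    D.form (D.gen g * x) y = D.form x (D.contr g y) := by
  induction y using D.F_induction generalizing x with
  | one => simp [form_one, contr_one, FreeAlgebra.algebraMapInv]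
  | add y z hy hz => simp [hy, hz]
  | smul r y hy => simp [hy]
  | mul h y hy =>
    rw [form_gen_mul', contr_gen_mul, contr_gen_mul]
    simp only [map_add, map_smul, LinearMap.add_apply, LinearMap.smul_apply, hy, form_gen_mul']
    rw [D.braid_comm]
    congr 1
    by_cases e : h = g
    · subst e; simp
    · rw [if_neg e, if_neg (Ne.symm e)]; simp

theorem form_symm (x y : D.F) : D.form x y = D.form y x := by
  induction x using D.F_induction generalizing y with
  | one => rw [form_one, form_one_left]
  | add x z hx hz => simp [hx, hz]
  | smul r x hx => simp [hx]
  | mul g x hx => rw [form_gen_mul_left, form_gen_mul', hx]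

theorem form_gen_gen (g h : D.Iinf) :
    D.form (D.gen g) (D.gen h) = if g = h then D.tau g else 0 := by
  have := D.form_gen_mul' h (D.gen g) 1
  rw [mul_one] at this
  rw [this, form_one, ← mul_one (D.gen g), contr_gen_mul, contr_one]
  split_ifs with e
  · subst e; simp
  · simp

theorem contr_twist (g h : D.Iinf) (x : D.F) :
    D.contr g (D.twist h x) = D.braid h g • D.twist h (D.contr g x) := by
  induction x using D.F_induction with
  | one => simp [contr_one]
  | add x y hx hy => simp [hx, hy]
  | smul r x hx => rw [map_smul, map_smul, hx, map_smul, map_smul, smul_comm]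
  | mul k x hx =>
    have e : D.twist h (D.gen k) = D.braid h k • D.gen k := by simp [twist]
    rw [map_mul, e, smul_mul_assoc, map_smul, contr_gen_mul, contr_gen_mul, hx, map_add, map_smul,
      map_mul, e]
    by_cases hk : k = g
    · subst hk
      simp only [if_true, map_smul, mul_smul_comm, smul_mul_assoc, smul_add, smul_smul]
    · simp only [if_neg hk, map_zero, mul_smul_comm, smul_mul_assoc, zero_add, smul_smul]
      congr 1
      ring

theorem rho_contr (g : D.Iinf) (x : D.F) :
    D.rho (D.contr g x) = TensorProduct.map (D.contr g) LinearMap.id (D.rho x) := by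
  induction x using D.F_induction with
  | one => simp [contr_one, rho_one]
  | add x y hx hy => simp [hx, hy]
  | smul r x hx => simp [hx]
  | mul h x hx =>
    have e : D.rho (D.contr g (D.gen h * x)) = (if h = g then D.tau g else 0) • D.rho x +
        D.braid g h • D.primMul h (TensorProduct.map (D.contr g) LinearMap.id (D.rho x)) := by
      rw [contr_gen_mul, map_add, map_smul, rho_gen_mul, hx]
      split_ifs <;> simp [D.braid_comm g h]
    rw [e, rho_gen_mul]
    generalize D.rho x = z
    induction z using TensorProduct.induction_on with
    | zero => simp
    | add a b ha hb => simp only [map_add, smul_add, ← ha, ← hb]; abel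
    | tmul a b =>
      simp only [primMul, LinearMap.add_apply, TensorProduct.map_tmul, LinearMap.mulLeft_apply,
        LinearMap.id_apply, AlgHom.toLinearMap_apply, map_add, contr_gen_mul, contr_twist,
        TensorProduct.add_tmul, smul_add, TensorProduct.smul_tmul', D.braid_comm h g]
      split_ifs <;> simp [add_assoc]

/-- The form satisfies `(x, yy') = (ϱ(x), y ⊗ y')`. -/
theorem form_mul_right (x y y' : D.F) :
    D.form x (y * y') = LinearMap.mul' QField QField
      (TensorProduct.map (D.form.flip y) (D.form.flip y') (D.rho x)) := by
  induction y using D.F_induction generalizing x with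
  | one =>
    rw [one_mul]
    conv_lhs => rw [← D.counit_rho x]
    generalize D.rho x = z
    induction z using TensorProduct.induction_on with
    | zero => simp
    | add a b ha hb => simp only [map_add, ← ha, ← hb, LinearMap.add_apply]
    | tmul a b => simp [form_one]
  | add y z hy hz =>
    simp only [add_mul, map_add, hy, hz, TensorProduct.map_add_left, LinearMap.add_apply]
  | smul r y hy =>
    simp only [smul_mul_assoc, map_smul, hy, TensorProduct.map_smul_left, LinearMap.smul_apply]
  | mul g y hy =>
    rw [mul_assoc, form_gen_mul', hy, rho_contr]
    generalize D.rho x = z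
    induction z using TensorProduct.induction_on with
    | zero => simp
    | add a b ha hb => simp only [map_add, ha, hb]
    | tmul a b => simp [form_gen_mul']

/-- The form satisfies `(xx', y) = (x ⊗ x', ϱ(y))`. -/
theorem form_mul_left (x x' y : D.F) :
    D.form (x * x') y = LinearMap.mul' QField QField
      (TensorProduct.map (D.form x) (D.form x') (D.rho y)) := by
  have e : ∀ z, D.form z = D.form.flip z := fun z => by ext w; exact D.form_symm z w
  rw [form_symm, form_mul_right, e x, e x']

/-- The radical `ℛ` of the form on `F`. -/
noncomputable def radical : Submodule QField D.F := LinearMap.ker D.form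

/-- The vector space `F / ℛ`, that is, the algebra `U⁺`. -/
abbrev FmodR : Type _ := D.F ⧸ D.radical

/-- The nondegenerate form on `F / ℛ` induced by the form on `F`. -/
noncomputable def formR : D.FmodR →ₗ[QField] D.FmodR →ₗ[QField] QField :=
  D.radical.liftQ (D.radical.liftQ D.form le_rfl).flip (by
    intro x hx
    rw [LinearMap.mem_ker]
    refine Submodule.linearMap_qext _ (LinearMap.ext fun y => ?_)
    have h : D.form x y = 0 := by rw [show D.form x = 0 from hx]; rfl
    exact (D.form_symm y x).trans h)

/-- The monoid `ℕ I^∞` of degrees. -/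
abbrev Deg : Type _ := D.Iinf →₀ ℕ

/-- The number of generators, `ht(∑ ν_{il} (i, l)) = ∑ ν_{il}`. -/
def ht (ν : D.Deg) : ℕ := ν.sum fun _ n => n

/-- For `ν = ∑_{p} (i_p, l_p)`, the number `e(ν) = ∑_{p < q} p(l_p α_p) p(l_q α_q)` of pairs of odd
terms, that is, `n(n-1)/2` where `n` is the number of odd terms. -/
def e (ν : D.Deg) : ℕ := (ν.sum fun g n => (D.par g).val * n).choose 2

/-- The space `F_ν`, spanned by the words in the generators `a_{il}` in which each `a_{il}` occurs
`ν_{il}` times. -/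
noncomputable def Fdeg (ν : D.Deg) : Submodule QField D.F :=
  Submodule.span QField
    {x | ∃ w : List D.Iinf, (∀ g, w.count g = ν g) ∧ x = (w.map D.gen).prod}

/-- The image of `F_ν` in `F / ℛ`. -/
noncomputable def FmodRdeg (ν : D.Deg) : Submodule QField D.FmodR :=
  (D.Fdeg ν).map D.radical.mkQ

/-- The Gaussian binomial coefficient `[a; t]_i`. -/
noncomputable def qbinom (i : I) (a : ℤ) (t : ℕ) : QField :=
  (∏ s ∈ Finset.range t, ((sgn (D.p i) * D.qi i) ^ (a - s) - D.qi i ^ ((s : ℤ) - a))) /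
    ∏ s ∈ Finset.range t, ((sgn (D.p i) * D.qi i) ^ ((s : ℤ) + 1) - D.qi i ^ (-((s : ℤ) + 1)))

/-- The generators `a_{il}`, `b_{il}`, `q^h` of the quantum Borcherds–Bozec superalgebra. -/
inductive Gen (D : SuperBorcherdsCartanDatum I P) : Type _
  | a (g : D.Iinf)
  | b (g : D.Iinf)
  | q (h : Module.Dual ℤ P)

/-- The free algebra on the generators `a_{il}`, `b_{il}`, `q^h`. -/
abbrev FreeU : Type _ := FreeAlgebra QField D.Gen

/-- The generator `a_{il}`, in the free algebra. -/
noncomputable abbrev fa (g : D.Iinf) : D.FreeU := FreeAlgebra.ι QField (Gen.a g)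

/-- The generator `b_{il}`, in the free algebra. -/
noncomputable abbrev fb (g : D.Iinf) : D.FreeU := FreeAlgebra.ι QField (Gen.b g)

/-- The generator `q^h`, in the free algebra. -/
noncomputable abbrev fq (h : Module.Dual ℤ P) : D.FreeU := FreeAlgebra.ι QField (Gen.q h)

/-- The coweight `l d_i h_i`, so that `K_i^l = q^{l d_i h_i}`. -/
noncomputable def cow (g : D.Iinf) : Module.Dual ℤ P :=
  (D.lev g * D.d (D.idx g)) • D.coroot (D.idx g)

/-- For `g = (i, 1)` with `i` real and `h = (j, k)`, and for `x`, `y` standing for the generators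
of index `g` and `h`, the quantum Serre expression
`∑_{t+t'=1-k a_{ij}} (-1)^{t'} (-1)^{p(i)(t' p(kj) + binom(t', 2))} [1-k a_{ij}; t']_i x^t y x^{t'}`. -/
noncomputable def serre (g h : D.Iinf) (x y : D.FreeU) : D.FreeU :=
  ∑ t ∈ Finset.HasAntidiagonal.antidiagonal (1 - D.lev h * D.A (D.idx g) (D.idx h)).toNat,
    ((-1) ^ t.2 * sgn (D.p (D.idx g) * (t.2 * D.par h + (t.2.choose 2 : ℕ))) *
      D.qbinom (D.idx g) (1 - D.lev h * D.A (D.idx g) (D.idx h)) t.2) • (x ^ t.1 * y * x ^ t.2)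

/-- The relations of the quantum Borcherds–Bozec superalgebra: the Cartan relations, the Serre
relations, the supercommutation relations, and (so that the subalgebras generated by the `a_{il}`
and by the `b_{il}` are copies of `F / ℛ`) the vanishing of the elements of the radical `ℛ`,
evaluated in the `a_{il}` or in the `b_{il}`. -/
inductive Rel (D : SuperBorcherdsCartanDatum I P) : D.FreeU → D.FreeU → Prop
  | q_zero : Rel D (D.fq 0) 1
  | q_add (h h' : Module.Dual ℤ P) : Rel D (D.fq h * D.fq h') (D.fq (h + h'))
  | q_a (h : Module.Dual ℤ P) (g : D.Iinf) :
      Rel D (D.fq h * D.fa g * D.fq (-h)) (qVar ^ (D.lev g * h (D.root (D.idx g))) • D.fa g)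
  | q_b (h : Module.Dual ℤ P) (g : D.Iinf) :
      Rel D (D.fq h * D.fb g * D.fq (-h)) (qVar ^ (-(D.lev g * h (D.root (D.idx g)))) • D.fb g)
  | serre_a (g h : D.Iinf) (hg : D.A (D.idx g) (D.idx g) = 2) (hgh : g ≠ h) :
      Rel D (D.serre g h (D.fa g) (D.fa h)) 0
  | serre_b (g h : D.Iinf) (hg : D.A (D.idx g) (D.idx g) = 2) (hgh : g ≠ h) :
      Rel D (D.serre g h (D.fb g) (D.fb h)) 0
  | comm_a (g h : D.Iinf) (hgh : D.A (D.idx g) (D.idx h) = 0) :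
      Rel D (D.fa g * D.fa h - sgn (D.par g * D.par h) • (D.fa h * D.fa g)) 0
  | comm_b (g h : D.Iinf) (hgh : D.A (D.idx g) (D.idx h) = 0) :
      Rel D (D.fb g * D.fb h - sgn (D.par g * D.par h) • (D.fb h * D.fb g)) 0
  | a_b (g h : D.Iinf) :
      Rel D (D.fa g * D.fb h - sgn (D.par g * D.par h) • (D.fb h * D.fa g))
        (if g = h then D.tau g • (D.fq (D.cow g) - D.fq (-D.cow g)) else 0)
  | radical_a (x : D.F) (hx : x ∈ D.radical) : Rel D (FreeAlgebra.lift QField D.fa x) 0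
  | radical_b (x : D.F) (hx : x ∈ D.radical) : Rel D (FreeAlgebra.lift QField D.fb x) 0

/-- The quantum Borcherds–Bozec superalgebra `U`. -/
abbrev U : Type _ := RingQuot D.Rel

/-- The generator `a_{il}` of `U`. -/
noncomputable def a (g : D.Iinf) : D.U := RingQuot.mkAlgHom QField D.Rel (D.fa g)

/-- The generator `b_{il}` of `U`. -/
noncomputable def b (g : D.Iinf) : D.U := RingQuot.mkAlgHom QField D.Rel (D.fb g)

/-- The element `q^h` of `U`. -/
noncomputable def qpow (h : Module.Dual ℤ P) : D.U := RingQuot.mkAlgHom QField D.Rel (D.fq h)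

/-- The element `K_i^l = q^{l d_i h_i}` of `U`. -/
noncomputable def K (g : D.Iinf) : D.U := D.qpow (D.cow g)

/-- The element `K_i^{-l}` of `U`. -/
noncomputable def Kinv (g : D.Iinf) : D.U := D.qpow (-D.cow g)

/-- The sign automorphism of `F`, multiplying `x` by `(-1)^{p(x)}`. -/
noncomputable def signF : D.F →ₐ[QField] D.F :=
  FreeAlgebra.lift QField fun g => sgn (D.par g) • D.gen g

theorem contr_signF (g : D.Iinf) (x : D.F) :
    D.contr g (D.signF x) = sgn (D.par g) • D.signF (D.contr g x) := by
  induction x using D.F_induction with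
  | one => simp [contr_one]
  | add x y hx hy => simp [hx, hy]
  | smul r x hx => rw [map_smul, map_smul, hx, map_smul, map_smul, smul_comm]
  | mul k x hx =>
    have e : D.signF (D.gen k) = sgn (D.par k) • D.gen k := by simp [signF]
    rw [map_mul, e, smul_mul_assoc, map_smul, contr_gen_mul, contr_gen_mul, hx, map_add, map_smul,
      map_mul, e]
    by_cases hk : k = g
    · subst hk
      simp only [if_true, map_smul, mul_smul_comm, smul_mul_assoc, smul_add, smul_smul]
    · simp only [if_neg hk, map_zero, mul_smul_comm, smul_mul_assoc, zero_add, smul_smul]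
      congr 1
      ring

theorem form_signF (x y : D.F) : D.form (D.signF x) y = D.form x (D.signF y) := by
  induction y using D.F_induction generalizing x with
  | one =>
    rw [map_one D.signF, form_one, form_one]
    induction x using D.F_induction with
    | one => simp
    | add x y hx hy => simp [hx, hy]
    | smul r x hx => simp [hx]
    | mul h x hx => simp [signF, FreeAlgebra.algebraMapInv]
  | add y z hy hz => simp [hy, hz]
  | smul r y hy => simp [hy]
  | mul g y hy =>
    have e : D.signF (D.gen g) = sgn (D.par g) • D.gen g := by simp [signF]
    rw [form_gen_mul', contr_signF, map_mul, e, smul_mul_assoc, map_smul, map_smul,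
      form_gen_mul', LinearMap.smul_apply, hy]

theorem signF_mem_radical {x : D.F} (hx : x ∈ D.radical) : D.signF x ∈ D.radical := by
  refine LinearMap.mem_ker.mpr (LinearMap.ext fun y => ?_)
  rw [form_signF, show D.form x = 0 from hx]
  rfl

theorem sgn_mul_self (x : ZMod 2) : sgn x * sgn x = 1 := by
  unfold sgn; rw [← mul_pow]; simp

/-- The parity of a generator of `U`. -/
def genPar : D.Gen → ZMod 2
  | Gen.a g => D.par g
  | Gen.b g => D.par g
  | Gen.q _ => 0

/-- The sign automorphism of the free algebra. -/
noncomputable def signFree : D.FreeU →ₐ[QField] D.FreeU :=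
  FreeAlgebra.lift QField fun g => sgn (D.genPar g) • FreeAlgebra.ι QField g

theorem sgn_add (x y : ZMod 2) : sgn (x + y) = sgn x * sgn y := by
  unfold sgn
  rw [← pow_add, ZMod.val_add, ← neg_one_pow_eq_pow_mod_two]

theorem signFree_serre (g h : D.Iinf) (x y : D.FreeU)
    (hx : D.signFree x = sgn (D.par g) • x) (hy : D.signFree y = sgn (D.par h) • y) :
    D.signFree (D.serre g h x y) = (sgn (D.par g) ^ (1 - D.lev h * D.A (D.idx g) (D.idx h)).toNat *
      sgn (D.par h)) • D.serre g h x y := by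
  unfold serre
  rw [map_sum, Finset.smul_sum]
  refine Finset.sum_congr rfl fun t ht => ?_
  rw [← Finset.HasAntidiagonal.mem_antidiagonal.mp ht, map_smul, map_mul, map_mul, map_pow, map_pow, hx, hy,
    smul_pow, smul_pow, pow_add]
  simp only [smul_mul_assoc, mul_smul_comm, smul_smul]
  congr 1
  ring

/-- The sign automorphism of `U`, multiplying `x` by `(-1)^{p(x)}`. -/
noncomputable def signU : D.U →ₐ[QField] D.U :=
  RingQuot.liftAlgHom QField ⟨(RingQuot.mkAlgHom QField D.Rel).comp D.signFree, by
    have ha : ∀ g, D.signFree (D.fa g) = sgn (D.par g) • D.fa g := fun g => by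
      simp [signFree, genPar]
    have hb : ∀ g, D.signFree (D.fb g) = sgn (D.par g) • D.fb g := fun g => by
      simp [signFree, genPar]
    have hq : ∀ h, D.signFree (D.fq h) = D.fq h := fun h => by
      simp [signFree, genPar, sgn]
    have hla : ∀ x, D.signFree (FreeAlgebra.lift QField D.fa x) =
        FreeAlgebra.lift QField D.fa (D.signF x) := by
      refine DFunLike.congr_fun (F := D.F →ₐ[QField] D.FreeU)
        (f := D.signFree.comp (FreeAlgebra.lift QField D.fa))
        (g := (FreeAlgebra.lift QField D.fa).comp D.signF) (FreeAlgebra.hom_ext ?_)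
      funext g; simp [ha, signF]
    have hlb : ∀ x, D.signFree (FreeAlgebra.lift QField D.fb x) =
        FreeAlgebra.lift QField D.fb (D.signF x) := by
      refine DFunLike.congr_fun (F := D.F →ₐ[QField] D.FreeU)
        (f := D.signFree.comp (FreeAlgebra.lift QField D.fb))
        (g := (FreeAlgebra.lift QField D.fb).comp D.signF) (FreeAlgebra.hom_ext ?_)
      funext g; simp [hb, signF]
    have key : ∀ {x y : D.FreeU} (c : QField), D.Rel x y → D.signFree x = c • x →
        D.signFree y = c • y → (RingQuot.mkAlgHom QField D.Rel).comp D.signFree x =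
          (RingQuot.mkAlgHom QField D.Rel).comp D.signFree y := by
      intro x y c h hx hy
      rw [AlgHom.comp_apply, AlgHom.comp_apply, hx, hy, map_smul, map_smul,
        RingQuot.mkAlgHom_rel QField h]
    intro x y hxy
    cases hxy with
    | q_zero => exact key 1 .q_zero (by rw [hq, one_smul]) (by rw [map_one, one_smul])
    | q_add h h' =>
      exact key 1 (.q_add h h') (by rw [map_mul, hq, hq, one_smul]) (by rw [hq, one_smul])
    | q_a h g =>
      exact key (sgn (D.par g)) (.q_a h g) (by rw [map_mul, map_mul, hq, hq, ha]; simp)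
        (by rw [map_smul, ha, smul_comm])
    | q_b h g =>
      exact key (sgn (D.par g)) (.q_b h g) (by rw [map_mul, map_mul, hq, hq, hb]; simp)
        (by rw [map_smul, hb, smul_comm])
    | serre_a g h hg hgh =>
      exact key _ (.serre_a g h hg hgh) (D.signFree_serre g h _ _ (ha g) (ha h)) (by simp)
    | serre_b g h hg hgh =>
      exact key _ (.serre_b g h hg hgh) (D.signFree_serre g h _ _ (hb g) (hb h)) (by simp)
    | comm_a g h hgh =>
      refine key (sgn (D.par g) * sgn (D.par h)) (.comm_a g h hgh) ?_ (by simp)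
      rw [map_sub, map_smul, map_mul, map_mul, ha, ha]
      simp only [smul_mul_assoc, mul_smul_comm, smul_smul, smul_sub]
      congr 2 <;> ring
    | comm_b g h hgh =>
      refine key (sgn (D.par g) * sgn (D.par h)) (.comm_b g h hgh) ?_ (by simp)
      rw [map_sub, map_smul, map_mul, map_mul, hb, hb]
      simp only [smul_mul_assoc, mul_smul_comm, smul_smul, smul_sub]
      congr 2 <;> ring
    | a_b g h =>
      refine key (sgn (D.par g) * sgn (D.par h)) (.a_b g h) ?_ ?_
      · rw [map_sub, map_smul, map_mul, map_mul, ha, hb]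
        simp only [smul_mul_assoc, mul_smul_comm, smul_smul, smul_sub]
        congr 2 <;> ring
      · split_ifs with e
        · subst e
          rw [map_smul, map_sub, hq, hq, sgn_mul_self, one_smul]
        · simp
    | radical_a x hx =>
      rw [AlgHom.comp_apply, hla, RingQuot.mkAlgHom_rel QField
        (Rel.radical_a _ (D.signF_mem_radical hx))]
      simp
    | radical_b x hx =>
      rw [AlgHom.comp_apply, hlb, RingQuot.mkAlgHom_rel QField
        (Rel.radical_b _ (D.signF_mem_radical hx))]
      simp⟩

theorem signU_signU (x : D.U) : D.signU (D.signU x) = x := by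
  have h : D.signU.comp D.signU = AlgHom.id QField D.U := by
    refine RingQuot.ringQuot_ext' QField _ _ (FreeAlgebra.hom_ext ?_)
    funext g
    simp [signU, signFree, smul_smul, sgn_mul_self]
  exact DFunLike.congr_fun h x

/-- The parity grading of `U`: `x` has parity `i` when the sign automorphism multiplies it by
`(-1)^i`. -/
noncomputable def parity (i : ZMod 2) : Submodule QField D.U :=
  LinearMap.ker (D.signU.toLinearMap - sgn i • LinearMap.id)

theorem mem_parity {i : ZMod 2} {x : D.U} : x ∈ D.parity i ↔ D.signU x = sgn i • x := by
  simp [parity, sub_eq_zero]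

/-- The linear projection of `U` onto its part of parity `i`. -/
noncomputable def parityProj (i : ZMod 2) : D.U →ₗ[QField] D.parity i :=
  LinearMap.codRestrict _ ((2⁻¹ : QField) • (LinearMap.id + sgn i • D.signU.toLinearMap)) (by
    intro x
    rw [mem_parity]
    simp only [LinearMap.smul_apply, LinearMap.add_apply, LinearMap.id_apply,
      AlgHom.toLinearMap_apply, map_smul, map_add, signU_signU, smul_add, smul_smul]
    rw [add_comm, mul_left_comm, sgn_mul_self, mul_one, mul_comm])

theorem parityProj_coe (i : ZMod 2) (x : D.U) :
    (D.parityProj i x : D.U) = (2⁻¹ : QField) • (x + sgn i • D.signU x) := rfl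

theorem parityProj_self (i : ZMod 2) (x : D.parity i) : D.parityProj i x = x := by
  apply Subtype.ext
  rw [parityProj_coe, D.mem_parity.mp x.2, smul_smul, sgn_mul_self, one_smul, ← two_smul QField,
    smul_smul, inv_mul_cancel₀ two_ne_zero, one_smul]

theorem parityProj_ne (i j : ZMod 2) (h : sgn i * sgn j = -1) (x : D.parity j) :
    D.parityProj i x = 0 := by
  apply Subtype.ext
  rw [parityProj_coe, D.mem_parity.mp x.2, smul_smul, h, neg_one_smul, add_neg_cancel, smul_zero]
  rfl

theorem sgn_zero : sgn 0 = 1 := by simp [sgn]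

theorem sgn_one : sgn 1 = -1 := by simp [sgn, ZMod.val_one]

noncomputable instance : GradedAlgebra D.parity where
  one_mem := by simp [mem_parity, sgn]
  mul_mem i j x y hx hy := by
    rw [mem_parity] at *
    rw [map_mul, hx, hy, smul_mul_smul_comm, sgn_add]
  toDecomposition := DirectSum.Decomposition.ofLinearMap _
    (DirectSum.lof QField (ZMod 2) (fun i => D.parity i) 0 ∘ₗ D.parityProj 0 +
      DirectSum.lof QField (ZMod 2) (fun i => D.parity i) 1 ∘ₗ D.parityProj 1) (by
      refine LinearMap.ext fun x => ?_
      rw [LinearMap.comp_apply, LinearMap.add_apply, map_add, LinearMap.comp_apply,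
        LinearMap.comp_apply, DirectSum.coeLinearMap_lof, DirectSum.coeLinearMap_lof,
        parityProj_coe, parityProj_coe]
      have e0 : sgn 0 • D.signU x = D.signU x := by rw [sgn_zero, one_smul]
      have e1 : sgn 1 • D.signU x = -D.signU x := by
        rw [sgn_one]; exact neg_one_smul QField (D.signU x)
      rw [e0, e1, ← smul_add, LinearMap.id_apply, add_add_add_comm, add_neg_cancel,
        add_zero, ← two_smul QField, smul_smul, inv_mul_cancel₀ two_ne_zero, one_smul]) (by
      have h01 : ∀ j : ZMod 2, j = 0 ∨ j = 1 := by decide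
      refine DirectSum.linearMap_ext _ fun j => LinearMap.ext fun x => ?_
      rw [LinearMap.comp_apply, LinearMap.comp_apply, DirectSum.coeLinearMap_lof,
        LinearMap.add_apply, LinearMap.comp_apply, LinearMap.comp_apply]
      obtain rfl | rfl := h01 j
      · rw [D.parityProj_ne 1 0 (by simp [sgn_zero, sgn_one])]
        rw [D.parityProj_self 0]
        simp
      · rw [D.parityProj_ne 0 1 (by simp [sgn_zero, sgn_one])]
        rw [D.parityProj_self 1]
        simp)

/-- The tensor product `U ⊗ U`, regarded as a superalgebra in the standard way:
`(x₁ ⊗ x₂)(x₃ ⊗ x₄) = (-1)^{p(x₂) p(x₃)} x₁x₃ ⊗ x₂x₄`. -/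
abbrev UU : Type _ := GradedTensorProduct QField D.parity D.parity

/-- The pure tensor `x ⊗ y ∈ U ⊗ U`. -/
noncomputable def pureTensor (x y : D.U) : D.UU := GradedTensorProduct.tmul QField x y

/-- The subspace `V ⊗ W` of `U ⊗ U`. -/
noncomputable def tens (V W : Submodule QField D.U) : Submodule QField D.UU :=
  Submodule.span QField {z | ∃ x ∈ V, ∃ y ∈ W, z = D.pureTensor x y}

/-- The map `x ↦ x⁺` from `F / ℛ` to `U`, with `a_{il}⁺ = a_{il}`. -/
noncomputable def plus : D.FmodR →ₗ[QField] D.U :=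
  D.radical.liftQ ((RingQuot.mkAlgHom QField D.Rel).comp
    (FreeAlgebra.lift QField D.fa)).toLinearMap fun x hx => by
      rw [LinearMap.mem_ker, AlgHom.toLinearMap_apply, AlgHom.comp_apply,
        RingQuot.mkAlgHom_rel QField (Rel.radical_a x hx), map_zero]

/-- The map `x ↦ x⁻` from `F / ℛ` to `U`, with `a_{il}⁻ = b_{il}`. -/
noncomputable def minus : D.FmodR →ₗ[QField] D.U :=
  D.radical.liftQ ((RingQuot.mkAlgHom QField D.Rel).comp
    (FreeAlgebra.lift QField D.fb)).toLinearMap fun x hx => by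
      rw [LinearMap.mem_ker, AlgHom.toLinearMap_apply, AlgHom.comp_apply,
        RingQuot.mkAlgHom_rel QField (Rel.radical_b x hx), map_zero]

/-- The subspace `U⁺_ν` of `U`. -/
noncomputable def Upos (ν : D.Deg) : Submodule QField D.U := (D.FmodRdeg ν).map D.plus

/-- The subspace `U⁻_ν` of `U` (its elements have weight `-ν`). -/
noncomputable def Uneg (ν : D.Deg) : Submodule QField D.U := (D.FmodRdeg ν).map D.minus

/-- The subalgebra `U⁰`, spanned by the `q^h`. -/
noncomputable def Uzero : Submodule QField D.U := Submodule.span QField (Set.range D.qpow)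

/-- For a finite set `S` of degrees, the subspace
`(U⁺ U⁰ ∑_{ν ∉ S} U⁻_ν) ⊗ U + U ⊗ (U⁻ U⁰ ∑_{ν ∉ S} U⁺_ν)` of `U ⊗ U`. -/
noncomputable def H (S : Finset D.Deg) : Submodule QField D.UU :=
  D.tens (LinearMap.range D.plus * D.Uzero * ⨆ ν ∉ S, D.Uneg ν) ⊤ ⊔
    D.tens ⊤ (LinearMap.range D.minus * D.Uzero * ⨆ ν ∉ S, D.Upos ν)

theorem tens_mono {V V' W W' : Submodule QField D.U} (hV : V ≤ V') (hW : W ≤ W') :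
    D.tens V W ≤ D.tens V' W' :=
  Submodule.span_mono fun _ ⟨x, hx, y, hy, h⟩ => ⟨x, hV hx, y, hW hy, h⟩

theorem H_anti {S T : Finset D.Deg} (h : S ⊆ T) : D.H T ≤ D.H S := by
  refine sup_le_sup (D.tens_mono (mul_le_mul' le_rfl ?_) le_rfl)
    (D.tens_mono le_rfl (mul_le_mul' le_rfl ?_)) <;>
  exact iSup₂_mono' fun ν hν => ⟨ν, fun hS => hν (h hS), le_rfl⟩

open Classical in
/-- The subspaces `H_S` form a basis of neighbourhoods of `0` for a group topology on `U ⊗ U`. -/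
noncomputable instance : AddGroupFilterBasis D.UU :=
  addGroupFilterBasisOfComm {V | ∃ S, V = (D.H S : Set D.UU)} ⟨_, ∅, rfl⟩
    (by
      rintro _ _ ⟨S, rfl⟩ ⟨T, rfl⟩
      exact ⟨_, ⟨S ∪ T, rfl⟩, Set.subset_inter (D.H_anti Finset.subset_union_left)
        (D.H_anti Finset.subset_union_right)⟩)
    (by rintro _ ⟨S, rfl⟩; exact (D.H S).zero_mem)
    (by
      rintro _ ⟨S, rfl⟩
      refine ⟨_, ⟨S, rfl⟩, ?_⟩
      rintro _ ⟨x, hx, y, hy, rfl⟩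
      exact (D.H S).add_mem hx hy)
    (by rintro _ ⟨S, rfl⟩; exact ⟨_, ⟨S, rfl⟩, fun x hx => (D.H S).neg_mem hx⟩)

/-- The topology on `U ⊗ U` in which the `H_S` are a basis of neighbourhoods of `0`. -/
noncomputable instance : TopologicalSpace D.UU := AddGroupFilterBasis.topology inferInstance

instance : IsTopologicalAddGroup D.UU := AddGroupFilterBasis.isTopologicalAddGroup _

noncomputable instance : UniformSpace D.UU := IsTopologicalAddGroup.rightUniformSpace D.UU

instance : IsUniformAddGroup D.UU := isUniformAddGroup_of_addCommGroup

/-- The completion `U ⊗̂ U` of `U ⊗ U` with respect to the subspaces `H_S`. -/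
abbrev UUhat : Type _ := UniformSpace.Completion D.UU

/-- The product `z Θ` of `z ∈ U ⊗ U` and `Θ ∈ U ⊗̂ U`: the extension by continuity of the left
multiplication by `z` on `U ⊗ U`. -/
noncomputable def leftMul (z : D.UU) : D.UUhat → D.UUhat := UniformSpace.Completion.map (z * ·)

/-- The product `Θ z` of `Θ ∈ U ⊗̂ U` and `z ∈ U ⊗ U`: the extension by continuity of the right
multiplication by `z` on `U ⊗ U`. -/
noncomputable def rightMul (z : D.UU) : D.UUhat → D.UUhat := UniformSpace.Completion.map (· * z)

/-- `Δ` is the comultiplication of `U`. -/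
structure IsComul (Δ : D.U →ₐ[QField] D.UU) : Prop where
  q : ∀ h, Δ (D.qpow h) = D.pureTensor (D.qpow h) (D.qpow h)
  a : ∀ g, Δ (D.a g) = D.pureTensor (D.a g) 1 + D.pureTensor (D.K g) (D.a g)
  b : ∀ g, Δ (D.b g) = D.pureTensor (D.b g) (D.Kinv g) + D.pureTensor 1 (D.b g)

/-- `Δ'` is the bar-conjugate comultiplication `Δ̄` of `U`: it is obtained from the
comultiplication by exchanging `K_i^l` and `K_i^{-l}`. -/
structure IsBarComul (Δ' : D.U →ₐ[QField] D.UU) : Prop where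
  q : ∀ h, Δ' (D.qpow h) = D.pureTensor (D.qpow h) (D.qpow h)
  a : ∀ g, Δ' (D.a g) = D.pureTensor (D.a g) 1 + D.pureTensor (D.Kinv g) (D.a g)
  b : ∀ g, Δ' (D.b g) = D.pureTensor (D.b g) (D.K g) + D.pureTensor 1 (D.b g)

/-- The family `Θ_ν ∈ U⁻_ν ⊗ U⁺_ν` satisfies `Θ_0 = 1 ⊗ 1`, its sum `Θ` exists in `U ⊗̂ U`, and
`Δ(u) Θ = Θ Δ̄(u)` for all `u ∈ U`. -/
structure IsQuasiR (Δ Δ' : D.U →ₐ[QField] D.UU) (Θ : D.Deg → D.UU) : Prop where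
  mem : ∀ ν, Θ ν ∈ D.tens (D.Uneg ν) (D.Upos ν)
  zero : Θ 0 = D.pureTensor 1 1
  intertwines : ∃ Θhat : D.UUhat, HasSum (fun ν => (Θ ν : D.UUhat)) Θhat ∧
    ∀ u, D.leftMul (Δ u) Θhat = D.rightMul (Δ' u) Θhat

end SuperBorcherdsCartanDatum

/-! The argument is Lusztig's. For the form on `F`, left and right multiplication by `a_g` are
adjoint to the contractions `contr g` and `contrR g`, which are twisted derivations. Hence
multiplications, contractions, rescalings and degree projections all descend to `F / ℛ`, where the
form is nondegenerate and distinct degrees are orthogonal. The Serre and commutation expressions are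
killed by the counit and by every contraction, so they lie in `ℛ` (`serreF_mem_radical`,
`comm_mem_radical`). A homomorphism out of `U` therefore amounts to elements `a_g`, `b_g`, `q^h`
that satisfy the Cartan and `a`-`b` relations and kill `ℛ` (`CartanRels.liftU`).

Comultiplications: the proposed image of each `a_g` or `b_g` is a sum of two families that commute
up to the braiding factor. Such a sum kills `ℛ` if both families do, because `ϱ(ℛ)` vanishes in `F /
ℛ ⊗ F / ℛ` (`lift_add_radical`).

Existence: let `Γ_ν = ∑ b ⊗ b*`. Contracting its second leg with `y` returns the degree `ν` part of
`y` (`ctr_casimir`), and this property determines it. By adjointness, contracting one leg of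
`Γ_{κ+g}` is the same as multiplying the other leg of `Γ_κ` by `a_g`. In `U`, moving `a_g` past `y⁻`
produces the two contractions of `y` weighted by `K_g` and `K_g⁻¹` (`a_mul_minus`). So the
commutator of `a_g ⊗ 1` with `Γ_{κ+g}` is an expression in `Γ_κ`, and the sign `(-1)^{ht + e}` is
the one for which it cancels the `K_g^{±1} ⊗ a_g` terms in degree `κ` (`theta_a`; `theta_b` is the
same for `b_g`). The sum converges because `Θ_ν ∈ H_S` for `ν ∉ S`, and multiplication is continuous
for the `H_S`.

Uniqueness: `F / ℛ` carries a right `U`-module structure of highest weight `Λ`. Acting on its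
generator gives a map `psiNeg Λ` from `U` to `F / ℛ`; together with its mirror image `psiPos` it
gives a map `sep` on `U ⊗ U` that vanishes on `H_S` for large `S`. The intertwining identity can
thus be tested one degree at a time, without a triangular decomposition of `U`. For the difference
of two solutions, induction on the height leaves only the product of its degree `κ+g` part with `a_g
⊗ 1`. The image of that product has a part scaling with `Λ` as `q^{-n}` and a part scaling as `q^n`;
comparing `Λ = 0` with a fundamental weight shows that its contraction by `g` is zero. A tensor of
nonzero degree killed by all contractions is zero. -/

namespace SuperBorcherdsCartanDatum

variable {I : Type*} {P : Type*} [AddCommGroup P] [Module.Free ℤ P]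
variable (D : SuperBorcherdsCartanDatum I P)

/-! ### Rescaling automorphisms of the free algebra -/

/-- The rescaling endomorphism of `F`, multiplying the generator `a_h` by `χ h`. -/
noncomputable def scal (χ : D.Iinf → QField) : D.F →ₐ[QField] D.F :=
  FreeAlgebra.lift QField fun h => χ h • D.gen h

theorem scal_gen (χ : D.Iinf → QField) (h : D.Iinf) : D.scal χ (D.gen h) = χ h • D.gen h := by
  simp [scal]

theorem scal_gen_mul (χ : D.Iinf → QField) (h : D.Iinf) (x : D.F) :
    D.scal χ (D.gen h * x) = χ h • (D.gen h * D.scal χ x) := by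
  rw [map_mul, scal_gen, smul_mul_assoc]

theorem twist_eq_scal (g : D.Iinf) : D.twist g = D.scal (D.braid g) := rfl

theorem scal_scal (χ ψ : D.Iinf → QField) (x : D.F) :
    D.scal χ (D.scal ψ x) = D.scal (fun h => ψ h * χ h) x := by
  have : (D.scal χ).comp (D.scal ψ) = D.scal (fun h => ψ h * χ h) :=
    FreeAlgebra.hom_ext (funext fun h => by simp [scal, smul_smul])
  exact DFunLike.congr_fun this x

theorem scal_one (x : D.F) : D.scal (fun _ => 1) x = x := by
  have : D.scal (fun _ => 1) = AlgHom.id QField D.F :=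
    FreeAlgebra.hom_ext (funext fun h => by simp [scal])
  exact DFunLike.congr_fun this x

theorem contr_scal (χ : D.Iinf → QField) (g : D.Iinf) (x : D.F) :
    D.contr g (D.scal χ x) = χ g • D.scal χ (D.contr g x) := by
  induction x using D.F_induction with
  | one => simp [contr_one]
  | add x y hx hy => simp [hx, hy]
  | smul r x hx => rw [map_smul, map_smul, hx, map_smul, map_smul, smul_comm]
  | mul k x hx =>
    rw [scal_gen_mul, map_smul, contr_gen_mul, contr_gen_mul, hx, map_add, map_smul, scal_gen_mul]
    by_cases hk : k = g
    · subst hk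
      simp only [if_true, map_smul, mul_smul_comm, smul_add, smul_smul]
    · simp only [if_neg hk, map_zero, mul_smul_comm, zero_add, smul_smul]
      congr 1
      ring

theorem counit_scal (χ : D.Iinf → QField) (x : D.F) :
    FreeAlgebra.algebraMapInv (D.scal χ x) = FreeAlgebra.algebraMapInv (R := QField) x := by
  have : (FreeAlgebra.algebraMapInv (R := QField)).comp (D.scal χ) = FreeAlgebra.algebraMapInv :=
    FreeAlgebra.hom_ext (funext fun h => by simp [scal, FreeAlgebra.algebraMapInv])
  exact DFunLike.congr_fun this x

/-- A contraction by `g` picks up the same factor `χ g` as left multiplication by `a_g` on the other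
side. With a suitable `χ` this yields the orthogonality of distinct degrees, and it keeps `ℛ` stable
under all sign and weight twists. -/
theorem form_scal (χ : D.Iinf → QField) (x y : D.F) :
    D.form (D.scal χ x) y = D.form x (D.scal χ y) := by
  induction y using D.F_induction generalizing x with
  | one => rw [map_one (D.scal χ), form_one, form_one, counit_scal]
  | add y z hy hz => simp [hy, hz]
  | smul r y hy => simp [hy]
  | mul g y hy =>
    rw [form_gen_mul', contr_scal, scal_gen_mul, map_smul, map_smul, form_gen_mul',
      LinearMap.smul_apply, hy]

/-! ### The right contraction -/

/-- The operator `(id ⊗ ξ_g) ∘ ϱ` on `F`. -/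
noncomputable def contrR (g : D.Iinf) : D.F →ₗ[QField] D.F :=
  (TensorProduct.rid QField D.F).toLinearMap ∘ₗ
    TensorProduct.map LinearMap.id (D.xi g) ∘ₗ D.rho

theorem contrR_one (g : D.Iinf) : D.contrR g 1 = 0 := by simp [contrR, rho_one, xi_one]

theorem rho_counit (x : D.F) : TensorProduct.rid QField D.F (TensorProduct.map LinearMap.id
    (FreeAlgebra.algebraMapInv (R := QField) (X := D.Iinf)).toLinearMap (D.rho x)) = x := by
  induction x using D.F_induction with
  | one => simp [rho_one]
  | add x y hx hy => simp [hx, hy]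
  | smul r x hx => simp [hx]
  | mul g x hx =>
    rw [rho_gen_mul]
    conv_rhs => rw [← hx]
    generalize D.rho x = z
    induction z using TensorProduct.induction_on with
    | zero => simp
    | add a b ha hb => simp only [map_add, ha, hb, mul_add]
    | tmul a b =>
      have h0 : FreeAlgebra.algebraMapInv (D.gen g) = (0 : QField) := by
        simp [FreeAlgebra.algebraMapInv]
      simp [primMul, h0]

/-- Apply `id ⊗ ξ_g` to `(a_h ⊗ 1 + 1 ⊗ a_h) ϱ(x)`. In the second term `a_h` has to cross the left
factor, which leaves `twist` there, and `ξ_g` reduces the right factor to its counit. -/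
theorem contrR_gen_mul (g h : D.Iinf) (x : D.F) :
    D.contrR g (D.gen h * x) =
      D.gen h * D.contrR g x + (if h = g then D.tau g • D.twist g x else 0) := by
  have h1 : (if h = g then D.tau g • D.twist g x else 0) = (if h = g then D.tau g else 0) •
      D.twist h (TensorProduct.rid QField D.F (TensorProduct.map LinearMap.id
    (FreeAlgebra.algebraMapInv (R := QField) (X := D.Iinf)).toLinearMap (D.rho x))) := by
    rw [rho_counit]; split_ifs with e <;> simp [e]
  rw [h1]
  simp only [contrR, LinearMap.comp_apply, rho_gen_mul]
  generalize D.rho x = z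
  induction z using TensorProduct.induction_on with
  | zero => simp
  | add a b ha hb => simp only [map_add, ha, hb, mul_add, smul_add]; abel
  | tmul a b =>
    simp [primMul, xi_gen_mul, smul_smul]

theorem form_gen (g : D.Iinf) : D.form (D.gen g) = D.xi g := by
  ext y
  have := D.form_gen_mul_left g 1 y
  rw [mul_one, form_one_left] at this
  rw [this]
  -- The identity `this` mentions `y`, so each induction hypothesis carries it as a premise that has
  -- to be rederived.
  induction y using D.F_induction with
  | one => simp [contr_one, xi_one]
  | add y z hy hz =>
    rw [map_add, map_add, map_add]
    rw [hy (by rw [← form_one_left, ← form_gen_mul_left, mul_one]),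
      hz (by rw [← form_one_left, ← form_gen_mul_left, mul_one])]
  | smul r y hy =>
    rw [map_smul, map_smul, map_smul]
    rw [hy (by rw [← form_one_left, ← form_gen_mul_left, mul_one])]
  | mul k y hy =>
    rw [contr_gen_mul, xi_gen_mul]
    split_ifs <;> simp [FreeAlgebra.algebraMapInv]

theorem form_mul_gen (g : D.Iinf) (x y : D.F) :
    D.form (x * D.gen g) y = D.form x (D.contrR g y) := by
  rw [form_mul_left, form_gen]
  simp only [contrR, LinearMap.comp_apply]
  generalize D.rho y = z
  induction z using TensorProduct.induction_on with
  | zero => simp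
  | add a b ha hb => simp only [map_add, ha, hb]
  | tmul a b => simp [mul_comm]

theorem contrR_scal (χ : D.Iinf → QField) (g : D.Iinf) (x : D.F) :
    D.contrR g (D.scal χ x) = χ g • D.scal χ (D.contrR g x) := by
  induction x using D.F_induction with
  | one => simp [contrR_one]
  | add x y hx hy => simp [hx, hy]
  | smul r x hx => rw [map_smul, map_smul, hx, map_smul, map_smul, smul_comm]
  | mul k x hx =>
    rw [scal_gen_mul, map_smul, contrR_gen_mul, contrR_gen_mul, hx, map_add, scal_gen_mul]
    by_cases hk : k = g
    · subst hk
      simp only [if_true, map_smul, mul_smul_comm, smul_add, smul_smul, twist_eq_scal,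
        scal_scal, mul_comm]
    · simp only [if_neg hk, map_zero, mul_smul_comm, add_zero, smul_smul, mul_comm]

/-! ### Stability of the radical -/

theorem mem_radical {x : D.F} : x ∈ D.radical ↔ ∀ y, D.form x y = 0 :=
  LinearMap.mem_ker.trans LinearMap.ext_iff

theorem mem_radical' {x : D.F} : x ∈ D.radical ↔ ∀ y, D.form y x = 0 := by
  simp only [mem_radical, D.form_symm x]

theorem scal_mem_radical (χ : D.Iinf → QField) {x : D.F} (hx : x ∈ D.radical) :
    D.scal χ x ∈ D.radical :=
  D.mem_radical.mpr fun y => by rw [form_scal, D.mem_radical.mp hx]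

theorem contr_mem_radical (g : D.Iinf) {x : D.F} (hx : x ∈ D.radical) :
    D.contr g x ∈ D.radical :=
  D.mem_radical.mpr fun y => by rw [← form_gen_mul', D.mem_radical.mp hx]

theorem contrR_mem_radical (g : D.Iinf) {x : D.F} (hx : x ∈ D.radical) :
    D.contrR g x ∈ D.radical :=
  D.mem_radical'.mpr fun y => by rw [← form_mul_gen, D.mem_radical'.mp hx]

theorem gen_mul_mem_radical (g : D.Iinf) {x : D.F} (hx : x ∈ D.radical) :
    D.gen g * x ∈ D.radical :=
  D.mem_radical.mpr fun y => by rw [form_gen_mul_left, D.mem_radical.mp hx]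

theorem mul_gen_mem_radical (g : D.Iinf) {x : D.F} (hx : x ∈ D.radical) :
    x * D.gen g ∈ D.radical :=
  D.mem_radical.mpr fun y => by rw [form_mul_gen, D.mem_radical.mp hx]

/-- An element killed by the counit and by all the contractions lies in the radical. -/
theorem mem_radical_of_contr {x : D.F} (h0 : FreeAlgebra.algebraMapInv (R := QField) x = 0)
    (h : ∀ g, D.contr g x ∈ D.radical) : x ∈ D.radical := by
  refine D.mem_radical.mpr fun y => ?_
  induction y using D.F_induction with
  | one => rw [form_one, h0]
  | add y z hy hz => rw [map_add, hy, hz, add_zero]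
  | smul r y hy => rw [map_smul, hy, smul_zero]
  | mul g y hy => rw [form_gen_mul', D.mem_radical.mp (h g)]

/-! ### The grading of the free algebra -/

/-- The word `w` as an element of `F`. -/
noncomputable def word (w : List D.Iinf) : D.F := (w.map D.gen).prod

/-- The degree of a word. -/
noncomputable def wdeg (w : List D.Iinf) : D.Deg := Multiset.toFinsupp (w : Multiset D.Iinf)

theorem word_nil : D.word [] = 1 := rfl

theorem word_cons (g : D.Iinf) (w : List D.Iinf) : D.word (g :: w) = D.gen g * D.word w := by
  simp [word]

theorem wdeg_nil : D.wdeg [] = 0 := by simp [wdeg]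

theorem wdeg_cons (g : D.Iinf) (w : List D.Iinf) :
    D.wdeg (g :: w) = D.wdeg w + Finsupp.single g 1 := by
  rw [wdeg, wdeg, ← Multiset.cons_coe, ← Multiset.singleton_add, map_add,
    Multiset.toFinsupp_singleton, add_comm]

theorem wdeg_concat (g : D.Iinf) (w : List D.Iinf) :
    D.wdeg (w ++ [g]) = D.wdeg w + Finsupp.single g 1 := by
  rw [wdeg, wdeg, ← Multiset.coe_add, map_add, Multiset.coe_singleton,
    Multiset.toFinsupp_singleton]

theorem wdeg_apply (w : List D.Iinf) (g : D.Iinf) : D.wdeg w g = w.count g := by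
  simp [wdeg]

theorem wdeg_eq_iff {w : List D.Iinf} {ν : D.Deg} : D.wdeg w = ν ↔ ∀ g, w.count g = ν g := by
  rw [Finsupp.ext_iff]; simp only [wdeg_apply]

theorem Fdeg_eq (ν : D.Deg) : D.Fdeg ν = Submodule.span QField (D.word '' {w | D.wdeg w = ν}) := by
  unfold Fdeg
  congr 1
  ext x
  simp only [Set.mem_ofPred_eq, Set.mem_image, wdeg_eq_iff]
  exact exists_congr fun w => and_congr_right fun _ => eq_comm

theorem word_mem_Fdeg (w : List D.Iinf) : D.word w ∈ D.Fdeg (D.wdeg w) := by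
  rw [Fdeg_eq]; exact Submodule.subset_span ⟨w, rfl, rfl⟩

theorem Fdeg_induction {ν : D.Deg} {C : ∀ x, x ∈ D.Fdeg ν → Prop} (zero : C 0 (zero_mem _))
    (add : ∀ x y hx hy, C x hx → C y hy → C (x + y) (add_mem hx hy))
    (smul : ∀ (r : QField) x hx, C x hx → C (r • x) (Submodule.smul_mem _ r hx))
    (word : ∀ w (h : D.wdeg w = ν), C (D.word w) (h ▸ D.word_mem_Fdeg w)) (x : D.F)
    (hx : x ∈ D.Fdeg ν) : C x hx := by
  have e := D.Fdeg_eq ν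
  refine Submodule.span_induction (p := fun x h => C x (e ▸ h)) ?_ zero
    (fun x y h h' => add x y (e ▸ h) (e ▸ h')) (fun r x h => smul r x (e ▸ h)) (e ▸ hx)
  rintro _ ⟨w, hw, rfl⟩
  exact word w hw

theorem basis_eq_word (w : List D.Iinf) :
    FreeAlgebra.basisFreeMonoid QField D.Iinf (FreeMonoid.ofList w) = D.word w := by
  have h : FreeAlgebra.equivMonoidAlgebraFreeMonoid (R := QField) (D.word w) =
      MonoidAlgebra.of QField (FreeMonoid D.Iinf) (FreeMonoid.ofList w) := by
    induction w with
    | nil => rw [word_nil, map_one]; exact (map_one _).symm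
    | cons g w ih =>
      rw [word_cons, map_mul, ih, FreeMonoid.ofList_cons, map_mul]
      congr 1
      simp [FreeAlgebra.equivMonoidAlgebraFreeMonoid, gen]
  rw [← AlgEquiv.symm_apply_apply FreeAlgebra.equivMonoidAlgebraFreeMonoid (D.word w), h]
  rfl

/-- The projection of `F` onto its part of degree `ν`. -/
noncomputable def proj (ν : D.Deg) : D.F →ₗ[QField] D.F :=
  open Classical in (FreeAlgebra.basisFreeMonoid QField D.Iinf).constr QField fun w =>
    if D.wdeg w.toList = ν then D.word w.toList else 0

open Classical in
theorem proj_word (ν : D.Deg) (w : List D.Iinf) :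
    D.proj ν (D.word w) = if D.wdeg w = ν then D.word w else 0 := by
  rw [← basis_eq_word, proj, Module.Basis.constr_basis, basis_eq_word]; rfl

theorem word_induction {C : D.F → Prop} (zero : C 0) (add : ∀ x y, C x → C y → C (x + y))
    (smul : ∀ (r : QField) x, C x → C (r • x)) (word : ∀ w, C (D.word w)) (x : D.F) : C x := by
  have hx : x ∈ Submodule.span QField (Set.range (FreeAlgebra.basisFreeMonoid QField D.Iinf)) := by
    rw [Module.Basis.span_eq]; trivial
  induction hx using Submodule.span_induction with
  | mem x h => obtain ⟨w, rfl⟩ := h; rw [← FreeMonoid.ofList_toList w, basis_eq_word]; exact word _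
  | zero => exact zero
  | add x y _ _ hx hy => exact add x y hx hy
  | smul r x _ hx => exact smul r x hx

theorem proj_mem (ν : D.Deg) (x : D.F) : D.proj ν x ∈ D.Fdeg ν := by
  induction x using D.word_induction with
  | zero => rw [map_zero]; exact zero_mem _
  | add x y hx hy => rw [map_add]; exact add_mem hx hy
  | smul r x hx => rw [map_smul]; exact Submodule.smul_mem _ _ hx
  | word w =>
    rw [proj_word]
    split_ifs with h
    · exact h ▸ D.word_mem_Fdeg w
    · exact zero_mem _

theorem proj_self {ν : D.Deg} {x : D.F} (hx : x ∈ D.Fdeg ν) : D.proj ν x = x := by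
  induction x, hx using D.Fdeg_induction with
  | zero => simp
  | add x y _ _ hx hy => simp [hx, hy]
  | smul r x _ hx => simp [hx]
  | word w hw => rw [proj_word, if_pos hw]

theorem proj_ne {μ ν : D.Deg} (h : μ ≠ ν) {x : D.F} (hx : x ∈ D.Fdeg μ) : D.proj ν x = 0 := by
  induction x, hx using D.Fdeg_induction with
  | zero => simp
  | add x y _ _ hx hy => simp [hx, hy]
  | smul r x _ hx => simp [hx]
  | word w hw => rw [proj_word, if_neg (hw ▸ h)]

theorem homogeneous_induction {C : D.F → Prop} (add : ∀ x y, C x → C y → C (x + y))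
    (hom : ∀ ν, ∀ x ∈ D.Fdeg ν, C x) (x : D.F) : C x := by
  have h : ∀ y ∈ ⨆ ν, D.Fdeg ν, C y := fun y hy =>
    Submodule.iSup_induction _ (motive := C) hy hom (hom 0 0 (zero_mem _)) add
  refine h x ?_
  induction x using D.word_induction with
  | zero => exact zero_mem _
  | add x y hx hy => exact add_mem hx hy
  | smul r x hx => exact Submodule.smul_mem _ _ hx
  | word w => exact Submodule.mem_iSup_of_mem _ (D.word_mem_Fdeg w)

theorem proj_gen_mul (κ : D.Deg) (g : D.Iinf) (x : D.F) :
    D.proj (κ + Finsupp.single g 1) (D.gen g * x) = D.gen g * D.proj κ x := by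
  induction x using D.word_induction with
  | zero => simp
  | add x y hx hy => simp [mul_add, hx, hy]
  | smul r x hx => simp [hx]
  | word w =>
    rw [← word_cons, proj_word, proj_word, wdeg_cons]
    simp only [add_left_inj]
    split_ifs <;> simp [word_cons]

theorem proj_gen_mul_eq_zero {ν : D.Deg} {g : D.Iinf} (hν : ν g = 0) (x : D.F) :
    D.proj ν (D.gen g * x) = 0 := by
  induction x using D.word_induction with
  | zero => simp
  | add x y hx hy => simp [mul_add, hx, hy]
  | smul r x hx => simp [hx]
  | word w =>
    rw [← word_cons, proj_word, wdeg_cons, if_neg]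
    rintro rfl
    simp at hν

theorem word_concat (g : D.Iinf) (w : List D.Iinf) : D.word (w ++ [g]) = D.word w * D.gen g := by
  simp [word]

theorem proj_mul_gen (κ : D.Deg) (g : D.Iinf) (x : D.F) :
    D.proj (κ + Finsupp.single g 1) (x * D.gen g) = D.proj κ x * D.gen g := by
  induction x using D.word_induction with
  | zero => simp
  | add x y hx hy => simp [add_mul, hx, hy]
  | smul r x hx => simp [hx]
  | word w =>
    rw [← word_concat, proj_word, proj_word, wdeg_concat]
    simp only [add_left_inj]
    split_ifs <;> simp [word_concat]

theorem proj_mul_gen_eq_zero {ν : D.Deg} {g : D.Iinf} (hν : ν g = 0) (x : D.F) :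
    D.proj ν (x * D.gen g) = 0 := by
  induction x using D.word_induction with
  | zero => simp
  | add x y hx hy => simp [add_mul, hx, hy]
  | smul r x hx => simp [hx]
  | word w =>
    rw [← word_concat, proj_word, wdeg_concat, if_neg]
    rintro rfl
    simp at hν

/-- The value `∏ χ(g)^{ν_g}` of a multiplicative function on a degree. -/
noncomputable def charDeg (χ : D.Iinf → QField) (ν : D.Deg) : QField := ν.prod fun g n => χ g ^ n

theorem charDeg_add_single (χ : D.Iinf → QField) (ν : D.Deg) (g : D.Iinf) :
    D.charDeg χ (ν + Finsupp.single g 1) = D.charDeg χ ν * χ g := by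
  rw [charDeg, Finsupp.prod_add_index' (by simp) (by intros; exact pow_add _ _ _)]
  simp [charDeg]

theorem scal_of_mem_Fdeg (χ : D.Iinf → QField) {ν : D.Deg} {x : D.F} (hx : x ∈ D.Fdeg ν) :
    D.scal χ x = D.charDeg χ ν • x := by
  induction x, hx using D.Fdeg_induction with
  | zero => simp
  | add x y _ _ hx hy => simp [hx, hy]
  | smul r x _ hx => rw [map_smul, hx, smul_comm]
  | word w hw =>
    subst hw
    induction w with
    | nil => simp [word_nil, wdeg_nil, charDeg]
    | cons g w ih =>
      rw [word_cons, scal_gen_mul, ih, wdeg_cons, charDeg_add_single, mul_smul_comm, smul_smul,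
        mul_comm]

theorem qVar_ne_zero : qVar ≠ 0 := RatFunc.X_ne_zero

theorem intDegree_qVar_pow (n : ℕ) : (qVar ^ n).intDegree = n := by
  induction n with
  | zero => simp
  | succ n ih =>
    rw [pow_succ, RatFunc.intDegree_mul (pow_ne_zero _ qVar_ne_zero) qVar_ne_zero, ih,
      RatFunc.intDegree_X]
    simp

theorem qVar_pow_injective : Function.Injective fun n : ℕ => qVar ^ n := fun m n h => by
  have := congrArg RatFunc.intDegree h
  simpa only [intDegree_qVar_pow, Nat.cast_inj] using this

/-- The rescaling that sends one generator `a_g` to `q a_g` and fixes the others is self-adjoint,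
with eigenvalues `q^{μ_g}` and `q^{ν_g}` on the two degrees. Choosing `g` with `μ_g ≠ ν_g` separates
them. -/
theorem form_eq_zero {μ ν : D.Deg} (h : μ ≠ ν) {x y : D.F} (hx : x ∈ D.Fdeg μ)
    (hy : y ∈ D.Fdeg ν) : D.form x y = 0 := by
  obtain ⟨g, hg⟩ := DFunLike.ne_iff.mp h
  have key : ∀ κ : D.Deg, D.charDeg (fun k => if k = g then qVar else 1) κ = qVar ^ κ g := by
    intro κ
    simp only [charDeg, Finsupp.prod, ite_pow, one_pow, Finset.prod_ite_eq']
    split_ifs with hκ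
    · rfl
    · rw [Finsupp.notMem_support_iff.mp hκ, pow_zero]
  have e := D.form_scal (fun k => if k = g then qVar else 1) x y
  rw [D.scal_of_mem_Fdeg _ hx, D.scal_of_mem_Fdeg _ hy, key, key, map_smul, map_smul,
    LinearMap.smul_apply, ← sub_eq_zero, ← sub_smul] at e
  exact (smul_eq_zero.mp e).resolve_left
    (sub_ne_zero.mpr fun h' => hg (qVar_pow_injective h'))

theorem form_proj (ν : D.Deg) (x y : D.F) : D.form (D.proj ν x) y = D.form x (D.proj ν y) := by
  induction x using D.homogeneous_induction with
  | add x z hx hz => simp [hx, hz]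
  | hom μ x hx =>
    induction y using D.homogeneous_induction with
    | add y z hy hz => simp [hy, hz]
    | hom κ y hy =>
      by_cases e : μ = ν
      · subst e
        rw [proj_self _ hx]
        by_cases e' : κ = μ
        · subst e'; rw [proj_self _ hy]
        · rw [proj_ne _ e' hy, D.form_eq_zero (Ne.symm e') hx hy, map_zero]
      · rw [proj_ne _ e hx, D.form_eq_zero e hx (D.proj_mem ν y), map_zero, LinearMap.zero_apply]

theorem proj_mem_radical (ν : D.Deg) {x : D.F} (hx : x ∈ D.radical) : D.proj ν x ∈ D.radical :=
  D.mem_radical.mpr fun y => by rw [form_proj, D.mem_radical.mp hx]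

/-! ### The Serre elements lie in the radical -/

theorem sgn_mul_natCast (x : ZMod 2) (n : ℕ) : sgn (x * n) = sgn x ^ n := by
  induction n with
  | zero => simp [sgn]
  | succ n ih => rw [Nat.cast_succ, mul_add, mul_one, sgn_add, ih, pow_succ]

theorem sgn_eq_one_or (x : ZMod 2) : sgn x = 1 ∨ sgn x = -1 := neg_one_pow_eq_or _ _

theorem sgn_mul_qVar_pow_ne_one (x : ZMod 2) {n : ℕ} (hn : n ≠ 0) : sgn x * qVar ^ n ≠ 1 := by
  intro h
  have h2 := congrArg RatFunc.intDegree h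
  rcases sgn_eq_one_or x with e | e
  · rw [e, one_mul, intDegree_qVar_pow, RatFunc.intDegree_one] at h2
    exact hn (by exact_mod_cast h2)
  · rw [e, neg_one_mul, RatFunc.intDegree_neg, intDegree_qVar_pow, RatFunc.intDegree_one] at h2
    exact hn (by exact_mod_cast h2)

/-- The Gaussian alternating sum vanishes: a sequence with the ratios of
`(-1)^j b^{j(j-1)/2} [m+1 choose j]_b` has vanishing sum. -/
theorem sum_eq_zero_of_gaussian_ratio {k : Type*} [Field k] (b : k) (m : ℕ)
    (hb : ∑ i ∈ Finset.range (m + 1), b ^ i ≠ 0) (f : ℕ → k)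
    (hf : ∀ j ≤ m, f j * b ^ j * ∑ i ∈ Finset.range (m + 1 - j), b ^ i =
      -(f (j + 1) * ∑ i ∈ Finset.range (j + 1), b ^ i)) :
    ∑ j ∈ Finset.range (m + 2), f j = 0 := by
  -- Telescoping: with `[r] = 1 + b + ⋯ + b^{r-1}` one has `[m+1] = [j] + b^j [m+1-j]`, so the ratio
  -- hypothesis propagates the formula from `j` to `j+1`. At `j = m+1` it says that the partial sum
  -- is minus the last term.
  have key : ∀ j ≤ m + 1, (∑ i ∈ Finset.range (m + 1), b ^ i) * ∑ i ∈ Finset.range j, f i =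
      -(f j * ∑ i ∈ Finset.range j, b ^ i) := by
    intro j hj
    induction j with
    | zero => simp
    | succ j ih =>
      have e : ∑ i ∈ Finset.range (m + 1), b ^ i = ∑ i ∈ Finset.range j, b ^ i +
          b ^ j * ∑ i ∈ Finset.range (m + 1 - j), b ^ i := by
        conv_lhs => rw [show m + 1 = j + (m + 1 - j) by omega, Finset.sum_range_add]
        rw [Finset.mul_sum]
        simp only [pow_add]
      rw [← hf j (by omega), Finset.sum_range_succ _ j, mul_add, ih (by omega), e]
      ring
  have := key (m + 1) le_rfl
  rw [Finset.sum_range_succ]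
  refine (mul_eq_zero.mp ?_).resolve_left hb
  rw [mul_add, this]
  ring

/-- The ratio of consecutive coefficients of the Serre element, in terms of `b = π Q ^ 2`. -/
theorem serre_coeff_relation {k : Type*} [Field k] (Q π s : k) (m : ℕ) (hQ : Q ≠ 0)
    (hs : s * s = 1) (hπm : π ^ m = 1)
    (hb : ∀ r : ℕ, r ≠ 0 → (π * Q ^ 2) ^ r ≠ 1) (c : ℕ → k)
    (hc : ∀ j ≤ m, c (j + 1) * ((π * Q) ^ (j + 1) - (Q ^ (j + 1))⁻¹) =
      -(s * π ^ j * ((π * Q) ^ (m - j + 1) - (Q ^ (m - j + 1))⁻¹) * c j))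
    (i j : ℕ) (hij : i + j = m) :
    c j * ∑ r ∈ Finset.range (i + 1), (π * Q ^ 2) ^ r +
      c (j + 1) * ((π * Q ^ 2) ^ i * (s * (Q ^ m)⁻¹)) *
        ∑ r ∈ Finset.range (j + 1), (π * Q ^ 2) ^ r = 0 := by
  have hb1 : π * Q ^ 2 - 1 ≠ 0 := sub_ne_zero.mpr (by simpa using hb 1 one_ne_zero)
  -- Up to a power of `Q`, the super quantum integers are the geometric sums in `b = π Q²`, the
  -- self-braiding of the real generator.
  have hX : ∀ r : ℕ, (π * Q) ^ r - (Q ^ r)⁻¹ = (Q ^ r)⁻¹ * ((π * Q ^ 2) ^ r - 1) := by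
    intro r
    have : Q ^ r ≠ 0 := pow_ne_zero _ hQ
    field_simp
    ring
  have hc' := hc j (by omega)
  rw [hX, hX, show m - j = i by omega] at hc'
  refine (mul_eq_zero.mp ?_).resolve_left hb1
  have e1 := mul_geom_sum (π * Q ^ 2) (i + 1)
  have e2 := mul_geom_sum (π * Q ^ 2) (j + 1)
  have expand : (π * Q ^ 2 - 1) * (c j * ∑ r ∈ Finset.range (i + 1), (π * Q ^ 2) ^ r +
      c (j + 1) * ((π * Q ^ 2) ^ i * (s * (Q ^ m)⁻¹)) *
        ∑ r ∈ Finset.range (j + 1), (π * Q ^ 2) ^ r) =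
      c j * ((π * Q ^ 2) ^ (i + 1) - 1) + ((π * Q ^ 2) ^ i * (s * (Q ^ m)⁻¹)) *
        (c (j + 1) * ((π * Q ^ 2) ^ (j + 1) - 1)) := by
    rw [← e1, ← e2]; ring
  have h3 : c (j + 1) * ((π * Q ^ 2) ^ (j + 1) - 1) =
      -(s * π ^ j * (Q ^ (j + 1) * (Q ^ (i + 1))⁻¹) * ((π * Q ^ 2) ^ (i + 1) - 1) * c j) := by
    have hj : Q ^ (j + 1) ≠ 0 := pow_ne_zero _ hQ
    have : c (j + 1) * ((π * Q ^ 2) ^ (j + 1) - 1) = Q ^ (j + 1) *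
      (c (j + 1) * ((Q ^ (j + 1))⁻¹ * ((π * Q ^ 2) ^ (j + 1) - 1))) := by
      field_simp
    rw [this, hc']
    ring
  rw [expand, h3]
  have h4 : (π * Q ^ 2) ^ i * (s * (Q ^ m)⁻¹) * (s * π ^ j * (Q ^ (j + 1) * (Q ^ (i + 1))⁻¹)) =
      1 := by
    have e : (π * Q ^ 2) ^ i * (s * (Q ^ m)⁻¹) * (s * π ^ j * (Q ^ (j + 1) * (Q ^ (i + 1))⁻¹)) =
        (s * s) * π ^ m * ((Q ^ 2) ^ i * (Q ^ m)⁻¹ * (Q ^ (j + 1) * (Q ^ (i + 1))⁻¹)) := by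
      rw [← hij, pow_add π]; ring
    have hi : Q ^ i ≠ 0 := pow_ne_zero _ hQ
    have hj : Q ^ j ≠ 0 := pow_ne_zero _ hQ
    rw [e, hs, hπm, ← hij]
    field_simp
    ring
  linear_combination (-(((π * Q ^ 2) ^ (i + 1) - 1) * c j)) * h4

/-- This scalar is what remains of the Serre element when its middle generator is contracted away.
Dividing the coefficients by `β^j`, where `β = s Q^{-m}`, gives them the ratios of a Gaussian
alternating sum. -/
theorem serre_coeff_sum {k : Type*} [Field k] (Q π s : k) (m : ℕ) (hQ : Q ≠ 0)
    (hs : s * s = 1) (hπm : π ^ m = 1)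
    (hb : ∀ r : ℕ, r ≠ 0 → (π * Q ^ 2) ^ r ≠ 1) (c : ℕ → k)
    (hc : ∀ j ≤ m, c (j + 1) * ((π * Q) ^ (j + 1) - (Q ^ (j + 1))⁻¹) =
      -(s * π ^ j * ((π * Q) ^ (m - j + 1) - (Q ^ (m - j + 1))⁻¹) * c j)) :
    ∑ t ∈ Finset.HasAntidiagonal.antidiagonal (m + 1), c t.2 * (s * (Q ^ m)⁻¹) ^ t.1 = 0 := by
  set β : k := s * (Q ^ m)⁻¹ with hβ
  have hs0 : s ≠ 0 := fun h => by simp [h] at hs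
  have hβ0 : β ≠ 0 := mul_ne_zero hs0 (inv_ne_zero (pow_ne_zero _ hQ))
  have hb1 : π * Q ^ 2 - 1 ≠ 0 := sub_ne_zero.mpr (by simpa using hb 1 one_ne_zero)
  have hgs : ∑ i ∈ Finset.range (m + 1), (π * Q ^ 2) ^ i ≠ 0 := by
    intro h
    have := mul_geom_sum (π * Q ^ 2) (m + 1)
    rw [h, mul_zero] at this
    exact hb (m + 1) (by omega) (sub_eq_zero.mp this.symm)
  -- `β² = b^{-m}`, thanks to `π^m = 1`; this converts the coefficient relation, which involves
  -- `b^{m-j} β`, into the Gaussian ratio, which involves `b^j`.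
  have hbb : (π * Q ^ 2) ^ m * (β * β) = 1 := by
    have : (π * Q ^ 2) ^ m * (β * β) = (s * s) * π ^ m * ((Q ^ 2) ^ m * ((Q ^ m)⁻¹ * (Q ^ m)⁻¹)) := by
      rw [hβ]; ring
    have hq : Q ^ m ≠ 0 := pow_ne_zero _ hQ
    rw [this, hs, hπm]
    field_simp
    ring
  have hsum := sum_eq_zero_of_gaussian_ratio (π * Q ^ 2) m hgs (fun j => c j * (β ^ j)⁻¹) (by
    intro j hj
    have h := serre_coeff_relation Q π s m hQ hs hπm hb c hc (m - j) j (by omega)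
    rw [← hβ] at h
    have hj0 : β ^ j ≠ 0 := pow_ne_zero _ hβ0
    have e : (π * Q ^ 2) ^ j * (π * Q ^ 2) ^ (m - j) * (β * β) = 1 := by
      rw [← pow_add, show j + (m - j) = m by omega, hbb]
    rw [show m + 1 - j = m - j + 1 by omega, pow_succ β, mul_inv]
    have e' : c (j + 1) * ((β ^ j)⁻¹ * β⁻¹) =
        c (j + 1) * (β ^ j)⁻¹ * β * ((π * Q ^ 2) ^ j * (π * Q ^ 2) ^ (m - j)) := by
      field_simp
      linear_combination (-c (j + 1)) * e
    rw [e']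
    linear_combination ((β ^ j)⁻¹ * (π * Q ^ 2) ^ j) * h)
  rw [Finset.Nat.antidiagonal_eq_map', Finset.sum_map]
  rw [← mul_zero (β ^ (m + 1)), ← hsum, Finset.mul_sum]
  refine Finset.sum_congr rfl fun j hj => ?_
  have hj' : j ≤ m + 1 := by simpa [Nat.lt_succ_iff] using hj
  have hj0 : β ^ j ≠ 0 := pow_ne_zero _ hβ0
  change c j * β ^ (m + 1 - j) = β ^ (m + 1) * (c j * (β ^ j)⁻¹)
  rw [show β ^ (m + 1) = β ^ (m + 1 - j) * β ^ j by rw [← pow_add]; congr 1; omega]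
  field_simp

/-- The coefficient of `x^t y x^{t'}` in the Serre expression. -/
noncomputable def serreCoeff (g h : D.Iinf) (t : ℕ) : QField :=
  (-1) ^ t * sgn (D.p (D.idx g) * (t * D.par h + (t.choose 2 : ℕ))) *
    D.qbinom (D.idx g) (1 - D.lev h * D.A (D.idx g) (D.idx h)) t

/-- The Serre element of the free algebra `F`. -/
noncomputable def serreF (g h : D.Iinf) : D.F :=
  ∑ t ∈ Finset.HasAntidiagonal.antidiagonal (1 - D.lev h * D.A (D.idx g) (D.idx h)).toNat,
    D.serreCoeff g h t.2 • (D.gen g ^ t.1 * (D.gen h * D.gen g ^ t.2))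

theorem lift_serreF (f : D.Iinf → D.FreeU) (g h : D.Iinf) :
    FreeAlgebra.lift QField f (D.serreF g h) = D.serre g h (f g) (f h) := by
  simp only [serreF, serre, map_sum, map_smul, map_mul, map_pow, FreeAlgebra.lift_ι_apply,
    serreCoeff, mul_assoc]

theorem contr_pow_mul_of_ne {g k : D.Iinf} (hk : g ≠ k) (t : ℕ) (x : D.F) :
    D.contr k (D.gen g ^ t * x) = D.braid g k ^ t • (D.gen g ^ t * D.contr k x) := by
  induction t with
  | zero => simp
  | succ t ih =>
    rw [pow_succ', mul_assoc, contr_gen_mul, if_neg hk, zero_add, ih, mul_smul_comm, smul_smul,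
      ← mul_assoc, ← pow_succ']

/-- The power rule for a `b`-derivation, with `b = braid g g`. For `t = 0` the truncated exponent `t
- 1` is harmless, since its coefficient is an empty sum. -/
theorem contr_pow_mul (g : D.Iinf) (t : ℕ) (x : D.F) :
    D.contr g (D.gen g ^ t * x) =
      (D.tau g * ∑ i ∈ Finset.range t, D.braid g g ^ i) • (D.gen g ^ (t - 1) * x) +
        D.braid g g ^ t • (D.gen g ^ t * D.contr g x) := by
  induction t with
  | zero => simp
  | succ t ih =>
    rw [pow_succ', mul_assoc, contr_gen_mul, if_pos rfl, ih, Finset.sum_range_succ', mul_add,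
      smul_add, mul_smul_comm, mul_smul_comm, smul_smul, smul_smul, ← mul_assoc (D.gen g),
      ← mul_assoc (D.gen g), ← pow_succ', ← pow_succ', ← pow_succ', Nat.add_sub_cancel]
    rcases t with _ | t
    · simp
    · rw [Nat.add_sub_cancel, ← add_assoc, ← add_smul, mul_add, pow_zero, mul_one]
      congr 2
      rw [add_comm (D.tau g), mul_left_comm, Finset.mul_sum]
      simp only [pow_succ']

/-- Every contraction of the Serre element is zero. For `g`, the contributions of neighbouring terms
cancel (`serre_coeff_relation`); for `h`, a power of `a_g` remains, with coefficient the vanishing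
Gaussian sum (`serre_coeff_sum`); for other generators there is nothing to contract. -/
theorem serreF_mem_radical (g h : D.Iinf) (hg : D.A (D.idx g) (D.idx g) = 2) (hgh : g ≠ h) :
    D.serreF g h ∈ D.radical := by
  have hlg : D.lev g = 1 := g.2.2 hg
  -- A real index occurs only at level 1, so `g ≠ h` forces distinct indices. Then `a_{ij} ≤ 0`, and
  -- `m = -k a_{ij}` is a natural number.
  have hidx : D.idx g ≠ D.idx h := by
    intro e
    have hlh : D.lev h = 1 := h.2.2 (by change D.A (D.idx h) (D.idx h) = 2; rw [← e]; exact hg)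
    exact hgh (Subtype.ext (Prod.ext e (hlg.trans hlh.symm)))
  obtain ⟨m, hm⟩ : ∃ m : ℕ, (m : ℤ) = -(D.lev h * D.A (D.idx g) (D.idx h)) :=
    Int.eq_ofNat_of_zero_le (by
      have := D.off_diag _ _ hidx
      have : 0 ≤ (D.lev h : ℤ) * -D.A (D.idx g) (D.idx h) :=
        mul_nonneg (Int.natCast_nonneg _) (by linarith)
      linarith) |>.imp fun _ h => h.symm
  have hn : (1 - D.lev h * D.A (D.idx g) (D.idx h)) = ((m + 1 : ℕ) : ℤ) := by push_cast; linarith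
  set π := sgn (D.p (D.idx g)) with hπdef
  set Q := D.qi (D.idx g) with hQdef
  set s := sgn (D.par g * D.par h) with hsdef
  have hpar : D.par g = D.p (D.idx g) := by simp [par, hlg]
  have hQ : Q ≠ 0 := pow_ne_zero _ qVar_ne_zero
  have hbgg : D.braid g g = π * Q ^ 2 := by
    have e1 : D.p (D.idx g) * D.p (D.idx g) = D.p (D.idx g) := by
      generalize D.p (D.idx g) = x; revert x; decide
    have e2 : D.pair g g = ((D.d (D.idx g) * 2 : ℕ) : ℤ) := by simp [pair, hlg, hg]
    rw [braid, hpar, e1, e2, zpow_natCast, pow_mul]; rfl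
  have hbgh : D.braid g h = s * (Q ^ m)⁻¹ := by
    have e2 : D.pair g h = -((D.d (D.idx g) * m : ℕ) : ℤ) := by
      push_cast; rw [hm]; simp [pair, hlg]; ring
    rw [braid, e2, zpow_neg, zpow_natCast, pow_mul]; rfl
  have hs : s * s = 1 := sgn_mul_self _
  have hπ : π * π = 1 := sgn_mul_self _
  -- If `i` is odd, its row of `A` is even, hence `m` is even.
  have hπm : π ^ m = 1 := by
    by_cases hp : D.p (D.idx g) = 1
    · have he : Even (m : ℤ) := by rw [hm]; exact ((D.odd_even _ hp _).mul_left _).neg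
      obtain ⟨r, hr⟩ := (Int.even_coe_nat m).mp he
      rw [hr, pow_add, ← mul_pow, hπ, one_pow]
    · have : D.p (D.idx g) = 0 := by
        revert hp; generalize D.p (D.idx g) = x; revert x; decide
      rw [hπdef, this, sgn_zero, one_pow]
  -- `b` is a sign times a positive power of `q`, so comparing degrees in `q` shows that it is not a
  -- root of unity.
  have hb : ∀ r : ℕ, r ≠ 0 → (π * Q ^ 2) ^ r ≠ 1 := by
    intro r hr
    rw [mul_pow, hπdef, ← sgn_mul_natCast, hQdef, qi, ← pow_mul, ← pow_mul]
    have := D.d_pos (D.idx g)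
    exact sgn_mul_qVar_pow_ne_one _ (by positivity)
  have hc : ∀ j ≤ m, D.serreCoeff g h (j + 1) * ((π * Q) ^ (j + 1) - (Q ^ (j + 1))⁻¹) =
      -(s * π ^ j * ((π * Q) ^ (m - j + 1) - (Q ^ (m - j + 1))⁻¹) * D.serreCoeff g h j) := by
    intro j hj
    have hX : (π * Q) ^ (j + 1) - (Q ^ (j + 1))⁻¹ ≠ 0 := by
      intro e
      refine hb (j + 1) (by omega) ?_
      have hq : Q ^ (j + 1) ≠ 0 := pow_ne_zero _ hQ
      rw [sub_eq_zero] at e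
      calc (π * Q ^ 2) ^ (j + 1) = (π * Q) ^ (j + 1) * Q ^ (j + 1) := by ring
        _ = 1 := by rw [e, inv_mul_cancel₀ hq]
    have hbin : D.qbinom (D.idx g) ((m + 1 : ℕ) : ℤ) (j + 1) *
        ((π * Q) ^ (j + 1) - (Q ^ (j + 1))⁻¹) = D.qbinom (D.idx g) ((m + 1 : ℕ) : ℤ) j *
          ((π * Q) ^ (m - j + 1) - (Q ^ (m - j + 1))⁻¹) := by
      have e1 : ((m + 1 : ℕ) : ℤ) - j = ((m - j + 1 : ℕ) : ℤ) := by push_cast [hj]; ring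
      have e2 : (j : ℤ) - ((m + 1 : ℕ) : ℤ) = -((m - j + 1 : ℕ) : ℤ) := by push_cast [hj]; ring
      have e3 : (j : ℤ) + 1 = ((j + 1 : ℕ) : ℤ) := by push_cast; ring
      unfold qbinom
      rw [Finset.prod_range_succ _ j, Finset.prod_range_succ _ j, e1, e2, e3, zpow_neg, zpow_neg,
        zpow_natCast, zpow_natCast, zpow_natCast, zpow_natCast, ← hπdef, ← hQdef, mul_div_mul_comm]
      rw [mul_assoc, div_mul_cancel₀ _ hX]
    have hsgn : sgn (D.p (D.idx g) * ((j + 1 : ℕ) * D.par h + ((j + 1).choose 2 : ℕ))) =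
        s * π ^ j * sgn (D.p (D.idx g) * (j * D.par h + (j.choose 2 : ℕ))) := by
      rw [hsdef, hπdef, ← sgn_mul_natCast, ← sgn_add, ← sgn_add, hpar]
      congr 1
      rw [Nat.choose_succ_succ' j 1, Nat.choose_one_right]
      push_cast
      ring
    simp only [serreCoeff, hn]
    rw [hsgn, mul_assoc _ (D.qbinom _ _ _), hbin, pow_succ]
    ring
  have hsum : D.serreF g h = ∑ t ∈ Finset.HasAntidiagonal.antidiagonal (m + 1),
      D.serreCoeff g h t.2 • (D.gen g ^ t.1 * (D.gen h * D.gen g ^ t.2)) := by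
    rw [serreF, hn, Int.toNat_natCast]
  have hgh' : ∀ (k : D.Iinf), k ≠ g → ∀ t, D.contr k (D.gen g ^ t) = 0 := by
    intro k hk t
    rw [← mul_one (D.gen g ^ t), D.contr_pow_mul_of_ne (Ne.symm hk), contr_one, mul_zero, smul_zero]
  refine D.mem_radical_of_contr ?_ fun k => ?_
  · rw [hsum, map_sum]
    refine Finset.sum_eq_zero fun t _ => ?_
    simp [FreeAlgebra.algebraMapInv]
  · suffices hk0 : D.contr k (D.serreF g h) = 0 by rw [hk0]; exact zero_mem _
    rw [hsum, map_sum]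
    by_cases hkg : k = g
    · subst hkg
      have hterm : ∀ t : ℕ × ℕ, D.contr k (D.serreCoeff k h t.2 •
          (D.gen k ^ t.1 * (D.gen h * D.gen k ^ t.2))) =
          (D.serreCoeff k h t.2 * (D.tau k * ∑ i ∈ Finset.range t.1, D.braid k k ^ i)) •
            (D.gen k ^ (t.1 - 1) * (D.gen h * D.gen k ^ t.2)) +
          (D.serreCoeff k h t.2 * (D.braid k k ^ t.1 * D.braid k h *
            (D.tau k * ∑ i ∈ Finset.range t.2, D.braid k k ^ i))) •
            (D.gen k ^ t.1 * (D.gen h * D.gen k ^ (t.2 - 1))) := by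
        intro t
        have e := D.contr_pow_mul k t.2 1
        rw [mul_one, contr_one, mul_zero, smul_zero, add_zero, mul_one] at e
        rw [map_smul, contr_pow_mul, contr_gen_mul, if_neg (Ne.symm hgh), zero_add, e,
          D.braid_comm h k, smul_add, smul_smul]
        simp only [mul_smul_comm, smul_smul, mul_assoc]
      simp only [hterm, Finset.sum_add_distrib]
      -- Shifting the left exponent in one sum and the right exponent in the other puts both over `t
      -- + t' = m` with the same monomials. The boundary terms have empty geometric sums as
      -- coefficients.
      rw [Finset.Nat.sum_antidiagonal_succ, Finset.Nat.sum_antidiagonal_succ']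
      simp only [Finset.range_zero, Finset.sum_empty, mul_zero, zero_smul, zero_add,
        Nat.add_sub_cancel, ← Finset.sum_add_distrib, ← add_smul]
      refine Finset.sum_eq_zero fun t ht => ?_
      have := serre_coeff_relation Q π s m hQ hs hπm hb _ hc t.1 t.2
        (Finset.HasAntidiagonal.mem_antidiagonal.mp ht)
      rw [← hbgg, ← hbgh] at this
      refine smul_eq_zero_of_left ?_ _
      linear_combination (D.tau k) * this
    · by_cases hkh : k = h
      · subst hkh
        have hterm : ∀ t ∈ Finset.HasAntidiagonal.antidiagonal (m + 1),
            D.contr k (D.serreCoeff g k t.2 •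
              (D.gen g ^ t.1 * (D.gen k * D.gen g ^ t.2))) =
            (D.serreCoeff g k t.2 * (s * (Q ^ m)⁻¹) ^ t.1 * D.tau k) • D.gen g ^ (m + 1) := by
          intro t ht
          rw [map_smul, D.contr_pow_mul_of_ne hgh, contr_gen_mul, if_pos rfl, hgh' k hkg, mul_zero,
            smul_zero, add_zero, mul_smul_comm, ← pow_add, Finset.HasAntidiagonal.mem_antidiagonal.mp ht, hbgh,
            smul_smul, smul_smul, mul_assoc]
        rw [Finset.sum_congr rfl hterm, ← Finset.sum_smul, ← Finset.sum_mul,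
          serre_coeff_sum Q π s m hQ hs hπm hb _ hc, zero_mul, zero_smul]
      · refine Finset.sum_eq_zero fun t _ => ?_
        rw [map_smul, D.contr_pow_mul_of_ne (Ne.symm hkg), contr_gen_mul, if_neg (Ne.symm hkh),
          hgh' k hkg, mul_zero, smul_zero, zero_add, mul_zero, smul_zero, smul_zero]

/-- When `a_{ij} = 0` the braiding of `g` and `h` is a bare sign, whose square is 1, so the terms of
each contraction cancel. -/
theorem comm_mem_radical (g h : D.Iinf) (hgh : D.A (D.idx g) (D.idx h) = 0) :
    D.gen g * D.gen h - sgn (D.par g * D.par h) • (D.gen h * D.gen g) ∈ D.radical := by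
  have hb : D.braid g h = sgn (D.par g * D.par h) := by simp [braid, pair, hgh]
  refine D.mem_radical_of_contr ?_ fun k => ?_
  · simp [FreeAlgebra.algebraMapInv]
  · suffices hk0 : D.contr k (D.gen g * D.gen h - sgn (D.par g * D.par h) •
        (D.gen h * D.gen g)) = 0 by rw [hk0]; exact zero_mem _
    have e : ∀ l, D.contr k (D.gen l) = if l = k then D.tau k • 1 else 0 := fun l => by
      have := D.contr_gen_mul k l 1
      rwa [mul_one, contr_one, mul_zero, smul_zero, add_zero] at this
    rw [map_sub, map_smul, contr_gen_mul, contr_gen_mul, e, e, ← hb]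
    have hbb : D.braid g h * D.braid g h = 1 := by rw [hb, sgn_mul_self]
    by_cases h1 : g = k <;> by_cases h2 : h = k
    · subst h1
      subst h2
      simp only [if_true, mul_smul_comm, mul_one, smul_add, smul_smul]
      rw [← mul_assoc, hbb, one_mul, add_comm, sub_self]
    · subst h1
      simp only [if_true, if_neg h2, mul_zero, smul_zero, add_zero, zero_add, D.braid_comm h g,
        mul_smul_comm, mul_one, smul_smul]
      rw [← mul_assoc, hbb, one_mul, sub_self]
    · subst h2
      simp [h1]
    · simp [h1, h2]

/-! ### The quotient by the radical -/

/-- The rescaling endomorphism of `F / ℛ`. -/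
noncomputable def scalV (χ : D.Iinf → QField) : D.FmodR →ₗ[QField] D.FmodR :=
  D.radical.mapQ D.radical (D.scal χ).toLinearMap fun _ hx => D.scal_mem_radical χ hx

/-- The left contraction on `F / ℛ`. -/
noncomputable def contrV (g : D.Iinf) : D.FmodR →ₗ[QField] D.FmodR :=
  D.radical.mapQ D.radical (D.contr g) fun _ hx => D.contr_mem_radical g hx

/-- The right contraction on `F / ℛ`. -/
noncomputable def contrRV (g : D.Iinf) : D.FmodR →ₗ[QField] D.FmodR :=
  D.radical.mapQ D.radical (D.contrR g) fun _ hx => D.contrR_mem_radical g hx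

/-- Left multiplication by a generator on `F / ℛ`. -/
noncomputable def lmV (g : D.Iinf) : D.FmodR →ₗ[QField] D.FmodR :=
  D.radical.mapQ D.radical (LinearMap.mulLeft QField (D.gen g)) fun _ hx =>
    D.gen_mul_mem_radical g hx

/-- Right multiplication by a generator on `F / ℛ`. -/
noncomputable def rmV (g : D.Iinf) : D.FmodR →ₗ[QField] D.FmodR :=
  D.radical.mapQ D.radical (LinearMap.mulRight QField (D.gen g)) fun _ hx =>
    D.mul_gen_mem_radical g hx

/-- The projection of `F / ℛ` onto its part of degree `ν`. -/
noncomputable def projV (ν : D.Deg) : D.FmodR →ₗ[QField] D.FmodR :=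
  D.radical.mapQ D.radical (D.proj ν) fun _ hx => D.proj_mem_radical ν hx

/-- The class in `F / ℛ` of an element of `F`. -/
noncomputable def cls : D.F →ₗ[QField] D.FmodR := D.radical.mkQ

theorem cls_surjective : Function.Surjective D.cls := D.radical.mkQ_surjective

theorem cls_eq_zero {x : D.F} : D.cls x = 0 ↔ x ∈ D.radical := Submodule.Quotient.mk_eq_zero _

theorem scalV_cls (χ : D.Iinf → QField) (x : D.F) : D.scalV χ (D.cls x) = D.cls (D.scal χ x) := rfl
theorem contrV_cls (g : D.Iinf) (x : D.F) : D.contrV g (D.cls x) = D.cls (D.contr g x) := rfl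
theorem contrRV_cls (g : D.Iinf) (x : D.F) : D.contrRV g (D.cls x) = D.cls (D.contrR g x) := rfl
theorem lmV_cls (g : D.Iinf) (x : D.F) : D.lmV g (D.cls x) = D.cls (D.gen g * x) := rfl
theorem rmV_cls (g : D.Iinf) (x : D.F) : D.rmV g (D.cls x) = D.cls (x * D.gen g) := rfl
theorem projV_cls (ν : D.Deg) (x : D.F) : D.projV ν (D.cls x) = D.cls (D.proj ν x) := rfl
theorem formR_cls (x y : D.F) : D.formR (D.cls x) (D.cls y) = D.form x y :=
  D.form_symm y x

theorem formR_symm (x y : D.FmodR) : D.formR x y = D.formR y x := by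
  obtain ⟨x, rfl⟩ := D.cls_surjective x
  obtain ⟨y, rfl⟩ := D.cls_surjective y
  rw [formR_cls, formR_cls, form_symm]

theorem eq_zero_of_formR {x : D.FmodR} (h : ∀ y, D.formR x y = 0) : x = 0 := by
  obtain ⟨x, rfl⟩ := D.cls_surjective x
  exact D.cls_eq_zero.mpr (D.mem_radical.mpr fun y => by rw [← formR_cls, h])

theorem eq_of_formR {x x' : D.FmodR} (h : ∀ y, D.formR x y = D.formR x' y) : x = x' :=
  sub_eq_zero.mp (D.eq_zero_of_formR fun y => by
    rw [map_sub, LinearMap.sub_apply, h, sub_self])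

theorem formR_lmV (g : D.Iinf) (x y : D.FmodR) :
    D.formR (D.lmV g x) y = D.formR x (D.contrV g y) := by
  obtain ⟨x, rfl⟩ := D.cls_surjective x
  obtain ⟨y, rfl⟩ := D.cls_surjective y
  rw [lmV_cls, contrV_cls, formR_cls, formR_cls, form_gen_mul_left]

theorem formR_rmV (g : D.Iinf) (x y : D.FmodR) :
    D.formR (D.rmV g x) y = D.formR x (D.contrRV g y) := by
  obtain ⟨x, rfl⟩ := D.cls_surjective x
  obtain ⟨y, rfl⟩ := D.cls_surjective y
  rw [rmV_cls, contrRV_cls, formR_cls, formR_cls, form_mul_gen]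

theorem formR_scalV (χ : D.Iinf → QField) (x y : D.FmodR) :
    D.formR (D.scalV χ x) y = D.formR x (D.scalV χ y) := by
  obtain ⟨x, rfl⟩ := D.cls_surjective x
  obtain ⟨y, rfl⟩ := D.cls_surjective y
  rw [scalV_cls, scalV_cls, formR_cls, formR_cls, form_scal]

theorem formR_projV (ν : D.Deg) (x y : D.FmodR) :
    D.formR (D.projV ν x) y = D.formR x (D.projV ν y) := by
  obtain ⟨x, rfl⟩ := D.cls_surjective x
  obtain ⟨y, rfl⟩ := D.cls_surjective y
  rw [projV_cls, projV_cls, formR_cls, formR_cls, form_proj]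

theorem projV_mem (ν : D.Deg) (x : D.FmodR) : D.projV ν x ∈ D.FmodRdeg ν := by
  obtain ⟨x, rfl⟩ := D.cls_surjective x
  exact ⟨_, D.proj_mem ν x, rfl⟩

theorem projV_self {ν : D.Deg} {x : D.FmodR} (hx : x ∈ D.FmodRdeg ν) : D.projV ν x = x := by
  obtain ⟨x, hx, rfl⟩ := hx
  exact congrArg D.cls (D.proj_self hx)

theorem projV_ne {μ ν : D.Deg} (h : μ ≠ ν) {x : D.FmodR} (hx : x ∈ D.FmodRdeg μ) :
    D.projV ν x = 0 := by
  obtain ⟨x, hx, rfl⟩ := hx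
  exact (congrArg D.cls (D.proj_ne h hx)).trans (map_zero _)

theorem scalV_of_mem (χ : D.Iinf → QField) {ν : D.Deg} {x : D.FmodR} (hx : x ∈ D.FmodRdeg ν) :
    D.scalV χ x = D.charDeg χ ν • x := by
  obtain ⟨x, hx, rfl⟩ := hx
  exact (congrArg D.cls (D.scal_of_mem_Fdeg χ hx)).trans (map_smul _ _ _)

theorem projV_lmV (κ : D.Deg) (g : D.Iinf) (x : D.FmodR) :
    D.projV (κ + Finsupp.single g 1) (D.lmV g x) = D.lmV g (D.projV κ x) := by
  obtain ⟨x, rfl⟩ := D.cls_surjective x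
  exact congrArg D.cls (D.proj_gen_mul κ g x)

theorem projV_lmV_eq_zero {ν : D.Deg} {g : D.Iinf} (hν : ν g = 0) (x : D.FmodR) :
    D.projV ν (D.lmV g x) = 0 := by
  obtain ⟨x, rfl⟩ := D.cls_surjective x
  exact (congrArg D.cls (D.proj_gen_mul_eq_zero hν x)).trans (map_zero _)

theorem projV_rmV (κ : D.Deg) (g : D.Iinf) (x : D.FmodR) :
    D.projV (κ + Finsupp.single g 1) (D.rmV g x) = D.rmV g (D.projV κ x) := by
  obtain ⟨x, rfl⟩ := D.cls_surjective x
  exact congrArg D.cls (D.proj_mul_gen κ g x)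

theorem projV_rmV_eq_zero {ν : D.Deg} {g : D.Iinf} (hν : ν g = 0) (x : D.FmodR) :
    D.projV ν (D.rmV g x) = 0 := by
  obtain ⟨x, rfl⟩ := D.cls_surjective x
  exact (congrArg D.cls (D.proj_mul_gen_eq_zero hν x)).trans (map_zero _)

/-- Transpose of `projV_lmV`: contraction lowers the degree by `g` because the adjoint left
multiplication raises it by `g`. -/
theorem contrV_projV (κ : D.Deg) (g : D.Iinf) (x : D.FmodR) :
    D.contrV g (D.projV (κ + Finsupp.single g 1) x) = D.projV κ (D.contrV g x) :=
  D.eq_of_formR fun y => by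
    rw [formR_projV, D.formR_symm, ← formR_lmV, D.formR_symm, formR_projV, projV_lmV,
      D.formR_symm, formR_lmV, D.formR_symm]

theorem contrV_projV_eq_zero {ν : D.Deg} {g : D.Iinf} (hν : ν g = 0) (x : D.FmodR) :
    D.contrV g (D.projV ν x) = 0 :=
  D.eq_zero_of_formR fun y => by
    rw [D.formR_symm, ← formR_lmV, D.formR_symm, formR_projV, projV_lmV_eq_zero D hν, map_zero]

theorem contrRV_projV (κ : D.Deg) (g : D.Iinf) (x : D.FmodR) :
    D.contrRV g (D.projV (κ + Finsupp.single g 1) x) = D.projV κ (D.contrRV g x) :=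
  D.eq_of_formR fun y => by
    rw [formR_projV, D.formR_symm, ← formR_rmV, D.formR_symm, formR_projV, projV_rmV,
      D.formR_symm, formR_rmV, D.formR_symm]

theorem contrRV_projV_eq_zero {ν : D.Deg} {g : D.Iinf} (hν : ν g = 0) (x : D.FmodR) :
    D.contrRV g (D.projV ν x) = 0 :=
  D.eq_zero_of_formR fun y => by
    rw [D.formR_symm, ← formR_rmV, D.formR_symm, formR_projV, projV_rmV_eq_zero D hν, map_zero]

theorem contrV_scalV (χ : D.Iinf → QField) (g : D.Iinf) (x : D.FmodR) :
    D.contrV g (D.scalV χ x) = χ g • D.scalV χ (D.contrV g x) := by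
  obtain ⟨x, rfl⟩ := D.cls_surjective x
  exact (congrArg D.cls (D.contr_scal χ g x)).trans (map_smul _ _ _)

theorem contrRV_scalV (χ : D.Iinf → QField) (g : D.Iinf) (x : D.FmodR) :
    D.contrRV g (D.scalV χ x) = χ g • D.scalV χ (D.contrRV g x) := by
  obtain ⟨x, rfl⟩ := D.cls_surjective x
  exact (congrArg D.cls (D.contrR_scal χ g x)).trans (map_smul _ _ _)

theorem scalV_scalV (χ ψ : D.Iinf → QField) (x : D.FmodR) :
    D.scalV χ (D.scalV ψ x) = D.scalV (fun h => ψ h * χ h) x := by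
  obtain ⟨x, rfl⟩ := D.cls_surjective x
  exact congrArg D.cls (D.scal_scal χ ψ x)

theorem scalV_one (x : D.FmodR) : D.scalV (fun _ => 1) x = x := by
  obtain ⟨x, rfl⟩ := D.cls_surjective x
  exact congrArg D.cls (D.scal_one x)

theorem V_induction {C : D.FmodR → Prop} (one : C (D.cls 1)) (add : ∀ x y, C x → C y → C (x + y))
    (smul : ∀ (r : QField) x, C x → C (r • x)) (mul : ∀ g x, C x → C (D.lmV g x))
    (x : D.FmodR) : C x := by
  obtain ⟨x, rfl⟩ := D.cls_surjective x
  induction x using D.F_induction with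
  | one => exact one
  | add x y hx hy => rw [map_add]; exact add _ _ hx hy
  | smul r x hx => rw [map_smul]; exact smul _ _ hx
  | mul g x hx => exact mul g _ hx

/-! ### Separation in tensor products -/

/-- An element of `W ⊗ V` killed by all the contractions with a separating family of functionals
on `V` is zero. -/
theorem tensor_eq_zero_of_contract {k W V ι : Type*} [Field k] [AddCommGroup W] [Module k W]
    [AddCommGroup V] [Module k V] (f : ι → V →ₗ[k] k) (hf : ∀ v, (∀ i, f i v = 0) → v = 0)
    (z : W ⊗[k] V) (hz : ∀ i, TensorProduct.rid k W (TensorProduct.map LinearMap.id (f i) z) = 0) :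
    z = 0 := by
  classical
  let B := Module.Basis.ofVectorSpace k W
  refine (TensorProduct.equivFinsuppOfBasisLeft (N := V) B).map_eq_zero_iff.mp
    (Finsupp.ext fun j => ?_)
  refine hf _ fun i => ?_
  -- Taking a coordinate in the first factor commutes with contracting the second, so each
  -- coordinate of `z` is a vector of `V` killed by the separating family.
  have key : ∀ z : W ⊗[k] V, f i ((TensorProduct.equivFinsuppOfBasisLeft (N := V) B) z j) =
      B.repr (TensorProduct.rid k W (TensorProduct.map LinearMap.id (f i) z)) j := by
    intro z
    induction z using TensorProduct.induction_on with
    | zero => simp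
    | add a b ha hb => simp only [map_add, Finsupp.add_apply, ha, hb]
    | tmul a b => simp [mul_comm]
  rw [key, hz]
  simp

/-- The contraction `x ⊗ z ↦ (z, y) x` of the second factor of `F / ℛ ⊗ F / ℛ`. -/
noncomputable def ctr (y : D.FmodR) : D.FmodR ⊗[QField] D.FmodR →ₗ[QField] D.FmodR :=
  (TensorProduct.rid QField D.FmodR).toLinearMap ∘ₗ
    TensorProduct.map LinearMap.id (D.formR.flip y)

theorem ctr_tmul (x y z : D.FmodR) : D.ctr y (x ⊗ₜ z) = D.formR z y • x := by simp [ctr]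

theorem tensor_eq_zero {z : D.FmodR ⊗[QField] D.FmodR} (hz : ∀ y, D.ctr y z = 0) : z = 0 :=
  tensor_eq_zero_of_contract (fun y => D.formR.flip y) (fun _ hv => D.eq_zero_of_formR hv) z hz

theorem tensor_ext {z z' : D.FmodR ⊗[QField] D.FmodR} (h : ∀ y, D.ctr y z = D.ctr y z') :
    z = z' :=
  sub_eq_zero.mp (D.tensor_eq_zero fun y => by rw [map_sub, h, sub_self])

/-- The radical is a coideal for `ϱ`. -/
theorem map_cls_rho_eq_zero {x : D.F} (hx : x ∈ D.radical) :
    TensorProduct.map D.cls D.cls (D.rho x) = 0 := by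
  refine D.tensor_eq_zero fun y => D.eq_zero_of_formR fun y' => ?_
  obtain ⟨y, rfl⟩ := D.cls_surjective y
  obtain ⟨y', rfl⟩ := D.cls_surjective y'
  -- Contracting `ϱ(x)` with `y' ⊗ y` gives `(x, y' y)`, which is zero for `x ∈ ℛ`; nondegeneracy on
  -- both legs finishes.
  have h := D.form_mul_right x y' y
  rw [D.mem_radical.mp hx] at h
  rw [h]
  generalize D.rho x = z
  induction z using TensorProduct.induction_on with
  | zero => simp
  | add a b ha hb => simp only [map_add, LinearMap.add_apply, ha, hb]
  | tmul a b => simp [ctr_tmul, formR_cls, mul_comm]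

/-! ### Homomorphisms from `F` that kill the radical -/

/-- The sum of two `q`-commuting representations of `F / ℛ` is a representation of `F / ℛ`. -/
theorem lift_add_radical {𝒜 : Type*} [Ring 𝒜] [Algebra QField 𝒜] (u v : D.Iinf → 𝒜)
    (huv : ∀ g h, v g * u h = D.braid g h • (u h * v g))
    (hu : ∀ x ∈ D.radical, FreeAlgebra.lift QField u x = 0)
    (hv : ∀ x ∈ D.radical, FreeAlgebra.lift QField v x = 0) :
    ∀ x ∈ D.radical, FreeAlgebra.lift QField (fun g => u g + v g) x = 0 := by
  intro x hx
  have hcomm : ∀ g x, v g * FreeAlgebra.lift QField u x =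
      FreeAlgebra.lift QField u (D.twist g x) * v g := by
    intro g x
    induction x using D.F_induction with
    | one => simp
    | add x y hx hy => simp only [map_add, mul_add, add_mul, hx, hy]
    | smul r x hx => simp only [map_smul, mul_smul_comm, smul_mul_assoc, hx]
    | mul h x hx =>
      rw [twist_eq_scal, scal_gen_mul, map_smul, map_mul, map_mul, FreeAlgebra.lift_ι_apply,
        ← mul_assoc, huv, smul_mul_assoc, smul_mul_assoc, mul_assoc, hx, mul_assoc, twist_eq_scal]
  -- Braided commutation makes multiplication after `u ⊗ v` multiplicative for the twisted product
  -- on `F ⊗ F`. Composed with `ϱ` it is therefore the homomorphism with value `u g + v g` on `a_g`.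
  have key : ∀ x, LinearMap.mul' QField 𝒜 (TensorProduct.map (FreeAlgebra.lift QField u).toLinearMap
      (FreeAlgebra.lift QField v).toLinearMap (D.rho x)) =
      FreeAlgebra.lift QField (fun g => u g + v g) x := by
    intro x
    induction x using D.F_induction with
    | one => simp [rho_one]
    | add x y hx hy => simp only [map_add, hx, hy]
    | smul r x hx => simp only [map_smul, hx]
    | mul g x hx =>
      rw [rho_gen_mul, map_mul, ← hx, FreeAlgebra.lift_ι_apply]
      generalize D.rho x = z
      induction z using TensorProduct.induction_on with
      | zero => simp
      | add a b ha hb => simp only [map_add, ha, hb, mul_add]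
      | tmul a b =>
        simp only [primMul, LinearMap.add_apply, TensorProduct.map_tmul, LinearMap.mulLeft_apply,
          LinearMap.id_apply, AlgHom.toLinearMap_apply, map_add, map_mul,
          LinearMap.mul'_apply, FreeAlgebra.lift_ι_apply, add_mul]
        rw [← mul_assoc, ← mul_assoc, ← mul_assoc, hcomm]
  rw [← key]
  -- Both representations factor through `F / ℛ`, and `ϱ(ℛ)` vanishes in `F / ℛ ⊗ F / ℛ`.
  have e : TensorProduct.map (FreeAlgebra.lift QField u).toLinearMap
      (FreeAlgebra.lift QField v).toLinearMap = TensorProduct.map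
        (D.radical.liftQ (FreeAlgebra.lift QField u).toLinearMap hu)
        (D.radical.liftQ (FreeAlgebra.lift QField v).toLinearMap hv) ∘ₗ
          TensorProduct.map D.cls D.cls := by
    rw [← TensorProduct.map_comp]; rfl
  rw [e, LinearMap.comp_apply, D.map_cls_rho_eq_zero hx, map_zero, map_zero]

theorem exists_sum_proj (x : D.F) :
    ∃ S : Finset D.Deg, ∀ T, S ⊆ T → ∑ ν ∈ T, D.proj ν x = x := by
  classical
  induction x using D.homogeneous_induction with
  | add x y hx hy =>
    obtain ⟨S, hS⟩ := hx
    obtain ⟨S', hS'⟩ := hy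
    refine ⟨S ∪ S', fun T hT => ?_⟩
    simp only [map_add, Finset.sum_add_distrib]
    rw [hS T (Finset.union_subset_left hT), hS' T (Finset.union_subset_right hT)]
  | hom ν x hx =>
    refine ⟨{ν}, fun T hT => ?_⟩
    rw [Finset.sum_eq_single ν, D.proj_self hx]
    · exact fun μ _ hμ => D.proj_ne (Ne.symm hμ) hx
    · exact fun h => absurd (hT (Finset.mem_singleton_self ν)) h

/-- The radical is spanned by its homogeneous elements. -/
theorem radical_homogeneous {M : Type*} [AddCommGroup M] [Module QField M] (f : D.F →ₗ[QField] M)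
    (hf : ∀ ν, ∀ x ∈ D.Fdeg ν, x ∈ D.radical → f x = 0) : ∀ x ∈ D.radical, f x = 0 := by
  intro x hx
  obtain ⟨S, hS⟩ := D.exists_sum_proj x
  rw [← hS S subset_rfl, map_sum]
  exact Finset.sum_eq_zero fun ν _ => hf ν _ (D.proj_mem ν x) (D.proj_mem_radical ν hx)

/-- Rescaling a representation of `F / ℛ` by commuting group-like elements. -/
theorem lift_mul_radical {𝒜 X : Type*} [Ring 𝒜] [Algebra QField 𝒜] [AddCommMonoid X]
    (κ : X → 𝒜) (κ_zero : κ 0 = 1) (κ_add : ∀ x y, κ (x + y) = κ x * κ y) (θ : D.Iinf → X)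
    (u : D.Iinf → 𝒜) (comm : ∀ x g, κ x * u g = u g * κ x)
    (hu : ∀ x ∈ D.radical, FreeAlgebra.lift QField u x = 0) :
    ∀ x ∈ D.radical, FreeAlgebra.lift QField (fun g => κ (θ g) * u g) x = 0 := by
  -- The group-like factors collect into one factor that depends only on the degree of the word. As
  -- `ℛ` is spanned by homogeneous elements, this factor can be pulled out on `ℛ`.
  have hw : ∀ w : List D.Iinf, FreeAlgebra.lift QField (fun g => κ (θ g) * u g) (D.word w) =
      κ ((D.wdeg w).sum fun g n => n • θ g) * FreeAlgebra.lift QField u (D.word w) := by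
    intro w
    induction w with
    | nil => simp [word_nil, wdeg_nil, κ_zero]
    | cons g w ih =>
      rw [word_cons, map_mul, map_mul, ih, wdeg_cons, FreeAlgebra.lift_ι_apply,
        FreeAlgebra.lift_ι_apply, Finsupp.sum_add_index' (by simp) (by intros; exact add_smul _ _ _),
        Finsupp.sum_single_index (by simp), one_smul, add_comm, κ_add, mul_assoc, mul_assoc,
        ← mul_assoc (u g), ← comm, mul_assoc]
  have hdeg : ∀ ν, ∀ x ∈ D.Fdeg ν, FreeAlgebra.lift QField (fun g => κ (θ g) * u g) x =
      κ (ν.sum fun g n => n • θ g) * FreeAlgebra.lift QField u x := by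
    intro ν x hx
    induction x, hx using D.Fdeg_induction with
    | zero => simp
    | add x y _ _ hx hy => rw [map_add, map_add, mul_add, hx, hy]
    | smul r x _ hx => rw [map_smul, map_smul, mul_smul_comm, hx]
    | word w h => subst h; exact hw w
  refine D.radical_homogeneous (FreeAlgebra.lift QField fun g => κ (θ g) * u g).toLinearMap ?_
  intro ν x hx hx'
  rw [AlgHom.toLinearMap_apply, hdeg ν x hx, hu x hx', mul_zero]

/-! ### The defining relations of `U` in an arbitrary algebra -/

/-- The function `h ↦ (-1)^{p(g) p(h)}`. -/
noncomputable def sig (g h : D.Iinf) : QField := sgn (D.par g * D.par h)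

theorem sig_comm (g h : D.Iinf) : D.sig g h = D.sig h g := by rw [sig, mul_comm, sig]

theorem sig_mul_self (g h : D.Iinf) : D.sig g h * D.sig g h = 1 := sgn_mul_self _

theorem sig_self (g : D.Iinf) : D.sig g g = sgn (D.par g) := by
  have : D.par g * D.par g = D.par g := by generalize D.par g = x; revert x; decide
  rw [sig, this]

theorem braid_eq (g h : D.Iinf) : D.braid g h = D.sig g h * qVar ^ D.pair g h := rfl

/-- This makes conjugation by `K_g` reproduce the power of `q` in the braiding; the sign of the
braiding comes from the superalgebra structure. -/
theorem lev_mul_cow (g h : D.Iinf) :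
    (D.lev h : ℤ) * D.cow g (D.root (D.idx h)) = D.pair g h := by
  simp only [cow, pair, LinearMap.smul_apply, D.pairing, nsmul_eq_mul]
  push_cast
  ring

/-- The Cartan relations and the commutation relations between the `a_g` and the `b_h`. -/
structure CartanRels {𝒜 : Type*} [Ring 𝒜] [Algebra QField 𝒜] (a b : D.Iinf → 𝒜)
    (q : Module.Dual ℤ P → 𝒜) : Prop where
  q_zero : q 0 = 1
  q_add : ∀ h h', q (h + h') = q h * q h'
  q_a : ∀ h g, q h * a g = qVar ^ (D.lev g * h (D.root (D.idx g))) • (a g * q h)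
  q_b : ∀ h g, q h * b g = qVar ^ (-(D.lev g * h (D.root (D.idx g)))) • (b g * q h)
  a_b : ∀ g h, a g * b h - D.sig g h • (b h * a g) =
    if g = h then D.tau g • (q (D.cow g) - q (-D.cow g)) else 0

theorem lift_smul {𝒜 : Type*} [Ring 𝒜] [Algebra QField 𝒜] (χ : D.Iinf → QField)
    (f : D.Iinf → 𝒜) (x : D.F) :
    FreeAlgebra.lift QField (fun g => χ g • f g) x = FreeAlgebra.lift QField f (D.scal χ x) := by
  have : FreeAlgebra.lift QField (fun g => χ g • f g) =
      (FreeAlgebra.lift QField f).comp (D.scal χ) :=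
    FreeAlgebra.hom_ext (funext fun g => by simp [scal])
  exact DFunLike.congr_fun this x

/-- Moving an element past the image of `F`. -/
theorem mul_lift_of_mul_gen {𝒜 : Type*} [Ring 𝒜] [Algebra QField 𝒜] {t : 𝒜} {f : D.Iinf → 𝒜}
    {χ : D.Iinf → QField} (h : ∀ g, t * f g = χ g • (f g * t)) (x : D.F) :
    t * FreeAlgebra.lift QField f x = FreeAlgebra.lift QField f (D.scal χ x) * t := by
  induction x using D.F_induction with
  | one => simp
  | add x y hx hy => simp only [map_add, mul_add, add_mul, hx, hy]
  | smul r x hx => simp only [map_smul, mul_smul_comm, smul_mul_assoc, hx]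
  | mul g x hx =>
    rw [scal_gen_mul, map_smul, map_mul, map_mul, FreeAlgebra.lift_ι_apply, ← mul_assoc, h,
      smul_mul_assoc, smul_mul_assoc, mul_assoc, hx, mul_assoc]

namespace CartanRels

variable {D}
variable {𝒜 : Type*} [Ring 𝒜] [Algebra QField 𝒜] {a b : D.Iinf → 𝒜} {q : Module.Dual ℤ P → 𝒜}

theorem q_mul_lift_a (H : D.CartanRels a b q) (h : Module.Dual ℤ P) (x : D.F) :
    q h * FreeAlgebra.lift QField a x = FreeAlgebra.lift QField a
      (D.scal (fun g => qVar ^ (D.lev g * h (D.root (D.idx g)))) x) * q h :=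
  D.mul_lift_of_mul_gen (H.q_a h) x

theorem q_mul_lift_b (H : D.CartanRels a b q) (h : Module.Dual ℤ P) (x : D.F) :
    q h * FreeAlgebra.lift QField b x = FreeAlgebra.lift QField b
      (D.scal (fun g => qVar ^ (-(D.lev g * h (D.root (D.idx g))))) x) * q h :=
  D.mul_lift_of_mul_gen (H.q_b h) x

theorem cow_b (H : D.CartanRels a b q) (g h : D.Iinf) :
    q (D.cow g) * b h = qVar ^ (-D.pair g h) • (b h * q (D.cow g)) := by
  rw [H.q_b, lev_mul_cow]

theorem ncow_b (H : D.CartanRels a b q) (g h : D.Iinf) :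
    q (-D.cow g) * b h = qVar ^ (D.pair g h) • (b h * q (-D.cow g)) := by
  rw [H.q_b, LinearMap.neg_apply, mul_neg, neg_neg, lev_mul_cow]

/-- The commutation of `a_g` with the negative part. -/
theorem a_mul_lift_b (H : D.CartanRels a b q) (g : D.Iinf) (y : D.F) :
    a g * FreeAlgebra.lift QField b y =
      FreeAlgebra.lift QField b (D.scal (D.sig g) y) * a g +
        q (D.cow g) * FreeAlgebra.lift QField b (D.contr g y) -
          FreeAlgebra.lift QField b (D.scal (D.sig g) (D.contrR g y)) * q (-D.cow g) := by
  induction y using D.F_induction with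
  | one => simp [contr_one, contrR_one]
  | add x y hx hy => simp only [map_add, mul_add, add_mul, hx, hy]; abel
  | smul r x hx => simp only [map_smul, mul_smul_comm, smul_mul_assoc, hx, smul_add, smul_sub]
  | mul h y hy =>
    have e1 : a g * b h = D.sig g h • (b h * a g) +
        if h = g then D.tau g • (q (D.cow g) - q (-D.cow g)) else 0 := by
      rw [← sub_eq_iff_eq_add', H.a_b]; simp only [eq_comm]
    -- Putting `K_g` back in front of `b_h` turns the bare sign into the full braiding factor, the
    -- one in the product rule for `contr g`.
    have e2 : D.sig g h • (b h * q (D.cow g)) = D.braid h g • (q (D.cow g) * b h) := by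
      rw [H.cow_b, smul_smul, D.braid_comm, braid_eq, mul_assoc, ← zpow_add₀ qVar_ne_zero,
        add_neg_cancel, zpow_zero, mul_one]
    -- On the other side `K_g⁻¹` passes to the right end, and the factor it leaves is the twist in
    -- the product rule for `contrR g`.
    have e3 : q (-D.cow g) * FreeAlgebra.lift QField b y = FreeAlgebra.lift QField b
        (D.scal (D.sig g) (D.twist g y)) * q (-D.cow g) := by
      rw [D.mul_lift_of_mul_gen (H.ncow_b g) y, twist_eq_scal, scal_scal]
      congr 4
      funext k
      rw [braid_eq, mul_right_comm, sig_mul_self, one_mul]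
    rw [map_mul, FreeAlgebra.lift_ι_apply, ← mul_assoc, e1, add_mul, smul_mul_assoc, mul_assoc, hy,
      contr_gen_mul, contrR_gen_mul, scal_gen_mul, map_add, map_add, map_add, scal_gen_mul]
    simp only [map_smul, map_mul, FreeAlgebra.lift_ι_apply, mul_sub, mul_add, add_mul, smul_add,
      smul_sub, mul_smul_comm, smul_mul_assoc]
    rw [← mul_assoc (b h) (q (D.cow g)), ← mul_assoc (q (D.cow g)) (b h), ← smul_mul_assoc _ (b h * q _), e2,
      smul_mul_assoc]
    split_ifs with hh
    · simp only [map_smul, mul_smul_comm, smul_mul_assoc, sub_mul, e3, mul_assoc]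
      abel
    · simp only [map_zero, mul_zero, zero_mul, mul_assoc]
      abel

/-- The relations are stable under the exchange of the positive and of the negative part. -/
theorem swap (H : D.CartanRels a b q) :
    D.CartanRels (fun g => D.sig g g • b g) a (fun h => q (-h)) where
  q_zero := by simp [H.q_zero]
  q_add h h' := by rw [neg_add, H.q_add]
  q_a h g := by
    rw [mul_smul_comm, H.q_b, smul_mul_assoc, smul_comm, LinearMap.neg_apply, mul_neg, neg_neg]
  q_b h g := by rw [H.q_a, LinearMap.neg_apply, mul_neg]
  a_b g h := by
    have e := H.a_b h g
    rw [sub_eq_iff_eq_add, D.sig_comm h g] at e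
    simp only [smul_mul_assoc, mul_smul_comm, e, smul_smul, smul_add]
    by_cases hgh : g = h
    · subst hgh
      simp only [if_true, sig_mul_self, neg_neg, mul_one, smul_sub, one_smul]
      abel
    · rw [if_neg hgh, if_neg (Ne.symm hgh), smul_zero, zero_add, mul_left_comm, sig_mul_self,
        mul_one, sub_self]

/-- The commutation of `b_g` with the positive part. -/
theorem lift_a_mul_b (H : D.CartanRels a b q) (g : D.Iinf) (x : D.F) :
    FreeAlgebra.lift QField a x * b g =
      b g * FreeAlgebra.lift QField a (D.scal (D.sig g) x) +
        FreeAlgebra.lift QField a (D.contrR g x) * q (D.cow g) -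
          q (-D.cow g) * FreeAlgebra.lift QField a (D.scal (D.sig g) (D.contr g x)) := by
  -- The preceding formula is read in the exchanged triple, where `b_g` plays the role of `a_g`.
  -- Starting from the sign twist of `x` leaves `x` itself untwisted, and a common factor `sig g g`
  -- is removed at the end.
  have e := H.swap.a_mul_lift_b g (D.scal (D.sig g) x)
  have hs : ∀ z, D.scal (D.sig g) (D.scal (D.sig g) z) = z := fun z => by
    rw [scal_scal]
    simp only [sig_mul_self, scal_one]
  rw [contr_scal, contrR_scal, hs, neg_neg] at e
  simp only [smul_mul_assoc, mul_smul_comm, map_smul, hs] at e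
  have e' := congrArg (D.sig g g • ·) e
  simp only [smul_smul, smul_add, smul_sub, sig_mul_self, one_smul] at e'
  rw [e']
  abel

variable (H : D.CartanRels a b q)
    (ha : ∀ x ∈ D.radical, FreeAlgebra.lift QField a x = 0)
    (hb : ∀ x ∈ D.radical, FreeAlgebra.lift QField b x = 0)

/-- The value on a generator of the homomorphism from `U`. -/
def onGen (a b : D.Iinf → 𝒜) (q : Module.Dual ℤ P → 𝒜) : D.Gen → 𝒜
  | Gen.a g => a g
  | Gen.b g => b g
  | Gen.q h => q h

/-- The homomorphism from `U` to an algebra in which the defining relations hold. -/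
noncomputable def liftU : D.U →ₐ[QField] 𝒜 :=
  RingQuot.liftAlgHom QField ⟨FreeAlgebra.lift QField (onGen a b q), by
    have hqq : ∀ h, q h * q (-h) = 1 := fun h => by rw [← H.q_add, add_neg_cancel, H.q_zero]
    have hfa : ∀ g, FreeAlgebra.lift QField (onGen a b q) (D.fa g) = a g := fun g => by simp [onGen]
    have hfb : ∀ g, FreeAlgebra.lift QField (onGen a b q) (D.fb g) = b g := fun g => by simp [onGen]
    have hfq : ∀ h, FreeAlgebra.lift QField (onGen a b q) (D.fq h) = q h := fun g => by simp [onGen]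
    have hla : ∀ x, FreeAlgebra.lift QField (onGen a b q) (FreeAlgebra.lift QField D.fa x) =
        FreeAlgebra.lift QField a x := by
      refine DFunLike.congr_fun (F := D.F →ₐ[QField] 𝒜)
        (f := (FreeAlgebra.lift QField (onGen a b q)).comp (FreeAlgebra.lift QField D.fa))
        (g := FreeAlgebra.lift QField a) (FreeAlgebra.hom_ext (funext fun g => by simp [onGen]))
    have hlb : ∀ x, FreeAlgebra.lift QField (onGen a b q) (FreeAlgebra.lift QField D.fb x) =
        FreeAlgebra.lift QField b x := by
      refine DFunLike.congr_fun (F := D.F →ₐ[QField] 𝒜)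
        (f := (FreeAlgebra.lift QField (onGen a b q)).comp (FreeAlgebra.lift QField D.fb))
        (g := FreeAlgebra.lift QField b) (FreeAlgebra.hom_ext (funext fun g => by simp [onGen]))
    intro x y hxy
    cases hxy with
    | q_zero => rw [hfq, H.q_zero, map_one]
    | q_add h h' => rw [map_mul, hfq, hfq, hfq, H.q_add]
    | q_a h g => rw [map_mul, map_mul, hfq, hfq, map_smul, hfa, H.q_a, smul_mul_assoc, mul_assoc,
        hqq, mul_one]
    | q_b h g => rw [map_mul, map_mul, hfq, hfq, map_smul, hfb, H.q_b, smul_mul_assoc, mul_assoc,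
        hqq, mul_one]
    -- The Serre and commutation relations need no separate check: they are images of elements of
    -- `ℛ`.
    | serre_a g h hg hgh =>
      rw [← lift_serreF, hla, ha _ (D.serreF_mem_radical g h hg hgh), map_zero]
    | serre_b g h hg hgh =>
      rw [← lift_serreF, hlb, hb _ (D.serreF_mem_radical g h hg hgh), map_zero]
    | comm_a g h hgh =>
      have := ha _ (D.comm_mem_radical g h hgh)
      rw [map_zero, map_sub, map_smul, map_mul, map_mul, hfa, hfa]
      simpa using this
    | comm_b g h hgh =>
      have := hb _ (D.comm_mem_radical g h hgh)
      rw [map_zero, map_sub, map_smul, map_mul, map_mul, hfb, hfb]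
      simpa using this
    | a_b g h =>
      have := H.a_b g h
      rw [map_sub, map_smul, map_mul, map_mul, hfa, hfb]
      refine this.trans ?_
      split_ifs
      · rw [map_smul, map_sub, hfq, hfq]
      · rw [map_zero]
    | radical_a x hx => rw [hla, ha x hx, map_zero]
    | radical_b x hx => rw [hlb, hb x hx, map_zero]⟩

theorem liftU_a (g : D.Iinf) : H.liftU ha hb (D.a g) = a g := by
  simp [liftU, SuperBorcherdsCartanDatum.a, onGen]

theorem liftU_b (g : D.Iinf) : H.liftU ha hb (D.b g) = b g := by
  simp [liftU, SuperBorcherdsCartanDatum.b, onGen]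

theorem liftU_qpow (h : Module.Dual ℤ P) : H.liftU ha hb (D.qpow h) = q h := by
  simp [liftU, qpow, onGen]

end CartanRels

theorem cartanRels_U : D.CartanRels D.a D.b D.qpow where
  q_zero := by
    have := RingQuot.mkAlgHom_rel QField (Rel.q_zero (D := D))
    rwa [map_one] at this
  q_add h h' := by
    have := RingQuot.mkAlgHom_rel QField (Rel.q_add (D := D) h h')
    rw [map_mul] at this
    exact this.symm
  q_a h g := by
    have e0 := RingQuot.mkAlgHom_rel QField (Rel.q_zero (D := D))
    have e1 := RingQuot.mkAlgHom_rel QField (Rel.q_add (D := D) (-h) h)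
    have e2 := RingQuot.mkAlgHom_rel QField (Rel.q_a (D := D) h g)
    rw [neg_add_cancel, e0, map_one, map_mul] at e1
    rw [map_mul, map_mul, map_smul] at e2
    have := congrArg (· * D.qpow h) e2
    simp only [qpow, mul_assoc, e1, mul_one, smul_mul_assoc] at this
    exact this
  q_b h g := by
    have e0 := RingQuot.mkAlgHom_rel QField (Rel.q_zero (D := D))
    have e1 := RingQuot.mkAlgHom_rel QField (Rel.q_add (D := D) (-h) h)
    have e2 := RingQuot.mkAlgHom_rel QField (Rel.q_b (D := D) h g)
    rw [neg_add_cancel, e0, map_one, map_mul] at e1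
    rw [map_mul, map_mul, map_smul] at e2
    have := congrArg (· * D.qpow h) e2
    simp only [qpow, mul_assoc, e1, mul_one, smul_mul_assoc] at this
    exact this
  a_b g h := by
    have e := RingQuot.mkAlgHom_rel QField (Rel.a_b (D := D) g h)
    rw [map_sub, map_smul, map_mul, map_mul] at e
    refine Eq.trans e ?_
    split_ifs
    · rw [map_smul, map_sub]; rfl
    · rw [map_zero]

theorem plus_cls (x : D.F) : D.plus (D.cls x) = FreeAlgebra.lift QField D.a x := by
  change (RingQuot.mkAlgHom QField D.Rel).comp (FreeAlgebra.lift QField D.fa) x = _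
  exact DFunLike.congr_fun (F := D.F →ₐ[QField] D.U)
    (FreeAlgebra.hom_ext (funext fun g => by simp [a])) x

theorem minus_cls (x : D.F) : D.minus (D.cls x) = FreeAlgebra.lift QField D.b x := by
  change (RingQuot.mkAlgHom QField D.Rel).comp (FreeAlgebra.lift QField D.fb) x = _
  exact DFunLike.congr_fun (F := D.F →ₐ[QField] D.U)
    (FreeAlgebra.hom_ext (funext fun g => by simp [b])) x

theorem lift_a_radical : ∀ x ∈ D.radical, FreeAlgebra.lift QField D.a x = 0 := fun x hx => by
  rw [← plus_cls, D.cls_eq_zero.mpr hx, map_zero]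

theorem lift_b_radical : ∀ x ∈ D.radical, FreeAlgebra.lift QField D.b x = 0 := fun x hx => by
  rw [← minus_cls, D.cls_eq_zero.mpr hx, map_zero]

theorem U_hom_ext {𝒜 : Type*} [Ring 𝒜] [Algebra QField 𝒜] {f f' : D.U →ₐ[QField] 𝒜}
    (ha : ∀ g, f (D.a g) = f' (D.a g)) (hb : ∀ g, f (D.b g) = f' (D.b g))
    (hq : ∀ h, f (D.qpow h) = f' (D.qpow h)) : f = f' := by
  refine RingQuot.ringQuot_ext' QField _ _ (FreeAlgebra.hom_ext (funext fun g => ?_))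
  cases g with
  | a g => exact ha g
  | b g => exact hb g
  | q h => exact hq h

/-! ### Highest weight modules and the projections of `U` onto `F / ℛ` -/

/-- The mirror image of `contr_gen_mul`, needed because `b_h` acts by right multiplication on the
highest weight module. Reaching the last letter costs a braiding with all of `x`, whence the twist.
-/
theorem contr_mul_gen (g h : D.Iinf) (x : D.F) :
    D.contr g (x * D.gen h) =
      D.contr g x * D.gen h + (if h = g then D.tau g • D.twist g x else 0) := by
  induction x using D.F_induction with
  | one =>
    have := D.contr_gen_mul g h 1
    rw [mul_one, contr_one, mul_zero, smul_zero, add_zero] at this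
    rw [one_mul, this, contr_one, zero_mul, zero_add, map_one]
  | add x y hx hy => simp only [add_mul, map_add, hx, hy, smul_add]; split_ifs <;> abel
  | smul r x hx =>
    simp only [smul_mul_assoc, map_smul, hx, smul_add]
    split_ifs <;> simp [smul_comm r]
  | mul k x hx =>
    rw [mul_assoc, contr_gen_mul, contr_gen_mul, hx, twist_eq_scal, scal_gen_mul, add_mul]
    have e : D.braid k g • (D.gen k * if h = g then D.tau g • D.scal (D.braid g) x else 0) =
        if h = g then D.tau g • D.braid g k • (D.gen k * D.scal (D.braid g) x) else 0 := by
      split_ifs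
      · rw [mul_smul_comm, smul_comm, D.braid_comm]
      · simp
    rw [mul_add, smul_add, e, ← add_assoc, smul_mul_assoc, mul_assoc]
    congr 2
    split_ifs <;> simp

theorem contrR_mul_gen (g h : D.Iinf) (x : D.F) :
    D.contrR g (x * D.gen h) =
      (if h = g then D.tau g • x else 0) + D.braid g h • (D.contrR g x * D.gen h) := by
  induction x using D.F_induction with
  | one =>
    have := D.contrR_gen_mul g h 1
    rw [mul_one, contrR_one, mul_zero, zero_add, map_one] at this
    rw [one_mul, this, contrR_one, zero_mul, smul_zero, add_zero]
  | add x y hx hy => simp only [add_mul, map_add, hx, hy, smul_add]; split_ifs <;> abel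
  | smul r x hx =>
    simp only [smul_mul_assoc, map_smul, hx, smul_add]
    split_ifs <;> simp [smul_comm r]
  | mul k x hx =>
    rw [mul_assoc, contrR_gen_mul, contrR_gen_mul, hx, map_mul, twist_eq_scal, scal_gen, mul_add,
      add_mul, smul_add, mul_smul_comm, mul_smul_comm, ← add_assoc, mul_assoc]
    congr 1
    · congr 1
      split_ifs <;> simp
    · split_ifs
      · rw [smul_mul_assoc, smul_comm]
      · simp

theorem contrV_rmV (g h : D.Iinf) (x : D.FmodR) : D.contrV g (D.rmV h x) =
    D.rmV h (D.contrV g x) + (if h = g then D.tau g • D.scalV (D.braid g) x else 0) := by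
  obtain ⟨x, rfl⟩ := D.cls_surjective x
  rw [rmV_cls, contrV_cls, contr_mul_gen, map_add, apply_ite D.cls, map_smul, map_zero]
  rfl

theorem contrRV_rmV (g h : D.Iinf) (x : D.FmodR) : D.contrRV g (D.rmV h x) =
    (if h = g then D.tau g • x else 0) + D.braid g h • D.rmV h (D.contrRV g x) := by
  obtain ⟨x, rfl⟩ := D.cls_surjective x
  rw [rmV_cls, contrRV_cls, contrR_mul_gen, map_add, map_smul, apply_ite D.cls, map_smul, map_zero]
  rfl

theorem scalV_rmV (χ : D.Iinf → QField) (g : D.Iinf) (x : D.FmodR) :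
    D.scalV χ (D.rmV g x) = χ g • D.rmV g (D.scalV χ x) := by
  obtain ⟨x, rfl⟩ := D.cls_surjective x
  rw [rmV_cls, scalV_cls, map_mul, scal_gen, mul_smul_comm, map_smul]
  rfl

theorem V_induction_right {C : D.FmodR → Prop} (one : C (D.cls 1))
    (add : ∀ x y, C x → C y → C (x + y)) (smul : ∀ (r : QField) x, C x → C (r • x))
    (mul : ∀ g x, C x → C (D.rmV g x)) (x : D.FmodR) : C x := by
  obtain ⟨x, rfl⟩ := D.cls_surjective x
  induction x using D.word_induction with
  | zero =>
    have := smul 0 _ one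
    rwa [zero_smul] at this
  | add x y hx hy => rw [map_add]; exact add _ _ hx hy
  | smul r x hx => rw [map_smul]; exact smul _ _ hx
  | word w =>
    induction w using List.reverseRecOn with
    | nil => exact one
    | append_singleton w g ih => rw [word_concat]; exact mul g _ ih

/-- The right action of `a_g` on the right highest weight module of weight `Λ`. -/
noncomputable def vermaA (Λ : P) (g : D.Iinf) : Module.End QField D.FmodR :=
  D.sig g g • (qVar ^ (-D.cow g Λ) •
      (D.scalV (fun h => qVar ^ (-D.pair g h)) ∘ₗ D.contrRV g) -
    qVar ^ (D.cow g Λ) • (D.scalV (D.sig g) ∘ₗ D.contrV g))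

/-- The right action of `q^h` on the right highest weight module of weight `Λ`. -/
noncomputable def vermaQ (Λ : P) (h : Module.Dual ℤ P) : Module.End QField D.FmodR :=
  qVar ^ (h Λ) • D.scalV fun g => qVar ^ (D.lev g * h (D.root (D.idx g)))

theorem scalV_comm (χ ψ : D.Iinf → QField) (x : D.FmodR) :
    D.scalV χ (D.scalV ψ x) = D.scalV ψ (D.scalV χ x) := by
  rw [scalV_scalV, scalV_scalV]
  simp only [mul_comm]

theorem vermaA_apply (Λ : P) (g : D.Iinf) (x : D.FmodR) :
    D.vermaA Λ g x = D.sig g g • (qVar ^ (-D.cow g Λ) •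
      D.scalV (fun h => qVar ^ (-D.pair g h)) (D.contrRV g x) -
    qVar ^ (D.cow g Λ) • D.scalV (D.sig g) (D.contrV g x)) := rfl

theorem vermaQ_apply (Λ : P) (h : Module.Dual ℤ P) (x : D.FmodR) :
    D.vermaQ Λ h x =
      qVar ^ (h Λ) • D.scalV (fun g => qVar ^ (D.lev g * h (D.root (D.idx g)))) x := rfl

/-- The operators are forced: in `1 · y⁻ a_g` one moves `a_g` to the left by the commutation formula
and uses that the generator is killed by `a_g` and has weight `Λ`. The module is a right one, hence
the opposite algebra, because `H_S` has `U⁺ U⁰` to the left of `U⁻_ν`. -/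
theorem cartanRels_verma (Λ : P) : D.CartanRels (fun g => MulOpposite.op (D.vermaA Λ g))
    (fun g => MulOpposite.op (D.rmV g)) (fun h => MulOpposite.op (D.vermaQ Λ h)) where
  q_zero := by
    refine congrArg MulOpposite.op (LinearMap.ext fun x => ?_)
    simp [vermaQ_apply, scalV_one]
  q_add h h' := by
    rw [← MulOpposite.op_mul]
    refine congrArg MulOpposite.op (LinearMap.ext fun x => ?_)
    rw [Module.End.mul_apply, vermaQ_apply, vermaQ_apply, vermaQ_apply, map_smul, scalV_scalV,
      smul_smul, LinearMap.add_apply, zpow_add₀ qVar_ne_zero, mul_comm]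
    simp only [LinearMap.add_apply, mul_add, zpow_add₀ qVar_ne_zero]
  q_a h g := by
    rw [← MulOpposite.op_mul, ← MulOpposite.op_mul, ← MulOpposite.op_smul]
    refine congrArg MulOpposite.op (LinearMap.ext fun x => ?_)
    rw [LinearMap.smul_apply, Module.End.mul_apply, Module.End.mul_apply, vermaA_apply,
      vermaQ_apply, vermaA_apply, vermaQ_apply]
    simp only [map_smul, map_sub, contrV_scalV, contrRV_scalV, smul_sub]
    rw [D.scalV_comm (D.sig g), D.scalV_comm fun h => qVar ^ (-D.pair g h)]
    congr 1 <;> simp only [smul_smul] <;> congr 1 <;> ring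
  q_b h g := by
    rw [← MulOpposite.op_mul, ← MulOpposite.op_mul, ← MulOpposite.op_smul]
    refine congrArg MulOpposite.op (LinearMap.ext fun x => ?_)
    rw [LinearMap.smul_apply, Module.End.mul_apply, Module.End.mul_apply, vermaQ_apply,
      vermaQ_apply, scalV_rmV, map_smul, smul_smul, smul_smul,
      mul_right_comm, ← zpow_add₀ qVar_ne_zero, neg_add_cancel, zpow_zero, one_mul]
  a_b g h := by
    rw [← MulOpposite.op_mul, ← MulOpposite.op_mul, ← MulOpposite.op_smul, ← MulOpposite.op_sub,
      ← MulOpposite.op_sub, ← MulOpposite.op_smul, ← MulOpposite.op_zero,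
      ← apply_ite MulOpposite.op]
    refine congrArg MulOpposite.op (LinearMap.ext fun x => ?_)
    rw [LinearMap.sub_apply, LinearMap.smul_apply, Module.End.mul_apply, Module.End.mul_apply,
      vermaA_apply, vermaA_apply, contrRV_rmV, contrV_rmV]
    simp only [map_add, map_smul, map_sub, scalV_rmV, smul_add, smul_sub, smul_smul]
    have e1 : D.sig g h * (D.sig g g * (qVar ^ (-D.cow g Λ) * (D.braid g h *
        qVar ^ (-D.pair g h)))) = D.sig g g * qVar ^ (-D.cow g Λ) := by
      rw [braid_eq, mul_assoc (D.sig g h), ← zpow_add₀ qVar_ne_zero, add_neg_cancel, zpow_zero]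
      linear_combination (D.sig g g * qVar ^ (-D.cow g Λ)) * D.sig_mul_self g h
    have e2 : D.sig g h * (D.sig g g * (qVar ^ (D.cow g Λ) * D.sig g h)) =
        D.sig g g * qVar ^ (D.cow g Λ) := by
      linear_combination (D.sig g g * qVar ^ (D.cow g Λ)) * D.sig_mul_self g h
    rw [e1, e2]
    by_cases hgh : g = h
    · subst hgh
      have e3 : D.scalV (D.sig g) (D.scalV (D.braid g) x) =
          D.scalV (fun k => qVar ^ D.pair g k) x := by
        rw [scalV_scalV]
        congr 2
        funext k
        rw [braid_eq, mul_right_comm, sig_mul_self, one_mul]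
      have e4 : ∀ c : QField, D.sig g g * (D.sig g g * c) = c := fun c => by
        rw [← mul_assoc, sig_mul_self, one_mul]
      simp only [if_true, map_smul, smul_smul, LinearMap.smul_apply, LinearMap.sub_apply,
        vermaQ_apply, e3, LinearMap.neg_apply, mul_neg, lev_mul_cow, e4,
        mul_comm (D.tau g)]
      abel
    · rw [if_neg hgh, if_neg (Ne.symm hgh), if_neg (Ne.symm hgh)]
      simp

theorem lift_rmV (x : D.F) (y : D.F) :
    (FreeAlgebra.lift QField (fun g => MulOpposite.op (D.rmV g)) x).unop (D.cls y) =
      D.cls (y * x) := by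
  induction x using D.F_induction generalizing y with
  | one => simp
  | add x z hx hz => rw [map_add, MulOpposite.unop_add, LinearMap.add_apply, hx, hz, mul_add, map_add]
  | smul r x hx => rw [map_smul, MulOpposite.unop_smul, LinearMap.smul_apply, hx, mul_smul_comm, map_smul]
  | mul g x hx =>
    rw [map_mul, FreeAlgebra.lift_ι_apply, MulOpposite.unop_mul, Module.End.mul_apply,
      MulOpposite.unop_op, rmV_cls, hx, mul_assoc]

/-- Both contractions kill 1, so every `a_g` kills the generator and only the counit of `x`
survives. -/
theorem lift_vermaA_one (Λ : P) (x : D.F) :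
    (FreeAlgebra.lift QField (fun g => MulOpposite.op (D.vermaA Λ g)) x).unop (D.cls 1) =
      D.form x 1 • D.cls 1 := by
  induction x using D.F_induction with
  | one => simp [form_one]
  | add x z hx hz => rw [map_add, MulOpposite.unop_add, LinearMap.add_apply, hx, hz, map_add,
      LinearMap.add_apply, add_smul]
  | smul r x hx => rw [map_smul, MulOpposite.unop_smul, LinearMap.smul_apply, hx, map_smul,
      LinearMap.smul_apply, smul_smul, smul_eq_mul]
  | mul g x hx =>
    rw [map_mul, FreeAlgebra.lift_ι_apply, MulOpposite.unop_mul, Module.End.mul_apply,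
      MulOpposite.unop_op, vermaA_apply, contrRV_cls, contrV_cls, contr_one, contrR_one,
      form_gen_mul_left, contr_one]
    simp

/-- Induction on the vector, built by right multiplications. Acting by `x` after `b_g` is rewritten,
by `lift_a_mul_b`, as a combination of terms in which a sign twist or a (twisted) contraction of `x`
acts first. These again lie in `ℛ`, so they kill the shorter vector. -/
theorem lift_vermaA_radical (Λ : P) : ∀ x ∈ D.radical,
    FreeAlgebra.lift QField (fun g => MulOpposite.op (D.vermaA Λ g)) x = 0 := by
  intro x hx
  refine MulOpposite.unop_injective (LinearMap.ext fun y => ?_)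
  rw [MulOpposite.unop_zero, LinearMap.zero_apply]
  induction y using D.V_induction_right generalizing x with
  | one => rw [lift_vermaA_one, D.mem_radical.mp hx, zero_smul]
  | add y z hy hz => rw [map_add, hy x hx, hz x hx, add_zero]
  | smul r y hy => rw [map_smul, hy x hx, smul_zero]
  | mul g y hy =>
    have hs : D.scal (D.sig g) (D.scal (D.sig g) x) = x := by
      rw [scal_scal]; simp only [sig_mul_self, scal_one]
    have hx' := D.scal_mem_radical (D.sig g) hx
    have e := (D.cartanRels_verma Λ).lift_a_mul_b g (D.scal (D.sig g) x)
    rw [(D.cartanRels_verma Λ).q_mul_lift_a, hs] at e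
    have e' := LinearMap.congr_fun (congrArg MulOpposite.unop e) y
    simp only [MulOpposite.unop_sub, MulOpposite.unop_add, MulOpposite.unop_mul,
      LinearMap.sub_apply, LinearMap.add_apply, Module.End.mul_apply, MulOpposite.unop_op] at e'
    rw [hy _ hx', hy _ (D.contrR_mem_radical g hx'), hy _ (D.scal_mem_radical _
      (D.scal_mem_radical _ (D.contr_mem_radical g hx')))] at e'
    simpa using e'.symm

theorem mul_mem_radical_left {x : D.F} (hx : x ∈ D.radical) (y : D.F) : y * x ∈ D.radical := by
  induction y using D.F_induction with
  | one => rwa [one_mul]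
  | add y z hy hz => rw [add_mul]; exact add_mem hy hz
  | smul r y hy => rw [smul_mul_assoc]; exact Submodule.smul_mem _ _ hy
  | mul g y hy => rw [mul_assoc]; exact D.gen_mul_mem_radical g hy

theorem lift_rmV_radical : ∀ x ∈ D.radical,
    FreeAlgebra.lift QField (fun g => MulOpposite.op (D.rmV g)) x = 0 := by
  intro x hx
  refine MulOpposite.unop_injective (LinearMap.ext fun y => ?_)
  obtain ⟨y, rfl⟩ := D.cls_surjective y
  rw [lift_rmV, D.cls_eq_zero.mpr (D.mul_mem_radical_left hx y)]
  rfl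

/-- The right highest weight module of weight `Λ` on `F / ℛ`. -/
noncomputable def verma (Λ : P) : D.U →ₐ[QField] (Module.End QField D.FmodR)ᵐᵒᵖ :=
  (D.cartanRels_verma Λ).liftU (D.lift_vermaA_radical Λ) D.lift_rmV_radical

theorem verma_lift_a (Λ : P) (x : D.F) : D.verma Λ (FreeAlgebra.lift QField D.a x) =
    FreeAlgebra.lift QField (fun g => MulOpposite.op (D.vermaA Λ g)) x :=
  DFunLike.congr_fun (f := (D.verma Λ).comp (FreeAlgebra.lift QField D.a))
    (FreeAlgebra.hom_ext (funext fun g => by simp [verma, CartanRels.liftU_a])) x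

theorem verma_lift_b (Λ : P) (x : D.F) : D.verma Λ (FreeAlgebra.lift QField D.b x) =
    FreeAlgebra.lift QField (fun g => MulOpposite.op (D.rmV g)) x :=
  DFunLike.congr_fun (f := (D.verma Λ).comp (FreeAlgebra.lift QField D.b))
    (FreeAlgebra.hom_ext (funext fun g => by simp [verma, CartanRels.liftU_b])) x

/-- The map `x⁺ q^h y⁻ ↦ ε(x) q^{h(Λ)} y` from `U` to `F / ℛ`. -/
noncomputable def psiNeg (Λ : P) : D.U →ₗ[QField] D.FmodR :=
  LinearMap.applyₗ (D.cls 1) ∘ₗ (MulOpposite.opLinearEquiv QField).symm.toLinearMap ∘ₗ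
    (D.verma Λ).toLinearMap

theorem psiNeg_apply (Λ : P) (u : D.U) : D.psiNeg Λ u = (D.verma Λ u).unop (D.cls 1) := rfl

theorem psiNeg_plus_mul (Λ : P) (x : D.FmodR) (u : D.U) :
    D.psiNeg Λ (D.plus x * u) = D.formR x (D.cls 1) • D.psiNeg Λ u := by
  obtain ⟨x, rfl⟩ := D.cls_surjective x
  rw [psiNeg_apply, plus_cls, map_mul, MulOpposite.unop_mul, Module.End.mul_apply, verma_lift_a,
    lift_vermaA_one, map_smul, formR_cls, psiNeg_apply]

theorem psiNeg_qpow_mul (Λ : P) (h : Module.Dual ℤ P) (u : D.U) :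
    D.psiNeg Λ (D.qpow h * u) = qVar ^ h Λ • D.psiNeg Λ u := by
  rw [psiNeg_apply, map_mul, MulOpposite.unop_mul, Module.End.mul_apply, verma,
    CartanRels.liftU_qpow, MulOpposite.unop_op, vermaQ_apply, scalV_cls, map_one, map_smul]
  rfl

/-- Since `b_g` acts by right multiplication, the generator times `y⁻` is `y`. In particular `y ↦
y⁻` is injective. -/
theorem psiNeg_minus (Λ : P) (y : D.FmodR) : D.psiNeg Λ (D.minus y) = y := by
  obtain ⟨y, rfl⟩ := D.cls_surjective y
  rw [psiNeg_apply, minus_cls, verma_lift_b, lift_rmV, one_mul]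

/-! ### The exchange of the positive and the negative part, and the projection `psiPos` -/

/-- The endomorphism of `U` exchanging the positive and the negative part. -/
noncomputable def omega : D.U →ₐ[QField] D.U :=
  D.cartanRels_U.swap.liftU
    (fun x hx => by rw [lift_smul]; exact D.lift_b_radical _ (D.scal_mem_radical _ hx))
    D.lift_a_radical

theorem omega_a (g : D.Iinf) : D.omega (D.a g) = D.sig g g • D.b g := CartanRels.liftU_a ..
theorem omega_b (g : D.Iinf) : D.omega (D.b g) = D.a g := CartanRels.liftU_b ..
theorem omega_qpow (h : Module.Dual ℤ P) : D.omega (D.qpow h) = D.qpow (-h) :=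
  CartanRels.liftU_qpow ..

/-- The sign endomorphism of `F / ℛ`. -/
noncomputable def signV : D.FmodR →ₗ[QField] D.FmodR := D.scalV fun g => D.sig g g

theorem signV_signV (x : D.FmodR) : D.signV (D.signV x) = x := by
  rw [signV, scalV_scalV]; simp only [sig_mul_self, scalV_one]

theorem omega_plus (x : D.FmodR) : D.omega (D.plus x) = D.minus (D.signV x) := by
  obtain ⟨x, rfl⟩ := D.cls_surjective x
  rw [signV, scalV_cls, plus_cls, minus_cls, ← lift_smul]
  exact DFunLike.congr_fun (f := D.omega.comp (FreeAlgebra.lift QField D.a))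
    (FreeAlgebra.hom_ext (funext fun g => by simp [omega_a])) x

theorem omega_minus (x : D.FmodR) : D.omega (D.minus x) = D.plus x := by
  obtain ⟨x, rfl⟩ := D.cls_surjective x
  rw [minus_cls, plus_cls]
  exact DFunLike.congr_fun (f := D.omega.comp (FreeAlgebra.lift QField D.b))
    (FreeAlgebra.hom_ext (funext fun g => by simp [omega_b])) x

theorem signU_a (g : D.Iinf) : D.signU (D.a g) = D.sig g g • D.a g := by
  simp [signU, a, signFree, genPar, sig_self]

theorem signU_b (g : D.Iinf) : D.signU (D.b g) = D.sig g g • D.b g := by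
  simp [signU, b, signFree, genPar, sig_self]

theorem signU_qpow (h : Module.Dual ℤ P) : D.signU (D.qpow h) = D.qpow h := by
  simp [signU, qpow, signFree, genPar, sgn]

/-- The sign that `omega` puts on `a_g ↦ b_g` appears once for each generator. So `omega` has order
dividing 4 and is bijective, and statements about one half of `U` can be carried to the other. -/
theorem omega_omega (u : D.U) : D.omega (D.omega u) = D.signU u := by
  refine DFunLike.congr_fun (f := D.omega.comp D.omega) (D.U_hom_ext ?_ ?_ ?_) u
  · intro g; simp [omega_a, omega_b, signU_a]
  · intro g; simp [omega_a, omega_b, signU_b]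
  · intro h; simp [omega_qpow, signU_qpow]

theorem omega_surjective : Function.Surjective D.omega := fun u =>
  ⟨D.omega (D.signU u), by rw [omega_omega, signU_signU]⟩

theorem signU_plus (x : D.FmodR) : D.signU (D.plus x) = D.plus (D.signV x) := by
  rw [← omega_omega, omega_plus, omega_minus]

theorem signU_minus (x : D.FmodR) : D.signU (D.minus x) = D.minus (D.signV x) := by
  rw [← omega_omega, omega_minus, omega_plus]

/-- The map `y⁻ q^h x⁺ ↦ ε(y) x` from `U` to `F / ℛ`. -/
noncomputable def psiPos : D.U →ₗ[QField] D.FmodR :=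
  D.signV ∘ₗ D.psiNeg 0 ∘ₗ D.omega.toLinearMap

theorem psiPos_plus (x : D.FmodR) : D.psiPos (D.plus x) = x := by
  simp only [psiPos, LinearMap.comp_apply, AlgHom.toLinearMap_apply, omega_plus, psiNeg_minus,
    signV_signV]

theorem psiPos_qpow_mul (h : Module.Dual ℤ P) (u : D.U) :
    D.psiPos (D.qpow h * u) = D.psiPos u := by
  simp only [psiPos, LinearMap.comp_apply, AlgHom.toLinearMap_apply, map_mul, omega_qpow,
    psiNeg_qpow_mul, map_zero, zpow_zero, one_smul]

theorem psiPos_minus_mul (y : D.FmodR) (u : D.U) :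
    D.psiPos (D.minus y * u) = D.formR y (D.cls 1) • D.psiPos u := by
  simp only [psiPos, LinearMap.comp_apply, AlgHom.toLinearMap_apply, map_mul, omega_minus,
    psiNeg_plus_mul, map_smul]

/-! ### The tensor square of `U` and the comultiplications -/

theorem a_mem (g : D.Iinf) : D.a g ∈ D.parity (D.par g) := by
  rw [mem_parity, signU_a, sig_self]

theorem b_mem (g : D.Iinf) : D.b g ∈ D.parity (D.par g) := by
  rw [mem_parity, signU_b, sig_self]

theorem qpow_mem (h : Module.Dual ℤ P) : D.qpow h ∈ D.parity 0 := by
  rw [mem_parity, signU_qpow, sgn_zero, one_smul]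

theorem one_mem_parity : (1 : D.U) ∈ D.parity 0 := by
  rw [mem_parity, map_one, sgn_zero, one_smul]

theorem pt_add_left (x x' y : D.U) :
    D.pureTensor (x + x') y = D.pureTensor x y + D.pureTensor x' y :=
  (congrArg (GradedTensorProduct.of QField D.parity D.parity) (TensorProduct.add_tmul x x' y)).trans (map_add _ _ _)

theorem pt_add_right (x y y' : D.U) :
    D.pureTensor x (y + y') = D.pureTensor x y + D.pureTensor x y' :=
  (congrArg (GradedTensorProduct.of QField D.parity D.parity) (TensorProduct.tmul_add x y y')).trans (map_add _ _ _)

theorem pt_sub_left (x x' y : D.U) :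
    D.pureTensor (x - x') y = D.pureTensor x y - D.pureTensor x' y :=
  (congrArg (GradedTensorProduct.of QField D.parity D.parity) (TensorProduct.sub_tmul x x' y)).trans (map_sub _ _ _)

theorem pt_sub_right (x y y' : D.U) :
    D.pureTensor x (y - y') = D.pureTensor x y - D.pureTensor x y' :=
  (congrArg (GradedTensorProduct.of QField D.parity D.parity) (TensorProduct.tmul_sub x y y')).trans (map_sub _ _ _)

theorem pt_smul_left (r : QField) (x y : D.U) :
    D.pureTensor (r • x) y = r • D.pureTensor x y :=
  (congrArg (GradedTensorProduct.of QField D.parity D.parity) (TensorProduct.smul_tmul' r x y).symm).trans (map_smul _ _ _)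

theorem pt_smul_right (r : QField) (x y : D.U) :
    D.pureTensor x (r • y) = r • D.pureTensor x y :=
  (congrArg (GradedTensorProduct.of QField D.parity D.parity) (TensorProduct.tmul_smul r x y)).trans (map_smul _ _ _)

theorem pt_zero_left (y : D.U) : D.pureTensor 0 y = 0 :=
  (congrArg (GradedTensorProduct.of QField D.parity D.parity) (TensorProduct.zero_tmul D.U y)).trans (map_zero _)

theorem pt_zero_right (x : D.U) : D.pureTensor x 0 = 0 :=
  (congrArg (GradedTensorProduct.of QField D.parity D.parity) (TensorProduct.tmul_zero D.U x)).trans (map_zero _)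

theorem pt_mul {i j : ZMod 2} (x y x' y' : D.U) (hy : y ∈ D.parity j) (hx' : x' ∈ D.parity i) :
    D.pureTensor x y * D.pureTensor x' y' =
      sgn (j * i) • D.pureTensor (x * x') (y * y') := by
  have e := GradedTensorProduct.tmul_coe_mul_coe_tmul D.parity D.parity x ⟨y, hy⟩ ⟨x', hx'⟩ y'
  refine e.trans ?_
  have h01 : ∀ k : ZMod 2, k = 0 ∨ k = 1 := by decide
  rcases h01 (j * i) with h | h <;> rw [h]
  · rw [uzpow_zero, one_smul, sgn_zero, one_smul]; rfl
  · rw [uzpow_one, Units.neg_smul, one_smul, sgn_one, neg_smul, one_smul]; rfl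

theorem U_eq_add (x : D.U) : ∃ x₀ ∈ D.parity 0, ∃ x₁ ∈ D.parity 1, x = x₀ + x₁ := by
  refine ⟨_, (D.parityProj 0 x).2, _, (D.parityProj 1 x).2, ?_⟩
  have e1 : sgn 1 • D.signU x = -D.signU x := by
    rw [sgn_one]; exact neg_one_smul QField (D.signU x)
  rw [parityProj_coe, parityProj_coe, sgn_zero, e1, one_smul, ← smul_add, add_add_add_comm,
    add_neg_cancel, add_zero, ← two_smul QField x, smul_smul, inv_mul_cancel₀ two_ne_zero, one_smul]

theorem pt_mul_of_even_left {y : D.U} (hy : y ∈ D.parity 0) (x x' y' : D.U) :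
    D.pureTensor x y * D.pureTensor x' y' = D.pureTensor (x * x') (y * y') := by
  obtain ⟨x₀, h₀, x₁, h₁, rfl⟩ := D.U_eq_add x'
  rw [pt_add_left, mul_add, D.pt_mul x y _ y' hy h₀, D.pt_mul x y _ y' hy h₁, zero_mul, zero_mul,
    sgn_zero, one_smul, one_smul, mul_add, pt_add_left]

theorem pt_mul_of_even_right {x' : D.U} (hx' : x' ∈ D.parity 0) (x y y' : D.U) :
    D.pureTensor x y * D.pureTensor x' y' = D.pureTensor (x * x') (y * y') := by
  obtain ⟨y₀, h₀, y₁, h₁, rfl⟩ := D.U_eq_add y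
  rw [pt_add_right, add_mul, D.pt_mul x _ x' y' h₀ hx', D.pt_mul x _ x' y' h₁ hx', mul_zero,
    mul_zero, sgn_zero, one_smul, one_smul, add_mul, pt_add_right]

theorem pt_one_one : D.pureTensor 1 1 = 1 := rfl

theorem qpow_smul_cow_b (n : ℤ) (g h : D.Iinf) : D.qpow (n • D.cow g) * D.b h =
    qVar ^ (-(n * D.pair g h)) • (D.b h * D.qpow (n • D.cow g)) := by
  rw [D.cartanRels_U.q_b, LinearMap.smul_apply, smul_eq_mul, mul_left_comm, lev_mul_cow]

theorem qpow_smul_cow_a (n : ℤ) (g h : D.Iinf) : D.qpow (n • D.cow g) * D.a h =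
    qVar ^ (n * D.pair g h) • (D.a h * D.qpow (n • D.cow g)) := by
  rw [D.cartanRels_U.q_a, LinearMap.smul_apply, smul_eq_mul, mul_left_comm, lev_mul_cow]

theorem qpow_neg_smul_cow_b (n : ℤ) (g h : D.Iinf) : D.qpow (-(n • D.cow g)) * D.b h =
    qVar ^ (n * D.pair g h) • (D.b h * D.qpow (-(n • D.cow g))) := by
  rw [← neg_smul, qpow_smul_cow_b, neg_mul, neg_neg]

theorem qpow_neg_smul_cow_a (n : ℤ) (g h : D.Iinf) : D.qpow (-(n • D.cow g)) * D.a h =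
    qVar ^ (-(n * D.pair g h)) • (D.a h * D.qpow (-(n • D.cow g))) := by
  rw [← neg_smul, qpow_smul_cow_a, neg_mul]

/-- The coproduct of `a_g`, with `K_g^n` in place of `K_g`. -/
noncomputable def comulA (n : ℤ) (g : D.Iinf) : D.UU :=
  D.pureTensor (D.a g) 1 + D.pureTensor (D.qpow (n • D.cow g)) (D.a g)

/-- The coproduct of `b_g`, with `K_g^n` in place of `K_g`. -/
noncomputable def comulB (n : ℤ) (g : D.Iinf) : D.UU :=
  D.pureTensor (D.b g) (D.qpow (-(n • D.cow g))) + D.pureTensor 1 (D.b g)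

/-- The case `n = 1` gives `Δ` and `n = -1` gives `Δ̄`. In the `a`-`b` relation the mixed terms
cancel for every `n`, the weights from the two legs being opposite. What remains telescopes to `K ⊗
K - K⁻¹ ⊗ K⁻¹`, and this uses `n = ±1`. -/
theorem cartanRels_comul (n : ℤ) (hn : n = 1 ∨ n = -1) :
    D.CartanRels (D.comulA n) (D.comulB n) (fun h => D.pureTensor (D.qpow h) (D.qpow h)) where
  q_zero := by rw [D.cartanRels_U.q_zero, pt_one_one]
  q_add h h' := by rw [D.pt_mul_of_even_left (D.qpow_mem _), D.cartanRels_U.q_add]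
  q_a h g := by
    rw [comulA, mul_add, add_mul, D.pt_mul_of_even_left (D.qpow_mem _),
      D.pt_mul_of_even_left (D.qpow_mem _), D.pt_mul_of_even_right (D.qpow_mem _),
      D.pt_mul_of_even_right (D.qpow_mem _), D.cartanRels_U.q_a, pt_smul_left, pt_smul_right,
      smul_add, mul_one, one_mul, ← D.cartanRels_U.q_add, ← D.cartanRels_U.q_add, add_comm h]
  q_b h g := by
    rw [comulB, mul_add, add_mul, D.pt_mul_of_even_left (D.qpow_mem _),
      D.pt_mul_of_even_left (D.qpow_mem _), D.pt_mul_of_even_right (D.qpow_mem _),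
      D.pt_mul_of_even_right (D.qpow_mem _), D.cartanRels_U.q_b, pt_smul_left, pt_smul_right,
      smul_add, mul_one, one_mul, ← D.cartanRels_U.q_add, ← D.cartanRels_U.q_add, add_comm h]
  a_b g h := by
    have hab := D.cartanRels_U.a_b g h
    have e1 : D.comulA n g * D.comulB n h - D.sig g h • (D.comulB n h * D.comulA n g) =
        D.pureTensor (D.a g * D.b h - D.sig g h • (D.b h * D.a g)) (D.qpow (-(n • D.cow h))) +
        D.pureTensor (D.qpow (n • D.cow g)) (D.a g * D.b h - D.sig g h • (D.b h * D.a g)) := by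
      rw [comulA, comulB, add_mul, add_mul, mul_add, mul_add, mul_add, mul_add,
        D.pt_mul_of_even_left D.one_mem_parity, D.pt_mul_of_even_left D.one_mem_parity,
        D.pt_mul _ _ _ _ (D.a_mem g) (D.b_mem h), D.pt_mul_of_even_right D.one_mem_parity,
        D.pt_mul_of_even_left (D.qpow_mem _), D.pt_mul_of_even_left (D.qpow_mem _),
        D.pt_mul _ _ _ _ (D.b_mem h) (D.a_mem g), D.pt_mul_of_even_right (D.qpow_mem _),
        D.qpow_smul_cow_b, D.qpow_neg_smul_cow_a, D.pair_comm h g, mul_comm (D.par h),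
        pt_sub_left, pt_sub_right]
      simp only [pt_smul_left, pt_smul_right, one_mul, mul_one, smul_add, smul_smul]
      have es : sgn (D.par g * D.par h) = D.sig g h := rfl
      rw [es, D.sig_mul_self, one_smul]
      abel
    rw [e1, hab]
    split_ifs with hgh
    · subst hgh
      rcases hn with rfl | rfl
      · simp only [one_smul, pt_smul_left, pt_smul_right, pt_sub_left, pt_sub_right, smul_sub]
        abel
      · simp only [neg_smul, one_smul, neg_neg, pt_smul_left, pt_smul_right, pt_sub_left,
          pt_sub_right, smul_sub]
        abel
    · rw [pt_zero_left, pt_zero_right, add_zero]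

theorem lift_pt_left_radical {f : D.Iinf → D.U}
    (hf : ∀ x ∈ D.radical, FreeAlgebra.lift QField f x = 0) : ∀ x ∈ D.radical,
    FreeAlgebra.lift QField (fun g => D.pureTensor (f g) 1) x = 0 := by
  intro x hx
  have : FreeAlgebra.lift QField (fun g => D.pureTensor (f g) 1) =
      (GradedTensorProduct.includeLeft D.parity D.parity).comp (FreeAlgebra.lift QField f) :=
    FreeAlgebra.hom_ext (funext fun g => by simp [pureTensor])
  rw [this, AlgHom.comp_apply, hf x hx, map_zero]

theorem lift_pt_right_radical {f : D.Iinf → D.U}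
    (hf : ∀ x ∈ D.radical, FreeAlgebra.lift QField f x = 0) : ∀ x ∈ D.radical,
    FreeAlgebra.lift QField (fun g => D.pureTensor 1 (f g)) x = 0 := by
  intro x hx
  have : FreeAlgebra.lift QField (fun g => D.pureTensor 1 (f g)) =
      (GradedTensorProduct.includeRight D.parity D.parity).comp (FreeAlgebra.lift QField f) :=
    FreeAlgebra.hom_ext (funext fun g => by simp [pureTensor])
  rw [this, AlgHom.comp_apply, hf x hx, map_zero]

/-- Although `q^h` does not commute with `f g` inside `U`, the elements `q^h ⊗ 1` and `1 ⊗ f g`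
commute, because `q^h` is even. So `lift_mul_radical` applies. -/
theorem lift_qpow_pt_radical {f : D.Iinf → D.U}
    (hf : ∀ x ∈ D.radical, FreeAlgebra.lift QField f x = 0) (θ : D.Iinf → Module.Dual ℤ P) :
    ∀ x ∈ D.radical, FreeAlgebra.lift QField (fun g => D.pureTensor (D.qpow (θ g)) (f g)) x = 0 := by
  have h := D.lift_mul_radical (fun h => D.pureTensor (D.qpow h) 1)
    (by rw [D.cartanRels_U.q_zero, pt_one_one])
    (fun x y => by rw [D.pt_mul_of_even_left D.one_mem_parity, D.cartanRels_U.q_add, mul_one]) θ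
    (fun g => D.pureTensor 1 (f g))
    (fun x g => by rw [D.pt_mul_of_even_left D.one_mem_parity,
      D.pt_mul_of_even_right (D.qpow_mem _), one_mul, one_mul, mul_one, mul_one])
    (D.lift_pt_right_radical hf)
  simpa only [D.pt_mul_of_even_left D.one_mem_parity, one_mul, mul_one] using h

theorem lift_pt_qpow_radical {f : D.Iinf → D.U}
    (hf : ∀ x ∈ D.radical, FreeAlgebra.lift QField f x = 0) (θ : D.Iinf → Module.Dual ℤ P) :
    ∀ x ∈ D.radical, FreeAlgebra.lift QField (fun g => D.pureTensor (f g) (D.qpow (θ g))) x = 0 := by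
  have h := D.lift_mul_radical (fun h => D.pureTensor 1 (D.qpow h))
    (by rw [D.cartanRels_U.q_zero, pt_one_one])
    (fun x y => by rw [D.pt_mul_of_even_right D.one_mem_parity, D.cartanRels_U.q_add, mul_one]) θ
    (fun g => D.pureTensor (f g) 1)
    (fun x g => by rw [D.pt_mul_of_even_left (D.qpow_mem _),
      D.pt_mul_of_even_right D.one_mem_parity, one_mul, one_mul, mul_one, mul_one])
    (D.lift_pt_left_radical hf)
  simpa only [D.pt_mul_of_even_left (D.qpow_mem _), one_mul, mul_one] using h

/-- The summands `a_g ⊗ 1` and `K_g^n ⊗ a_g` commute up to the braiding factor. For `n = -1` the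
power of `q` is inverted, so the two families exchange their roles in `lift_add_radical`. -/
theorem lift_comulA_radical (n : ℤ) (hn : n = 1 ∨ n = -1) : ∀ x ∈ D.radical,
    FreeAlgebra.lift QField (D.comulA n) x = 0 := by
  have h1 := D.lift_pt_left_radical D.lift_a_radical
  have h2 := D.lift_qpow_pt_radical D.lift_a_radical fun g => n • D.cow g
  rcases hn with rfl | rfl
  · refine D.lift_add_radical _ _ (fun g h => ?_) h1 h2
    rw [D.pt_mul _ _ _ _ (D.a_mem g) (D.a_mem h), D.pt_mul_of_even_left D.one_mem_parity,
      qpow_smul_cow_a, pt_smul_left, smul_smul, one_mul, one_mul, mul_one]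
    rfl
  · have e : D.comulA (-1) = fun g => D.pureTensor (D.qpow ((-1 : ℤ) • D.cow g)) (D.a g) +
      D.pureTensor (D.a g) 1 := funext fun g => add_comm _ _
    rw [e]
    refine D.lift_add_radical _ _ (fun g h => ?_) h2 h1
    rw [D.pt_mul _ _ _ _ (D.a_mem h) (D.a_mem g), D.pt_mul_of_even_left D.one_mem_parity,
      qpow_smul_cow_a, pt_smul_left, smul_smul, smul_smul, one_mul, mul_one, braid_eq,
      mul_comm (D.par h), D.pair_comm h g]
    have es : sgn (D.par g * D.par h) = D.sig g h := rfl
    rw [es, mul_right_comm _ _ (D.sig g h), sig_mul_self, one_mul, ← zpow_add₀ qVar_ne_zero, neg_one_mul,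
      add_neg_cancel, zpow_zero, one_smul]

theorem lift_comulB_radical (n : ℤ) (hn : n = 1 ∨ n = -1) : ∀ x ∈ D.radical,
    FreeAlgebra.lift QField (D.comulB n) x = 0 := by
  have h1 := D.lift_pt_right_radical D.lift_b_radical
  have h2 := D.lift_pt_qpow_radical D.lift_b_radical fun g => -(n • D.cow g)
  rcases hn with rfl | rfl
  · have e : D.comulB 1 = fun g => D.pureTensor 1 (D.b g) +
      D.pureTensor (D.b g) (D.qpow (-((1 : ℤ) • D.cow g))) := funext fun g => add_comm _ _
    rw [e]
    refine D.lift_add_radical _ _ (fun g h => ?_) h1 h2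
    rw [D.pt_mul _ _ _ _ (D.b_mem h) (D.b_mem g), D.pt_mul_of_even_right D.one_mem_parity,
      qpow_neg_smul_cow_b, pt_smul_right, smul_smul, one_mul, mul_one, braid_eq,
      mul_comm (D.par h), one_mul]
    have es : sgn (D.par g * D.par h) = D.sig g h := rfl
    rw [es, mul_right_comm, sig_mul_self, one_mul]
  · refine D.lift_add_radical _ _ (fun g h => ?_) h2 h1
    rw [D.pt_mul _ _ _ _ (D.b_mem g) (D.b_mem h), D.pt_mul_of_even_right D.one_mem_parity,
      qpow_neg_smul_cow_b, pt_smul_right, smul_smul, one_mul, mul_one, braid_eq, D.pair_comm h g,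
      neg_one_mul, mul_assoc, ← zpow_add₀ qVar_ne_zero, add_neg_cancel, zpow_zero, mul_one]
    rfl

theorem existsUnique_comul : ∃! Δ : D.U →ₐ[QField] D.UU, D.IsComul Δ := by
  have H := D.cartanRels_comul 1 (Or.inl rfl)
  have hA := D.lift_comulA_radical 1 (Or.inl rfl)
  have hB := D.lift_comulB_radical 1 (Or.inl rfl)
  refine ⟨H.liftU hA hB, ⟨fun h => H.liftU_qpow hA hB h, fun g => ?_, fun g => ?_⟩, ?_⟩
  · rw [H.liftU_a, comulA, one_smul]; rfl
  · rw [H.liftU_b, comulB, one_smul]; rfl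
  · refine fun Δ hΔ => D.U_hom_ext (fun g => ?_) (fun g => ?_) (fun h => ?_)
    · rw [hΔ.a, H.liftU_a, comulA, one_smul]; rfl
    · rw [hΔ.b, H.liftU_b, comulB, one_smul]; rfl
    · rw [hΔ.q, H.liftU_qpow]

theorem existsUnique_barComul : ∃! Δ : D.U →ₐ[QField] D.UU, D.IsBarComul Δ := by
  have H := D.cartanRels_comul (-1) (Or.inr rfl)
  have hA := D.lift_comulA_radical (-1) (Or.inr rfl)
  have hB := D.lift_comulB_radical (-1) (Or.inr rfl)
  refine ⟨H.liftU hA hB, ⟨fun h => H.liftU_qpow hA hB h, fun g => ?_, fun g => ?_⟩, ?_⟩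
  · rw [H.liftU_a, comulA, neg_smul, one_smul]; rfl
  · rw [H.liftU_b, comulB, neg_smul, one_smul, neg_neg]; rfl
  · refine fun Δ hΔ => D.U_hom_ext (fun g => ?_) (fun g => ?_) (fun h => ?_)
    · rw [hΔ.a, H.liftU_a, comulA, neg_smul, one_smul]; rfl
    · rw [hΔ.b, H.liftU_b, comulB, neg_smul, one_smul, neg_neg]; rfl
    · rw [hΔ.q, H.liftU_qpow]

/-! ### Commutation in `U` -/

theorem a_mul_plus (g : D.Iinf) (x : D.FmodR) : D.a g * D.plus x = D.plus (D.lmV g x) := by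
  obtain ⟨x, rfl⟩ := D.cls_surjective x
  rw [lmV_cls, plus_cls, plus_cls, map_mul, FreeAlgebra.lift_ι_apply]

theorem plus_mul_a (g : D.Iinf) (x : D.FmodR) : D.plus x * D.a g = D.plus (D.rmV g x) := by
  obtain ⟨x, rfl⟩ := D.cls_surjective x
  rw [rmV_cls, plus_cls, plus_cls, map_mul, FreeAlgebra.lift_ι_apply]

theorem b_mul_minus (g : D.Iinf) (x : D.FmodR) : D.b g * D.minus x = D.minus (D.lmV g x) := by
  obtain ⟨x, rfl⟩ := D.cls_surjective x
  rw [lmV_cls, minus_cls, minus_cls, map_mul, FreeAlgebra.lift_ι_apply]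

theorem minus_mul_b (g : D.Iinf) (x : D.FmodR) : D.minus x * D.b g = D.minus (D.rmV g x) := by
  obtain ⟨x, rfl⟩ := D.cls_surjective x
  rw [rmV_cls, minus_cls, minus_cls, map_mul, FreeAlgebra.lift_ι_apply]

/-- The character `g ↦ q^{⟨h, |g|⟩}` of the degrees. -/
noncomputable def wt (h : Module.Dual ℤ P) (g : D.Iinf) : QField :=
  qVar ^ (D.lev g * h (D.root (D.idx g)))

theorem wt_neg_mul (h : Module.Dual ℤ P) (g : D.Iinf) : D.wt (-h) g * D.wt h g = 1 := by
  rw [wt, wt, ← zpow_add₀ qVar_ne_zero, LinearMap.neg_apply, mul_neg, neg_add_cancel, zpow_zero]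

theorem scalV_wt_neg (h : Module.Dual ℤ P) (x : D.FmodR) :
    D.scalV (D.wt (-h)) (D.scalV (D.wt h) x) = x := by
  rw [scalV_scalV]
  simp only [mul_comm (D.wt h _), wt_neg_mul, scalV_one]

theorem qpow_mul_plus (h : Module.Dual ℤ P) (x : D.FmodR) :
    D.qpow h * D.plus x = D.plus (D.scalV (D.wt h) x) * D.qpow h := by
  obtain ⟨x, rfl⟩ := D.cls_surjective x
  rw [scalV_cls, plus_cls, plus_cls, D.cartanRels_U.q_mul_lift_a]
  rfl

theorem qpow_mul_minus (h : Module.Dual ℤ P) (x : D.FmodR) :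
    D.qpow h * D.minus x = D.minus (D.scalV (D.wt (-h)) x) * D.qpow h := by
  obtain ⟨x, rfl⟩ := D.cls_surjective x
  rw [scalV_cls, minus_cls, minus_cls, D.cartanRels_U.q_mul_lift_b]
  unfold wt
  simp only [LinearMap.neg_apply, mul_neg]

theorem minus_mul_qpow (h : Module.Dual ℤ P) (x : D.FmodR) :
    D.minus x * D.qpow h = D.qpow h * D.minus (D.scalV (D.wt h) x) := by
  rw [qpow_mul_minus, scalV_wt_neg]

theorem a_mul_minus (g : D.Iinf) (y : D.FmodR) :
    D.a g * D.minus y = D.minus (D.scalV (D.sig g) y) * D.a g + D.K g * D.minus (D.contrV g y) -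
      D.minus (D.scalV (D.sig g) (D.contrRV g y)) * D.Kinv g := by
  obtain ⟨y, rfl⟩ := D.cls_surjective y
  simp only [scalV_cls, contrV_cls, contrRV_cls, minus_cls, D.cartanRels_U.a_mul_lift_b]
  rfl

theorem plus_mul_b (g : D.Iinf) (x : D.FmodR) :
    D.plus x * D.b g = D.b g * D.plus (D.scalV (D.sig g) x) + D.plus (D.contrRV g x) * D.K g -
      D.Kinv g * D.plus (D.scalV (D.sig g) (D.contrV g x)) := by
  obtain ⟨x, rfl⟩ := D.cls_surjective x
  simp only [scalV_cls, contrV_cls, contrRV_cls, plus_cls, D.cartanRels_U.lift_a_mul_b]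
  rfl

theorem scalV_sig_sig (g : D.Iinf) (x : D.FmodR) :
    D.scalV (D.sig g) (D.scalV (D.sig g) x) = x := by
  rw [scalV_scalV]; simp only [sig_mul_self, scalV_one]

/-- The commutation of `b_g` with the positive part, solved for `b_g x⁺`. -/
theorem b_mul_plus (g : D.Iinf) (x : D.FmodR) : ∃ x₁ x₂ x₃ : D.FmodR,
    D.b g * D.plus x = D.plus x₁ * D.b g - D.plus x₂ * D.K g + D.plus x₃ * D.Kinv g := by
  have e := D.plus_mul_b g (D.scalV (D.sig g) x)
  rw [scalV_sig_sig] at e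
  rw [Kinv, qpow_mul_plus] at e
  refine ⟨D.scalV (D.sig g) x, D.contrRV g (D.scalV (D.sig g) x),
    D.scalV (D.wt (-D.cow g)) (D.scalV (D.sig g) (D.contrV g (D.scalV (D.sig g) x))), ?_⟩
  rw [e, Kinv]
  abel

theorem scalV_mem (χ : D.Iinf → QField) {ν : D.Deg} {x : D.FmodR} (hx : x ∈ D.FmodRdeg ν) :
    D.scalV χ x ∈ D.FmodRdeg ν := by
  rw [D.scalV_of_mem χ hx]; exact Submodule.smul_mem _ _ hx

theorem lmV_mem (g : D.Iinf) {ν : D.Deg} {x : D.FmodR} (hx : x ∈ D.FmodRdeg ν) :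
    D.lmV g x ∈ D.FmodRdeg (ν + Finsupp.single g 1) := by
  rw [← D.projV_self hx, ← projV_lmV]; exact D.projV_mem _ _

theorem rmV_mem (g : D.Iinf) {ν : D.Deg} {x : D.FmodR} (hx : x ∈ D.FmodRdeg ν) :
    D.rmV g x ∈ D.FmodRdeg (ν + Finsupp.single g 1) := by
  rw [← D.projV_self hx, ← projV_rmV]; exact D.projV_mem _ _

theorem contrV_mem (g : D.Iinf) {ν : D.Deg} {x : D.FmodR}
    (hx : x ∈ D.FmodRdeg (ν + Finsupp.single g 1)) : D.contrV g x ∈ D.FmodRdeg ν := by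
  rw [← D.projV_self hx, contrV_projV]; exact D.projV_mem _ _

theorem contrRV_mem (g : D.Iinf) {ν : D.Deg} {x : D.FmodR}
    (hx : x ∈ D.FmodRdeg (ν + Finsupp.single g 1)) : D.contrRV g x ∈ D.FmodRdeg ν := by
  rw [← D.projV_self hx, contrRV_projV]; exact D.projV_mem _ _

theorem contrV_eq_zero {g : D.Iinf} {ν : D.Deg} (hν : ν g = 0) {x : D.FmodR}
    (hx : x ∈ D.FmodRdeg ν) : D.contrV g x = 0 := by
  rw [← D.projV_self hx, contrV_projV_eq_zero D hν]

theorem contrRV_eq_zero {g : D.Iinf} {ν : D.Deg} (hν : ν g = 0) {x : D.FmodR}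
    (hx : x ∈ D.FmodRdeg ν) : D.contrRV g x = 0 := by
  rw [← D.projV_self hx, contrRV_projV_eq_zero D hν]

/-- A degree containing `g` is of the form `κ + g`. -/
theorem exists_eq_add_single {ν : D.Deg} {g : D.Iinf} (h : ν g ≠ 0) :
    ∃ κ : D.Deg, ν = κ + Finsupp.single g 1 :=
  ⟨ν - Finsupp.single g 1, (tsub_add_cancel_of_le (by
    rw [Finsupp.single_le_iff]; exact Nat.one_le_iff_ne_zero.mpr h)).symm⟩

theorem U_induction {C : D.U → Prop} (one : C 1) (add : ∀ x y, C x → C y → C (x + y))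
    (smul : ∀ (r : QField) x, C x → C (r • x)) (mul : ∀ x y, C x → C y → C (x * y))
    (a : ∀ g, C (D.a g)) (b : ∀ g, C (D.b g)) (q : ∀ h, C (D.qpow h)) (u : D.U) : C u := by
  obtain ⟨u, rfl⟩ := RingQuot.mkAlgHom_surjective QField D.Rel u
  induction u using FreeAlgebra.induction with
  | grade0 r => rw [AlgHom.commutes, Algebra.algebraMap_eq_smul_one]; exact smul r 1 one
  | grade1 g =>
    cases g with
    | a g => exact a g
    | b g => exact b g
    | q h => exact q h
  | mul x y hx hy => rw [map_mul]; exact mul _ _ hx hy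
  | add x y hx hy => rw [map_add]; exact add _ _ hx hy

/-! ### Continuity of the multiplication of `U ⊗ U` -/

/-- The subspace `U⁺ U⁰ ∑_{ν ∉ S} U⁻_ν` of `U`. -/
noncomputable def negTail (S : Finset D.Deg) : Submodule QField D.U :=
  LinearMap.range D.plus * D.Uzero * ⨆ ν ∉ S, D.Uneg ν

/-- The subspace `U⁻ U⁰ ∑_{ν ∉ S} U⁺_ν` of `U`. -/
noncomputable def posTail (S : Finset D.Deg) : Submodule QField D.U :=
  LinearMap.range D.minus * D.Uzero * ⨆ ν ∉ S, D.Upos ν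

theorem H_eq (S : Finset D.Deg) : D.H S = D.tens (D.negTail S) ⊤ ⊔ D.tens ⊤ (D.posTail S) := rfl

theorem negTail_anti {S T : Finset D.Deg} (h : S ⊆ T) : D.negTail T ≤ D.negTail S :=
  mul_le_mul' le_rfl (iSup₂_mono' fun ν hν => ⟨ν, fun hS => hν (h hS), le_rfl⟩)

theorem mem_negTail {S : Finset D.Deg} {ν : D.Deg} (hν : ν ∉ S) (x : D.FmodR)
    (h : Module.Dual ℤ P) {y : D.FmodR} (hy : y ∈ D.FmodRdeg ν) :
    D.plus x * D.qpow h * D.minus y ∈ D.negTail S :=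
  Submodule.mul_mem_mul (Submodule.mul_mem_mul ⟨x, rfl⟩ (Submodule.subset_span ⟨h, rfl⟩))
    (Submodule.mem_iSup_of_mem ν (Submodule.mem_iSup_of_mem hν ⟨y, hy, rfl⟩))

theorem negTail_le {S : Finset D.Deg} {N : Submodule QField D.U}
    (H : ∀ ν ∉ S, ∀ x h, ∀ y ∈ D.FmodRdeg ν, D.plus x * D.qpow h * D.minus y ∈ N) :
    D.negTail S ≤ N := by
  refine Submodule.mul_le.mpr fun m hm n hn => ?_
  have h1 : (⨆ ν ∉ S, D.Uneg ν) ≤ N.comap (LinearMap.mulLeft QField m) := by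
    refine iSup₂_le fun ν hν => ?_
    rintro _ ⟨y, hy, rfl⟩
    have h2 : LinearMap.range D.plus * D.Uzero ≤
        N.comap (LinearMap.mulRight QField (D.minus y)) := by
      refine Submodule.mul_le.mpr ?_
      rintro _ ⟨x, rfl⟩ z hz
      have h3 : D.Uzero ≤ N.comap (LinearMap.mulRight QField (D.minus y) ∘ₗ
          LinearMap.mulLeft QField (D.plus x)) := by
        refine Submodule.span_le.mpr ?_
        rintro _ ⟨h, rfl⟩
        exact H ν hν x h y hy
      exact h3 hz
    exact h2 hm
  exact h1 hn

/-- It suffices to treat generators. `a_g` and `q^h` are absorbed by `U⁺ U⁰`. Moving `b_g` through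
`x⁺` leaves terms with `K_g^{±1}` and one in which `b_g` joins `y⁻`, raising its degree by `g`. -/
theorem negTail_mul_left (u : D.U) (S : Finset D.Deg) :
    ∃ T, D.negTail T ≤ (D.negTail S).comap (LinearMap.mulLeft QField u) := by
  classical
  induction u using D.U_induction generalizing S with
  | one => exact ⟨S, fun x hx => by simpa using hx⟩
  | add u v hu hv =>
    obtain ⟨T, hT⟩ := hu S
    obtain ⟨T', hT'⟩ := hv S
    refine ⟨T ∪ T', fun x hx => ?_⟩
    have h1 := hT (D.negTail_anti Finset.subset_union_left hx)
    have h2 := hT' (D.negTail_anti Finset.subset_union_right hx)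
    simp only [Submodule.mem_comap, LinearMap.mulLeft_apply] at *
    rw [add_mul]; exact add_mem h1 h2
  | smul r u hu =>
    obtain ⟨T, hT⟩ := hu S
    refine ⟨T, fun x hx => ?_⟩
    have h1 := hT hx
    simp only [Submodule.mem_comap, LinearMap.mulLeft_apply] at *
    rw [smul_mul_assoc]; exact Submodule.smul_mem _ _ h1
  | mul u v hu hv =>
    obtain ⟨T, hT⟩ := hu S
    obtain ⟨T', hT'⟩ := hv T
    refine ⟨T', fun x hx => ?_⟩
    have h1 := hT (hT' hx)
    simp only [Submodule.mem_comap, LinearMap.mulLeft_apply] at *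
    rwa [mul_assoc]
  | a g =>
    refine ⟨S, D.negTail_le fun ν hν x h y hy => ?_⟩
    simp only [Submodule.mem_comap, LinearMap.mulLeft_apply]
    rw [← mul_assoc, ← mul_assoc, a_mul_plus]
    exact D.mem_negTail hν _ _ hy
  | q k =>
    refine ⟨S, D.negTail_le fun ν hν x h y hy => ?_⟩
    simp only [Submodule.mem_comap, LinearMap.mulLeft_apply]
    rw [← mul_assoc, ← mul_assoc, qpow_mul_plus, mul_assoc (D.plus _), ← D.cartanRels_U.q_add]
    exact D.mem_negTail hν _ _ hy
  | b g =>
    -- If `ν + g ∈ S` then `ν` is the image of `ν + g`. Truncated subtraction may add further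
    -- degrees to the set, which only shrinks the tail.
    refine ⟨S ∪ S.image fun μ => μ - Finsupp.single g 1, D.negTail_le fun ν hν x h y hy => ?_⟩
    rw [Finset.mem_union, not_or] at hν
    obtain ⟨x₁, x₂, x₃, e⟩ := D.b_mul_plus g x
    simp only [Submodule.mem_comap, LinearMap.mulLeft_apply]
    rw [← mul_assoc, ← mul_assoc, e, add_mul, add_mul, sub_mul, sub_mul]
    refine add_mem (sub_mem ?_ ?_) ?_
    · have e2 : D.b g * D.qpow h = (D.wt h g) • (D.qpow h * D.b g) := by
        rw [D.cartanRels_U.q_b, smul_smul, wt, ← zpow_add₀ qVar_ne_zero, add_neg_cancel, zpow_zero,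
          one_smul]
      rw [mul_assoc (D.plus _), e2, mul_smul_comm, smul_mul_assoc, ← mul_assoc, mul_assoc _ (D.b g),
        b_mul_minus]
      refine Submodule.smul_mem _ _ (D.mem_negTail (fun hS => hν.2 ?_) _ _ (D.lmV_mem g hy))
      exact Finset.mem_image.mpr ⟨_, hS, add_tsub_cancel_right _ _⟩
    · rw [mul_assoc (D.plus _), K, ← D.cartanRels_U.q_add]
      exact D.mem_negTail hν.1 _ _ hy
    · rw [mul_assoc (D.plus _), Kinv, ← D.cartanRels_U.q_add]
      exact D.mem_negTail hν.1 _ _ hy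

theorem negTail_mul_right (u : D.U) (S : Finset D.Deg) :
    ∃ T, D.negTail T ≤ (D.negTail S).comap (LinearMap.mulRight QField u) := by
  classical
  induction u using D.U_induction generalizing S with
  | one => exact ⟨S, fun x hx => by simpa using hx⟩
  | add u v hu hv =>
    obtain ⟨T, hT⟩ := hu S
    obtain ⟨T', hT'⟩ := hv S
    refine ⟨T ∪ T', fun x hx => ?_⟩
    have h1 := hT (D.negTail_anti Finset.subset_union_left hx)
    have h2 := hT' (D.negTail_anti Finset.subset_union_right hx)
    simp only [Submodule.mem_comap, LinearMap.mulRight_apply] at *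
    rw [mul_add]; exact add_mem h1 h2
  | smul r u hu =>
    obtain ⟨T, hT⟩ := hu S
    refine ⟨T, fun x hx => ?_⟩
    have h1 := hT hx
    simp only [Submodule.mem_comap, LinearMap.mulRight_apply] at *
    rw [mul_smul_comm]; exact Submodule.smul_mem _ _ h1
  | mul u v hu hv =>
    obtain ⟨T, hT⟩ := hv S
    obtain ⟨T', hT'⟩ := hu T
    refine ⟨T', fun x hx => ?_⟩
    have h1 := hT (hT' hx)
    simp only [Submodule.mem_comap, LinearMap.mulRight_apply] at *
    rwa [← mul_assoc]
  | b g =>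
    refine ⟨S.image fun μ => μ - Finsupp.single g 1, D.negTail_le fun ν hν x h y hy => ?_⟩
    simp only [Submodule.mem_comap, LinearMap.mulRight_apply]
    rw [mul_assoc, minus_mul_b]
    refine D.mem_negTail (fun hS => hν ?_) _ _ (D.rmV_mem g hy)
    exact Finset.mem_image.mpr ⟨_, hS, add_tsub_cancel_right _ _⟩
  | q k =>
    refine ⟨S, D.negTail_le fun ν hν x h y hy => ?_⟩
    simp only [Submodule.mem_comap, LinearMap.mulRight_apply]
    rw [mul_assoc, minus_mul_qpow, ← mul_assoc, mul_assoc (D.plus _), ← D.cartanRels_U.q_add]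
    exact D.mem_negTail hν _ _ (D.scalV_mem _ hy)
  | a g =>
    -- Moving `a_g` to the left across `y⁻` contracts `y`, lowering its degree by `g`; so `S + g`
    -- has to be excluded as well.
    refine ⟨S ∪ S.image fun μ => μ + Finsupp.single g 1, D.negTail_le fun ν hν x h y hy => ?_⟩
    rw [Finset.mem_union, not_or] at hν
    simp only [Submodule.mem_comap, LinearMap.mulRight_apply]
    have e := D.a_mul_minus g (D.scalV (D.sig g) y)
    rw [scalV_sig_sig, Kinv, minus_mul_qpow, eq_sub_iff_add_eq, ← sub_eq_iff_eq_add] at e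
    have hy' := D.scalV_mem (D.sig g) hy
    have e2 : D.qpow h * D.a g = (D.wt h g) • (D.a g * D.qpow h) := D.cartanRels_U.q_a h g
    rw [mul_assoc, ← e, mul_sub, mul_add]
    refine sub_mem (add_mem ?_ ?_) ?_
    · rw [← mul_assoc, mul_assoc (D.plus _), e2, mul_smul_comm, smul_mul_assoc, ← mul_assoc,
        plus_mul_a]
      exact Submodule.smul_mem _ _ (D.mem_negTail hν.1 _ _ hy')
    · by_cases hg : ν g = 0
      · rw [contrRV_eq_zero D hg hy']
        simp
      · obtain ⟨κ, rfl⟩ := D.exists_eq_add_single hg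
        rw [← mul_assoc, mul_assoc (D.plus _), ← D.cartanRels_U.q_add]
        refine D.mem_negTail (fun hS => hν.2 (Finset.mem_image_of_mem _ hS)) _ _ ?_
        exact D.scalV_mem _ (D.scalV_mem _ (D.contrRV_mem g hy'))
    · by_cases hg : ν g = 0
      · rw [contrV_eq_zero D hg hy']
        simp
      · obtain ⟨κ, rfl⟩ := D.exists_eq_add_single hg
        rw [K, ← mul_assoc, mul_assoc (D.plus _), ← D.cartanRels_U.q_add]
        exact D.mem_negTail (fun hS => hν.2 (Finset.mem_image_of_mem _ hS)) _ _
          (D.contrV_mem g hy')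

/-- As `omega` is a surjective homomorphism, this carries the stability of the negative tails under
multiplication over to the positive ones. -/
theorem map_omega_negTail (S : Finset D.Deg) :
    (D.negTail S).map D.omega.toLinearMap = D.posTail S := by
  rw [negTail, posTail, Submodule.map_mul, Submodule.map_mul, Submodule.map_iSup]
  congr 1
  · congr 1
    · rw [← LinearMap.range_comp]
      refine le_antisymm ?_ ?_
      · rintro _ ⟨x, rfl⟩
        exact ⟨D.signV x, (D.omega_plus x).symm⟩
      · rintro _ ⟨x, rfl⟩
        exact ⟨D.signV x, (D.omega_plus _).trans (by rw [signV_signV])⟩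
    · rw [Uzero, Submodule.map_span, ← Set.range_comp]
      congr 1
      refine subset_antisymm ?_ ?_
      · rintro _ ⟨h, rfl⟩
        exact ⟨-h, (D.omega_qpow h).symm⟩
      · rintro _ ⟨h, rfl⟩
        exact ⟨-h, (D.omega_qpow (-h)).trans (by rw [neg_neg])⟩
  · refine iSup_congr fun ν => ?_
    rw [Submodule.map_iSup]
    refine iSup_congr fun _ => ?_
    rw [Uneg, Upos, ← Submodule.map_comp]
    congr 1
    exact LinearMap.ext fun x => D.omega_minus x

theorem posTail_mul_left (u : D.U) (S : Finset D.Deg) :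
    ∃ T, D.posTail T ≤ (D.posTail S).comap (LinearMap.mulLeft QField u) := by
  obtain ⟨u, rfl⟩ := D.omega_surjective u
  obtain ⟨T, hT⟩ := D.negTail_mul_left u S
  refine ⟨T, ?_⟩
  rw [← map_omega_negTail, ← map_omega_negTail]
  rintro _ ⟨x, hx, rfl⟩
  exact ⟨u * x, hT hx, map_mul D.omega _ _⟩

theorem posTail_mul_right (u : D.U) (S : Finset D.Deg) :
    ∃ T, D.posTail T ≤ (D.posTail S).comap (LinearMap.mulRight QField u) := by
  obtain ⟨u, rfl⟩ := D.omega_surjective u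
  obtain ⟨T, hT⟩ := D.negTail_mul_right u S
  refine ⟨T, ?_⟩
  rw [← map_omega_negTail, ← map_omega_negTail]
  rintro _ ⟨x, hx, rfl⟩
  exact ⟨x * u, hT hx, map_mul D.omega _ _⟩

theorem signU_negTail {S : Finset D.Deg} {x : D.U} (hx : x ∈ D.negTail S) :
    D.signU x ∈ D.negTail S := by
  have : D.negTail S ≤ (D.negTail S).comap D.signU.toLinearMap := by
    refine D.negTail_le fun ν hν x h y hy => ?_
    rw [Submodule.mem_comap, AlgHom.toLinearMap_apply, map_mul, map_mul, signU_plus, signU_qpow,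
      signU_minus]
    exact D.mem_negTail hν _ _ (D.scalV_mem _ hy)
  exact this hx

theorem signU_posTail {S : Finset D.Deg} {x : D.U} (hx : x ∈ D.posTail S) :
    D.signU x ∈ D.posTail S := by
  rw [← map_omega_negTail] at hx ⊢
  obtain ⟨x, hx, rfl⟩ := hx
  refine ⟨D.signU x, D.signU_negTail hx, ?_⟩
  change D.omega (D.signU x) = D.signU (D.omega x)
  rw [← omega_omega, ← omega_omega]

/-- The power `x ↦ (-1)^{i p(x)} x` of the sign automorphism. -/
noncomputable def signPow (i : ZMod 2) (x : D.U) : D.U := if i = 0 then x else D.signU x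

theorem signPow_of_mem {i j : ZMod 2} {x : D.U} (hx : x ∈ D.parity j) :
    D.signPow i x = sgn (i * j) • x := by
  have h01 : ∀ k : ZMod 2, k = 0 ∨ k = 1 := by decide
  rcases h01 i with rfl | rfl
  · rw [signPow, if_pos rfl, zero_mul, sgn_zero, one_smul]
  · rw [signPow, if_neg one_ne_zero, one_mul, ← mem_parity]; exact hx

theorem signPow_add (i : ZMod 2) (x y : D.U) :
    D.signPow i (x + y) = D.signPow i x + D.signPow i y := by
  unfold signPow; split_ifs <;> simp

/-- Only one of the inner factors is assumed homogeneous: the super sign becomes a power of the sign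
automorphism on the other. Since the tails are stable under that automorphism, their elements need
not be split by parity. -/
theorem pt_mul_signPow {j : ZMod 2} {y : D.U} (hy : y ∈ D.parity j) (x x' y' : D.U) :
    D.pureTensor x y * D.pureTensor x' y' = D.pureTensor (x * D.signPow j x') (y * y') := by
  obtain ⟨x₀, h₀, x₁, h₁, rfl⟩ := D.U_eq_add x'
  rw [pt_add_left, mul_add, D.pt_mul x y _ y' hy h₀, D.pt_mul x y _ y' hy h₁, signPow_add, mul_add,
    pt_add_left, D.signPow_of_mem h₀, D.signPow_of_mem h₁]
  simp only [mul_smul_comm, pt_smul_left]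

theorem pt_mul_signPow' {i : ZMod 2} {x' : D.U} (hx' : x' ∈ D.parity i) (x y y' : D.U) :
    D.pureTensor x y * D.pureTensor x' y' = D.pureTensor (x * x') (D.signPow i y * y') := by
  obtain ⟨y₀, h₀, y₁, h₁, rfl⟩ := D.U_eq_add y
  rw [pt_add_right, add_mul, D.pt_mul x _ x' y' h₀ hx', D.pt_mul x _ x' y' h₁ hx', signPow_add,
    add_mul, pt_add_right, D.signPow_of_mem h₀, D.signPow_of_mem h₁]
  simp only [smul_mul_assoc, pt_smul_right, mul_comm i]

theorem UU_induction {C : D.UU → Prop} (zero : C 0) (add : ∀ x y, C x → C y → C (x + y))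
    (pt : ∀ i j, ∀ x ∈ D.parity i, ∀ y ∈ D.parity j, C (D.pureTensor x y)) (z : D.UU) : C z := by
  obtain ⟨z, rfl⟩ := (GradedTensorProduct.of QField D.parity D.parity).surjective z
  induction z using TensorProduct.induction_on with
  | zero => rw [map_zero]; exact zero
  | add x y hx hy => rw [map_add]; exact add _ _ hx hy
  | tmul x y =>
    change C (D.pureTensor x y)
    obtain ⟨x₀, h₀, x₁, h₁, rfl⟩ := D.U_eq_add x
    obtain ⟨y₀, k₀, y₁, k₁, rfl⟩ := D.U_eq_add y
    rw [pt_add_left, pt_add_right, pt_add_right]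
    exact add _ _ (add _ _ (pt _ _ _ h₀ _ k₀) (pt _ _ _ h₀ _ k₁))
      (add _ _ (pt _ _ _ h₁ _ k₀) (pt _ _ _ h₁ _ k₁))

theorem pt_mem_tens {V W : Submodule QField D.U} {x y : D.U} (hx : x ∈ V) (hy : y ∈ W) :
    D.pureTensor x y ∈ D.tens V W := Submodule.subset_span ⟨x, hx, y, hy, rfl⟩

theorem signPow_negTail (i : ZMod 2) {S : Finset D.Deg} {x : D.U} (hx : x ∈ D.negTail S) :
    D.signPow i x ∈ D.negTail S := by
  unfold signPow; split_ifs
  exacts [hx, D.signU_negTail hx]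

theorem signPow_posTail (i : ZMod 2) {S : Finset D.Deg} {x : D.U} (hx : x ∈ D.posTail S) :
    D.signPow i x ∈ D.posTail S := by
  unfold signPow; split_ifs
  exacts [hx, D.signU_posTail hx]

theorem posTail_anti {S T : Finset D.Deg} (h : S ⊆ T) : D.posTail T ≤ D.posTail S :=
  mul_le_mul' le_rfl (iSup₂_mono' fun ν hν => ⟨ν, fun hS => hν (h hS), le_rfl⟩)

theorem H_le {S : Finset D.Deg} {N : Submodule QField D.UU}
    (h₁ : ∀ x ∈ D.negTail S, ∀ y, D.pureTensor x y ∈ N)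
    (h₂ : ∀ x, ∀ y ∈ D.posTail S, D.pureTensor x y ∈ N) : D.H S ≤ N := by
  rw [H_eq]
  refine sup_le (Submodule.span_le.mpr ?_) (Submodule.span_le.mpr ?_)
  · rintro _ ⟨x, hx, y, -, rfl⟩; exact h₁ x hx y
  · rintro _ ⟨x, -, y, hy, rfl⟩; exact h₂ x y hy

theorem pt_mem_H_left {S : Finset D.Deg} {x : D.U} (hx : x ∈ D.negTail S) (y : D.U) :
    D.pureTensor x y ∈ D.H S :=
  (le_sup_left : _ ≤ D.H S) (D.pt_mem_tens hx (Submodule.mem_top (x := y)))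

theorem pt_mem_H_right {S : Finset D.Deg} (x : D.U) {y : D.U} (hy : y ∈ D.posTail S) :
    D.pureTensor x y ∈ D.H S :=
  (le_sup_right : _ ≤ D.H S) (D.pt_mem_tens (Submodule.mem_top (x := x)) hy)

theorem H_mul_left (z : D.UU) (S : Finset D.Deg) :
    ∃ T, D.H T ≤ (D.H S).comap (LinearMap.mulLeft QField z) := by
  classical
  induction z using D.UU_induction with
  | zero => exact ⟨∅, fun x _ => by simp⟩
  | add u v hu hv =>
    obtain ⟨T, hT⟩ := hu
    obtain ⟨T', hT'⟩ := hv
    refine ⟨T ∪ T', fun x hx => ?_⟩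
    have h1 := hT (D.H_anti Finset.subset_union_left hx)
    have h2 := hT' (D.H_anti Finset.subset_union_right hx)
    simp only [Submodule.mem_comap, LinearMap.mulLeft_apply] at *
    rw [add_mul]; exact add_mem h1 h2
  | pt i j x hx y hy =>
    obtain ⟨T, hT⟩ := D.negTail_mul_left x S
    obtain ⟨T', hT'⟩ := D.posTail_mul_left y S
    refine ⟨T ∪ T', D.H_le (fun v hv w => ?_) fun v w hw => ?_⟩ <;>
      rw [Submodule.mem_comap, LinearMap.mulLeft_apply, D.pt_mul_signPow hy]
    · exact D.pt_mem_H_left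
        (hT (D.signPow_negTail j (D.negTail_anti Finset.subset_union_left hv))) _
    · exact D.pt_mem_H_right _ (hT' (D.posTail_anti Finset.subset_union_right hw))

theorem H_mul_right (z : D.UU) (S : Finset D.Deg) :
    ∃ T, D.H T ≤ (D.H S).comap (LinearMap.mulRight QField z) := by
  classical
  induction z using D.UU_induction with
  | zero => exact ⟨∅, fun x _ => by simp⟩
  | add u v hu hv =>
    obtain ⟨T, hT⟩ := hu
    obtain ⟨T', hT'⟩ := hv
    refine ⟨T ∪ T', fun x hx => ?_⟩
    have h1 := hT (D.H_anti Finset.subset_union_left hx)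
    have h2 := hT' (D.H_anti Finset.subset_union_right hx)
    simp only [Submodule.mem_comap, LinearMap.mulRight_apply] at *
    rw [mul_add]; exact add_mem h1 h2
  | pt i j x hx y hy =>
    obtain ⟨T, hT⟩ := D.negTail_mul_right x S
    obtain ⟨T', hT'⟩ := D.posTail_mul_right y S
    refine ⟨T ∪ T', D.H_le (fun v hv w => ?_) fun v w hw => ?_⟩ <;>
      rw [Submodule.mem_comap, LinearMap.mulRight_apply, D.pt_mul_signPow' hx]
    · exact D.pt_mem_H_left (hT (D.negTail_anti Finset.subset_union_left hv)) _
    · exact D.pt_mem_H_right _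
        (hT' (D.signPow_posTail i (D.posTail_anti Finset.subset_union_right hw)))

theorem nhds_zero_hasBasis :
    (nhds (0 : D.UU)).HasBasis (fun _ : Finset D.Deg => True) fun S => (D.H S : Set D.UU) := by
  refine ((AddGroupFilterBasis.nhds_zero_hasBasis
    (inferInstance : AddGroupFilterBasis D.UU)).to_hasBasis ?_ ?_)
  · rintro _ ⟨S, rfl⟩; exact ⟨S, trivial, subset_rfl⟩
  · intro S _; exact ⟨_, ⟨S, rfl⟩, subset_rfl⟩

/-- This is what gives `leftMul` its meaning: `Completion.map` extends a map only if it is uniformly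
continuous. -/
theorem uniformContinuous_mul_left (z : D.UU) : UniformContinuous fun w : D.UU => z * w := by
  refine uniformContinuous_of_continuousAt_zero (AddMonoidHom.mulLeft z) ?_
  rw [ContinuousAt, map_zero, D.nhds_zero_hasBasis.tendsto_iff D.nhds_zero_hasBasis]
  intro S _
  obtain ⟨T, hT⟩ := D.H_mul_left z S
  exact ⟨T, trivial, fun x hx => hT hx⟩

theorem uniformContinuous_mul_right (z : D.UU) : UniformContinuous fun w : D.UU => w * z := by
  refine uniformContinuous_of_continuousAt_zero (AddMonoidHom.mulRight z) ?_
  rw [ContinuousAt, map_zero, D.nhds_zero_hasBasis.tendsto_iff D.nhds_zero_hasBasis]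
  intro S _
  obtain ⟨T, hT⟩ := D.H_mul_right z S
  exact ⟨T, trivial, fun x hx => hT hx⟩

/-! ### The Casimir elements of the form -/

theorem finite_words (ν : D.Deg) : {w : List D.Iinf | ∀ g, w.count g = ν g}.Finite := by
  by_cases h : ∃ w₀ : List D.Iinf, ∀ g, w₀.count g = ν g
  · obtain ⟨w₀, h₀⟩ := h
    refine (List.finite_toSet w₀.permutations).subset fun w hw => ?_
    exact List.mem_permutations.mpr (List.perm_iff_count.mpr fun g => (hw g).trans (h₀ g).symm)
  · exact Set.Finite.subset Set.finite_empty fun w hw => h ⟨w, hw⟩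

instance finite_FmodRdeg (ν : D.Deg) : Module.Finite QField (D.FmodRdeg ν) := by
  have h : Module.Finite QField (D.Fdeg ν) := by
    refine Module.Finite.iff_fg.mpr (Submodule.fg_span ?_)
    refine ((D.finite_words ν).image fun w => (w.map D.gen).prod).subset ?_
    rintro _ ⟨w, hw, rfl⟩
    exact ⟨w, hw, rfl⟩
  exact Module.Finite.map _ _

/-- The restriction of the form to the part of degree `ν`. -/
noncomputable def formDeg (ν : D.Deg) : LinearMap.BilinForm QField (D.FmodRdeg ν) :=
  D.formR.domRestrict₁₂ _ _

theorem formDeg_apply {ν : D.Deg} (x y : D.FmodRdeg ν) : D.formDeg ν x y = D.formR x y := rfl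

theorem formDeg_isSymm (ν : D.Deg) : (D.formDeg ν).IsSymm :=
  ⟨fun x y => D.formR_symm x y⟩

/-- The degree projection is self-adjoint, so an element of degree `ν` orthogonal to its own degree
is orthogonal to all of `F / ℛ`. -/
theorem formDeg_nondegenerate (ν : D.Deg) : (D.formDeg ν).Nondegenerate := by
  have key : ∀ x : D.FmodRdeg ν, (∀ y, D.formDeg ν x y = 0) → x = 0 := fun x hx =>
    Subtype.ext (D.eq_zero_of_formR fun y => by
      rw [← D.projV_self x.2, formR_projV]
      exact hx ⟨_, D.projV_mem ν y⟩)
  exact ⟨key, fun y hy => key y fun x => (D.formR_symm y x).trans (hy x)⟩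

/-- The families `B` and `B'` are dual with respect to the form. -/
def IsDual {ν : D.Deg} {ι : Type*} (B B' : Module.Basis ι QField (D.FmodRdeg ν)) : Prop :=
  ∀ j k, (j = k → D.formR (B j) (B' k) = 1) ∧ (j ≠ k → D.formR (B j) (B' k) = 0)

theorem exists_isDual {ν : D.Deg} {ι : Type*} [Finite ι]
    (B : Module.Basis ι QField (D.FmodRdeg ν)) : ∃ B', D.IsDual B B' := by
  classical
  refine ⟨(D.formDeg ν).dualBasis (D.formDeg_nondegenerate ν) B, fun j k => ?_⟩
  rw [← formDeg_apply, LinearMap.BilinForm.apply_dualBasis_right _ (D.formDeg_isSymm ν)]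
  exact ⟨fun h => if_pos h, fun h => if_neg h⟩

/-- The element `∑ b ⊗ b*` of `F / ℛ ⊗ F / ℛ`, where `b` runs over a basis of the part of degree
`ν` and `b*` over the dual basis. -/
noncomputable def casimir (ν : D.Deg) : D.FmodR ⊗[QField] D.FmodR :=
  ∑ k, (Module.finBasis QField (D.FmodRdeg ν) k : D.FmodR) ⊗ₜ
    ((D.exists_isDual (Module.finBasis QField (D.FmodRdeg ν))).choose k : D.FmodR)

/-- The pairings with the dual basis are the coordinates of the degree `ν` part of `y`. By
nondegeneracy this property determines the tensor, whence independence of the basis and all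
identities for `casimir` below. -/
theorem ctr_sum_of_isDual {ν : D.Deg} {ι : Type*} [Fintype ι]
    {B B' : Module.Basis ι QField (D.FmodRdeg ν)} (h : D.IsDual B B') (y : D.FmodR) :
    D.ctr y (∑ k, (B k : D.FmodR) ⊗ₜ (B' k : D.FmodR)) = D.projV ν y := by
  obtain ⟨x, hx⟩ : ∃ x : D.FmodRdeg ν, (x : D.FmodR) = D.projV ν y := ⟨⟨_, D.projV_mem ν y⟩, rfl⟩
  have hk : ∀ k, D.formR (B' k) y = B.repr x k := by
    intro k
    rw [← D.projV_self (B' k).2, formR_projV, ← hx]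
    conv_lhs => rw [← B.sum_repr x]
    rw [Submodule.coe_sum, map_sum, Finset.sum_eq_single k]
    · rw [Submodule.coe_smul, map_smul, formR_symm, (h k k).1 rfl, smul_eq_mul, mul_one]
    · intro j _ hj
      rw [Submodule.coe_smul, map_smul, formR_symm, (h j k).2 hj, smul_zero]
    · simp
  rw [map_sum, ← hx]
  conv_rhs => rw [← B.sum_repr x, Submodule.coe_sum]
  refine Finset.sum_congr rfl fun k _ => ?_
  rw [ctr_tmul, hk]
  rfl

theorem ctr_casimir (ν : D.Deg) (y : D.FmodR) : D.ctr y (D.casimir ν) = D.projV ν y :=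
  D.ctr_sum_of_isDual (D.exists_isDual (Module.finBasis QField (D.FmodRdeg ν))).choose_spec y

theorem casimir_eq {ν : D.Deg} {ι : Type*} [Fintype ι]
    {B B' : Module.Basis ι QField (D.FmodRdeg ν)} (h : D.IsDual B B') :
    D.casimir ν = ∑ k, (B k : D.FmodR) ⊗ₜ (B' k : D.FmodR) :=
  D.tensor_ext fun y => by rw [ctr_casimir, D.ctr_sum_of_isDual h]

theorem ctr_map (f : D.FmodR →ₗ[QField] D.FmodR) {g : D.FmodR →ₗ[QField] D.FmodR} {y y' : D.FmodR}
    (h : ∀ z, D.formR (g z) y = D.formR z y') (z : D.FmodR ⊗[QField] D.FmodR) :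
    D.ctr y (TensorProduct.map f g z) = f (D.ctr y' z) := by
  induction z using TensorProduct.induction_on with
  | zero => simp only [map_zero]
  | add z z' hz hz' => simp only [map_add, hz, hz']
  | tmul x z => rw [TensorProduct.map_tmul, ctr_tmul, ctr_tmul, h, map_smul]

theorem ctr_map_left (f : D.FmodR →ₗ[QField] D.FmodR) (y : D.FmodR)
    (z : D.FmodR ⊗[QField] D.FmodR) :
    D.ctr y (TensorProduct.map f LinearMap.id z) = f (D.ctr y z) := D.ctr_map f (fun _ => rfl) z

theorem formR_contrV (g : D.Iinf) (x y : D.FmodR) :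
    D.formR (D.contrV g x) y = D.formR x (D.lmV g y) := by
  rw [formR_symm, ← formR_lmV, formR_symm]

theorem formR_contrRV (g : D.Iinf) (x y : D.FmodR) :
    D.formR (D.contrRV g x) y = D.formR x (D.rmV g y) := by
  rw [formR_symm, ← formR_rmV, formR_symm]

/-- Contracting the second leg with `y` turns the left side into `contr_g` of the degree `κ+g` part
of `y`, and the right side, by adjointness, into the degree `κ` part of `contr_g y`. -/
theorem map_contrV_casimir (κ : D.Deg) (g : D.Iinf) :
    TensorProduct.map (D.contrV g) LinearMap.id (D.casimir (κ + Finsupp.single g 1)) =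
      TensorProduct.map LinearMap.id (D.lmV g) (D.casimir κ) :=
  D.tensor_ext fun y => by
    rw [ctr_map_left, D.ctr_map _ fun z => D.formR_lmV g z y, ctr_casimir, ctr_casimir,
      contrV_projV, LinearMap.id_apply]

theorem map_contrRV_casimir (κ : D.Deg) (g : D.Iinf) :
    TensorProduct.map (D.contrRV g) LinearMap.id (D.casimir (κ + Finsupp.single g 1)) =
      TensorProduct.map LinearMap.id (D.rmV g) (D.casimir κ) :=
  D.tensor_ext fun y => by
    rw [ctr_map_left, D.ctr_map _ fun z => D.formR_rmV g z y, ctr_casimir, ctr_casimir,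
      contrRV_projV, LinearMap.id_apply]

theorem map_id_contrV_casimir (κ : D.Deg) (g : D.Iinf) :
    TensorProduct.map LinearMap.id (D.contrV g) (D.casimir (κ + Finsupp.single g 1)) =
      TensorProduct.map (D.lmV g) LinearMap.id (D.casimir κ) :=
  D.tensor_ext fun y => by
    rw [ctr_map_left, D.ctr_map _ fun z => D.formR_contrV g z y, ctr_casimir, ctr_casimir,
      projV_lmV, LinearMap.id_apply]

theorem map_id_contrRV_casimir (κ : D.Deg) (g : D.Iinf) :
    TensorProduct.map LinearMap.id (D.contrRV g) (D.casimir (κ + Finsupp.single g 1)) =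
      TensorProduct.map (D.rmV g) LinearMap.id (D.casimir κ) :=
  D.tensor_ext fun y => by
    rw [ctr_map_left, D.ctr_map _ fun z => D.formR_contrRV g z y, ctr_casimir, ctr_casimir,
      projV_rmV, LinearMap.id_apply]

theorem map_contrV_casimir_eq_zero {g : D.Iinf} {ν : D.Deg} (hν : ν g = 0) :
    TensorProduct.map (D.contrV g) LinearMap.id (D.casimir ν) = 0 :=
  D.tensor_eq_zero fun y => by rw [ctr_map_left, ctr_casimir, contrV_projV_eq_zero D hν]

theorem map_contrRV_casimir_eq_zero {g : D.Iinf} {ν : D.Deg} (hν : ν g = 0) :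
    TensorProduct.map (D.contrRV g) LinearMap.id (D.casimir ν) = 0 :=
  D.tensor_eq_zero fun y => by rw [ctr_map_left, ctr_casimir, contrRV_projV_eq_zero D hν]

theorem map_id_contrV_casimir_eq_zero {g : D.Iinf} {ν : D.Deg} (hν : ν g = 0) :
    TensorProduct.map LinearMap.id (D.contrV g) (D.casimir ν) = 0 :=
  D.tensor_eq_zero fun y => by
    rw [D.ctr_map _ fun z => D.formR_contrV g z y, ctr_casimir, projV_lmV_eq_zero D hν, map_zero]

theorem map_id_contrRV_casimir_eq_zero {g : D.Iinf} {ν : D.Deg} (hν : ν g = 0) :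
    TensorProduct.map LinearMap.id (D.contrRV g) (D.casimir ν) = 0 :=
  D.tensor_eq_zero fun y => by
    rw [D.ctr_map _ fun z => D.formR_contrRV g z y, ctr_casimir, projV_rmV_eq_zero D hν, map_zero]

theorem projV_scalV (χ : D.Iinf → QField) (ν : D.Deg) (y : D.FmodR) :
    D.projV ν (D.scalV χ y) = D.charDeg χ ν • D.projV ν y :=
  D.eq_of_formR fun w => by
    rw [formR_projV, formR_scalV, D.scalV_of_mem χ (D.projV_mem ν w), map_smul, map_smul,
      LinearMap.smul_apply, formR_projV]

/-- Both legs of `Γ_ν` have degree `ν`, so a rescaling acts by the same scalar on either leg and can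
be moved from one to the other. -/
theorem map_scalV_casimir (χ : D.Iinf → QField) (ν : D.Deg) :
    TensorProduct.map (D.scalV χ) LinearMap.id (D.casimir ν) = D.charDeg χ ν • D.casimir ν :=
  D.tensor_ext fun y => by
    rw [ctr_map_left, map_smul, ctr_casimir, D.scalV_of_mem χ (D.projV_mem ν y)]

theorem map_id_scalV_casimir (χ : D.Iinf → QField) (ν : D.Deg) :
    TensorProduct.map LinearMap.id (D.scalV χ) (D.casimir ν) = D.charDeg χ ν • D.casimir ν :=
  D.tensor_ext fun y => by
    rw [D.ctr_map _ fun z => D.formR_scalV χ z y, map_smul, ctr_casimir, ctr_casimir, projV_scalV,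
      LinearMap.id_apply]

/-! ### The components of the quasi-`R`-matrix -/

/-- The sign `(-1)^{ht(ν) + e(ν)}`. -/
noncomputable def thetaSign (ν : D.Deg) : QField := (-1) ^ (D.ht ν + D.e ν)

theorem charDeg_sig (g : D.Iinf) (κ : D.Deg) : D.charDeg (D.sig g) κ =
    (-1) ^ ((D.par g).val * κ.sum fun h n => (D.par h).val * n) := by
  have hs : ∀ h, D.sig g h = (-1) ^ ((D.par g).val * (D.par h).val) := fun h => by
    have : ∀ x y : ZMod 2, (x * y).val = x.val * y.val := by decide
    rw [sig, sgn, this]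
  simp only [charDeg, Finsupp.prod, Finsupp.sum, hs, ← pow_mul, Finset.prod_pow_eq_pow_sum,
    Finset.mul_sum, mul_assoc]

/-- The height grows by one. If `g` is odd, `binom(n, 2)` grows by the number `n` of odd terms of
`κ`, and `(-1)^n` is the sign for moving `a_g` past degree `κ`. -/
theorem thetaSign_add_single (κ : D.Deg) (g : D.Iinf) :
    D.thetaSign (κ + Finsupp.single g 1) = -(D.charDeg (D.sig g) κ * D.thetaSign κ) := by
  have h1 : D.ht (κ + Finsupp.single g 1) = D.ht κ + 1 := by
    rw [ht, Finsupp.sum_add_index' (by simp) (by intros; rfl)]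
    simp [ht]
  have h2 : (κ + Finsupp.single g 1).sum (fun h n => (D.par h).val * n) =
      κ.sum (fun h n => (D.par h).val * n) + (D.par g).val := by
    rw [Finsupp.sum_add_index' (by simp) (by intros; ring)]
    simp
  have h01 : ∀ x : ZMod 2, x.val = 0 ∨ x.val = 1 := by decide
  rw [thetaSign, thetaSign, charDeg_sig, e, e, h1, h2]
  rcases h01 (D.par g) with h | h
  · rw [h, zero_mul, pow_zero, add_zero]; ring
  · have h3 : ∀ n : ℕ, (n + 1).choose 2 = n + n.choose 2 := fun n => by
      rw [Nat.choose_succ_succ' n 1, Nat.choose_one_right]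
    rw [h, h3, one_mul, ← pow_add]; ring

/-- The map `x ⊗ y ↦ f(x) ⊗ h(y)` from `F / ℛ ⊗ F / ℛ` to `U ⊗ U`. -/
noncomputable def tmap (f h : D.FmodR →ₗ[QField] D.U) : D.FmodR ⊗[QField] D.FmodR →ₗ[QField] D.UU :=
  (GradedTensorProduct.of QField D.parity D.parity).toLinearMap ∘ₗ TensorProduct.map f h

theorem tmap_tmul (f h : D.FmodR →ₗ[QField] D.U) (x y : D.FmodR) :
    D.tmap f h (x ⊗ₜ y) = D.pureTensor (f x) (h y) := rfl

theorem signPow_plus (g : D.Iinf) (x : D.FmodR) :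
    D.signPow (D.par g) (D.plus x) = D.plus (D.scalV (D.sig g) x) := by
  have h01 : ∀ k : ZMod 2, k = 0 ∨ k = 1 := by decide
  unfold signPow
  rcases h01 (D.par g) with h | h
  · have : D.sig g = fun _ => 1 := funext fun k => by rw [sig, h, zero_mul, sgn_zero]
    rw [if_pos h, this, scalV_one]
  · have : D.sig g = fun k => D.sig k k := funext fun k => by rw [sig, h, one_mul, sig_self]
    rw [if_neg (by rw [h]; exact one_ne_zero), this, signU_plus, signV]

theorem signPow_minus (g : D.Iinf) (x : D.FmodR) :
    D.signPow (D.par g) (D.minus x) = D.minus (D.scalV (D.sig g) x) := by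
  have h01 : ∀ k : ZMod 2, k = 0 ∨ k = 1 := by decide
  unfold signPow
  rcases h01 (D.par g) with h | h
  · have : D.sig g = fun _ => 1 := funext fun k => by rw [sig, h, zero_mul, sgn_zero]
    rw [if_pos h, this, scalV_one]
  · have : D.sig g = fun k => D.sig k k := funext fun k => by rw [sig, h, one_mul, sig_self]
    rw [if_neg (by rw [h]; exact one_ne_zero), this, signU_minus, signV]

/-- The image of the Casimir element in `U⁻ ⊗ U⁺`. -/
noncomputable def gammaU (ν : D.Deg) : D.UU := D.tmap D.minus D.plus (D.casimir ν)

section commutator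
variable (z : D.FmodR ⊗[QField] D.FmodR) (g : D.Iinf)

theorem a_one_mul_tmap : D.pureTensor (D.a g) 1 * D.tmap D.minus D.plus z =
    D.tmap (LinearMap.mulRight QField (D.a g) ∘ₗ D.minus) D.plus
      (TensorProduct.map (D.scalV (D.sig g)) LinearMap.id z) +
    D.tmap (LinearMap.mulLeft QField (D.K g) ∘ₗ D.minus) D.plus
      (TensorProduct.map (D.contrV g) LinearMap.id z) -
    D.tmap (LinearMap.mulRight QField (D.Kinv g) ∘ₗ D.minus) D.plus
      (TensorProduct.map (D.scalV (D.sig g)) LinearMap.id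
        (TensorProduct.map (D.contrRV g) LinearMap.id z)) := by
  induction z using TensorProduct.induction_on with
  | zero => simp only [map_zero, mul_zero, add_zero, sub_zero]
  | add z z' hz hz' => simp only [map_add, mul_add, hz, hz']; abel
  | tmul x y =>
    simp only [TensorProduct.map_tmul, tmap_tmul, D.pt_mul_of_even_left D.one_mem_parity,
      a_mul_minus, one_mul, pt_add_left, pt_sub_left]
    rfl

theorem tmap_mul_a_one : D.tmap D.minus D.plus z * D.pureTensor (D.a g) 1 =
    D.tmap (LinearMap.mulRight QField (D.a g) ∘ₗ D.minus) D.plus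
      (TensorProduct.map LinearMap.id (D.scalV (D.sig g)) z) := by
  induction z using TensorProduct.induction_on with
  | zero => simp only [map_zero, zero_mul]
  | add z z' hz hz' => simp only [map_add, add_mul, hz, hz']
  | tmul x y =>
    simp only [TensorProduct.map_tmul, tmap_tmul, D.pt_mul_signPow' (D.a_mem g), signPow_plus,
      mul_one]
    rfl

theorem K_a_mul_tmap : D.pureTensor (D.K g) (D.a g) * D.tmap D.minus D.plus z =
    D.tmap (LinearMap.mulLeft QField (D.K g) ∘ₗ D.minus) (LinearMap.mulLeft QField (D.a g) ∘ₗ D.plus)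
      (TensorProduct.map (D.scalV (D.sig g)) LinearMap.id z) := by
  induction z using TensorProduct.induction_on with
  | zero => simp only [map_zero, mul_zero]
  | add z z' hz hz' => simp only [map_add, mul_add, hz, hz']
  | tmul x y =>
    simp only [TensorProduct.map_tmul, tmap_tmul, D.pt_mul_signPow (D.a_mem g), signPow_minus]
    rfl

theorem tmap_mul_Kinv_a : D.tmap D.minus D.plus z * D.pureTensor (D.Kinv g) (D.a g) =
    D.tmap (LinearMap.mulRight QField (D.Kinv g) ∘ₗ D.minus)
      (LinearMap.mulRight QField (D.a g) ∘ₗ D.plus) z := by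
  induction z using TensorProduct.induction_on with
  | zero => simp only [map_zero, zero_mul]
  | add z z' hz hz' => simp only [map_add, add_mul, hz, hz']
  | tmul x y => rw [tmap_tmul, D.pt_mul_of_even_right (x' := D.Kinv g) (D.qpow_mem _)]; rfl

theorem one_b_mul_tmap : D.pureTensor 1 (D.b g) * D.tmap D.minus D.plus z =
    D.tmap D.minus (LinearMap.mulLeft QField (D.b g) ∘ₗ D.plus)
      (TensorProduct.map (D.scalV (D.sig g)) LinearMap.id z) := by
  induction z using TensorProduct.induction_on with
  | zero => simp only [map_zero, mul_zero]
  | add z z' hz hz' => simp only [map_add, mul_add, hz, hz']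
  | tmul x y =>
    simp only [TensorProduct.map_tmul, tmap_tmul, D.pt_mul_signPow (D.b_mem g), signPow_minus,
      one_mul]
    rfl

theorem tmap_mul_one_b : D.tmap D.minus D.plus z * D.pureTensor 1 (D.b g) =
    D.tmap D.minus (LinearMap.mulLeft QField (D.b g) ∘ₗ D.plus)
      (TensorProduct.map LinearMap.id (D.scalV (D.sig g)) z) +
    D.tmap D.minus (LinearMap.mulRight QField (D.K g) ∘ₗ D.plus)
      (TensorProduct.map LinearMap.id (D.contrRV g) z) -
    D.tmap D.minus (LinearMap.mulLeft QField (D.Kinv g) ∘ₗ D.plus)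
      (TensorProduct.map LinearMap.id (D.scalV (D.sig g))
        (TensorProduct.map LinearMap.id (D.contrV g) z)) := by
  induction z using TensorProduct.induction_on with
  | zero => simp only [map_zero, zero_mul, add_zero, sub_zero]
  | add z z' hz hz' => simp only [map_add, add_mul, hz, hz']; abel
  | tmul x y =>
    simp only [TensorProduct.map_tmul, tmap_tmul, D.pt_mul_of_even_right D.one_mem_parity,
      plus_mul_b, mul_one, pt_add_right, pt_sub_right]
    rfl

theorem b_Kinv_mul_tmap : D.pureTensor (D.b g) (D.Kinv g) * D.tmap D.minus D.plus z =
    D.tmap (LinearMap.mulLeft QField (D.b g) ∘ₗ D.minus)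
      (LinearMap.mulLeft QField (D.Kinv g) ∘ₗ D.plus) z := by
  induction z using TensorProduct.induction_on with
  | zero => simp only [map_zero, mul_zero]
  | add z z' hz hz' => simp only [map_add, mul_add, hz, hz']
  | tmul x y => rw [tmap_tmul, D.pt_mul_of_even_left (y := D.Kinv g) (D.qpow_mem _)]; rfl

theorem tmap_mul_b_K : D.tmap D.minus D.plus z * D.pureTensor (D.b g) (D.K g) =
    D.tmap (LinearMap.mulRight QField (D.b g) ∘ₗ D.minus) (LinearMap.mulRight QField (D.K g) ∘ₗ D.plus)
      (TensorProduct.map LinearMap.id (D.scalV (D.sig g)) z) := by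
  induction z using TensorProduct.induction_on with
  | zero => simp only [map_zero, zero_mul]
  | add z z' hz hz' => simp only [map_add, add_mul, hz, hz']
  | tmul x y =>
    simp only [TensorProduct.map_tmul, tmap_tmul, D.pt_mul_signPow' (D.b_mem g), signPow_plus]
    rfl

theorem tmap_map_left (f h : D.FmodR →ₗ[QField] D.U) (p : D.FmodR →ₗ[QField] D.FmodR) :
    D.tmap f h (TensorProduct.map p LinearMap.id z) = D.tmap (f ∘ₗ p) h z := by
  rw [tmap, tmap, ← LinearMap.comp_id h, TensorProduct.map_comp]; rfl

theorem tmap_map_right (f h : D.FmodR →ₗ[QField] D.U) (r : D.FmodR →ₗ[QField] D.FmodR) :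
    D.tmap f h (TensorProduct.map LinearMap.id r z) = D.tmap f (h ∘ₗ r) z := by
  rw [tmap, tmap, ← LinearMap.comp_id f, TensorProduct.map_comp]; rfl

theorem map_map_swap (p r : D.FmodR →ₗ[QField] D.FmodR) :
    TensorProduct.map p LinearMap.id (TensorProduct.map LinearMap.id r z) =
      TensorProduct.map LinearMap.id r (TensorProduct.map p LinearMap.id z) := by
  rw [← LinearMap.comp_apply, ← LinearMap.comp_apply, ← TensorProduct.map_comp,
    ← TensorProduct.map_comp]
  rfl

end commutator

/-- The terms with `a_g` on the first leg cancel, because the sign twist can be put on either leg of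
`Γ`. The two contraction terms become left and right multiplication by `a_g` on the second leg of
`Γ_κ`. -/
theorem commutator_a_one (κ : D.Deg) (g : D.Iinf) :
    D.pureTensor (D.a g) 1 * D.gammaU (κ + Finsupp.single g 1) -
        D.gammaU (κ + Finsupp.single g 1) * D.pureTensor (D.a g) 1 =
      D.tmap (LinearMap.mulLeft QField (D.K g) ∘ₗ D.minus)
        (LinearMap.mulLeft QField (D.a g) ∘ₗ D.plus) (D.casimir κ) -
      D.charDeg (D.sig g) κ • D.tmap (LinearMap.mulRight QField (D.Kinv g) ∘ₗ D.minus)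
        (LinearMap.mulRight QField (D.a g) ∘ₗ D.plus) (D.casimir κ) := by
  have hl : D.plus ∘ₗ D.lmV g = LinearMap.mulLeft QField (D.a g) ∘ₗ D.plus :=
    LinearMap.ext fun x => (D.a_mul_plus g x).symm
  have hr : D.plus ∘ₗ D.rmV g = LinearMap.mulRight QField (D.a g) ∘ₗ D.plus :=
    LinearMap.ext fun x => (D.plus_mul_a g x).symm
  rw [gammaU, a_one_mul_tmap, tmap_mul_a_one, map_scalV_casimir, map_id_scalV_casimir,
    map_contrV_casimir, map_contrRV_casimir, map_map_swap, map_scalV_casimir, map_smul, map_smul,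
    map_smul,     tmap_map_right, tmap_map_right, hl, hr]
  abel

theorem commutator_a_one_eq_zero {ν : D.Deg} {g : D.Iinf} (hν : ν g = 0) :
    D.pureTensor (D.a g) 1 * D.gammaU ν - D.gammaU ν * D.pureTensor (D.a g) 1 = 0 := by
  rw [gammaU, a_one_mul_tmap, tmap_mul_a_one, map_scalV_casimir, map_id_scalV_casimir,
    D.map_contrV_casimir_eq_zero hν, D.map_contrRV_casimir_eq_zero hν, map_zero, map_zero, map_zero,
    add_zero, sub_zero, sub_self]

theorem commutator_one_b (κ : D.Deg) (g : D.Iinf) :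
    D.pureTensor 1 (D.b g) * D.gammaU (κ + Finsupp.single g 1) -
        D.gammaU (κ + Finsupp.single g 1) * D.pureTensor 1 (D.b g) =
      D.charDeg (D.sig g) κ • D.tmap (LinearMap.mulLeft QField (D.b g) ∘ₗ D.minus)
        (LinearMap.mulLeft QField (D.Kinv g) ∘ₗ D.plus) (D.casimir κ) -
      D.tmap (LinearMap.mulRight QField (D.b g) ∘ₗ D.minus)
        (LinearMap.mulRight QField (D.K g) ∘ₗ D.plus) (D.casimir κ) := by
  have hl : D.minus ∘ₗ D.lmV g = LinearMap.mulLeft QField (D.b g) ∘ₗ D.minus :=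
    LinearMap.ext fun x => (D.b_mul_minus g x).symm
  have hr : D.minus ∘ₗ D.rmV g = LinearMap.mulRight QField (D.b g) ∘ₗ D.minus :=
    LinearMap.ext fun x => (D.minus_mul_b g x).symm
  rw [gammaU, one_b_mul_tmap, tmap_mul_one_b, map_scalV_casimir, map_id_scalV_casimir,
    map_id_contrV_casimir, map_id_contrRV_casimir, ← map_map_swap, map_id_scalV_casimir, map_smul,
    map_smul, map_smul, tmap_map_left, tmap_map_left, hl, hr]
  abel

theorem commutator_one_b_eq_zero {ν : D.Deg} {g : D.Iinf} (hν : ν g = 0) :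
    D.pureTensor 1 (D.b g) * D.gammaU ν - D.gammaU ν * D.pureTensor 1 (D.b g) = 0 := by
  rw [gammaU, one_b_mul_tmap, tmap_mul_one_b, map_scalV_casimir, map_id_scalV_casimir,
    D.map_id_contrV_casimir_eq_zero hν, D.map_id_contrRV_casimir_eq_zero hν, map_zero, map_zero,
    map_zero, add_zero, sub_zero, sub_self]

/-- The component `(-1)^{ht(ν) + e(ν)} ∑ b⁻ ⊗ (b*)⁺` of the quasi-`R`-matrix. -/
noncomputable def theta (ν : D.Deg) : D.UU := D.thetaSign ν • D.gammaU ν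

theorem charDeg_sig_mul_self (g : D.Iinf) (κ : D.Deg) :
    D.charDeg (D.sig g) κ * D.charDeg (D.sig g) κ = 1 := by
  rw [charDeg_sig, ← mul_pow, neg_one_mul, neg_neg, one_pow]

/-- The sign `charDeg (sig g) κ` arises on the `K_g⁻¹` term of the commutator, but on the `K_g` term
of the product with `Θ_κ`. The recursion for `thetaSign` reconciles the two and supplies the overall
minus. -/
theorem theta_a (κ : D.Deg) (g : D.Iinf) :
    D.pureTensor (D.a g) 1 * D.theta (κ + Finsupp.single g 1) -
        D.theta (κ + Finsupp.single g 1) * D.pureTensor (D.a g) 1 =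
      -(D.pureTensor (D.K g) (D.a g) * D.theta κ - D.theta κ * D.pureTensor (D.Kinv g) (D.a g)) := by
  rw [theta, theta, mul_smul_comm, smul_mul_assoc, ← smul_sub, commutator_a_one,
    mul_smul_comm, smul_mul_assoc, ← smul_sub, ← smul_neg, gammaU, K_a_mul_tmap, tmap_mul_Kinv_a,
    map_scalV_casimir, map_smul, thetaSign_add_single, neg_smul, mul_comm (D.charDeg _ _), mul_smul,
    smul_sub (D.charDeg _ _), smul_smul (D.charDeg _ _), charDeg_sig_mul_self, one_smul, smul_neg]

theorem theta_b (κ : D.Deg) (g : D.Iinf) :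
    D.pureTensor 1 (D.b g) * D.theta (κ + Finsupp.single g 1) -
        D.theta (κ + Finsupp.single g 1) * D.pureTensor 1 (D.b g) =
      -(D.pureTensor (D.b g) (D.Kinv g) * D.theta κ - D.theta κ * D.pureTensor (D.b g) (D.K g)) := by
  rw [theta, theta, mul_smul_comm, smul_mul_assoc, ← smul_sub, commutator_one_b,
    mul_smul_comm, smul_mul_assoc, ← smul_sub, ← smul_neg, gammaU, b_Kinv_mul_tmap, tmap_mul_b_K,
    map_id_scalV_casimir, map_smul, thetaSign_add_single, neg_smul, mul_comm (D.charDeg _ _),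
    mul_smul, smul_sub (D.charDeg _ _), smul_smul (D.charDeg _ _), charDeg_sig_mul_self, one_smul,
    smul_neg]

theorem theta_a_eq_zero {ν : D.Deg} {g : D.Iinf} (hν : ν g = 0) :
    D.pureTensor (D.a g) 1 * D.theta ν - D.theta ν * D.pureTensor (D.a g) 1 = 0 := by
  rw [theta, mul_smul_comm, smul_mul_assoc, ← smul_sub, D.commutator_a_one_eq_zero hν, smul_zero]

theorem theta_b_eq_zero {ν : D.Deg} {g : D.Iinf} (hν : ν g = 0) :
    D.pureTensor 1 (D.b g) * D.theta ν - D.theta ν * D.pureTensor 1 (D.b g) = 0 := by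
  rw [theta, mul_smul_comm, smul_mul_assoc, ← smul_sub, D.commutator_one_b_eq_zero hν, smul_zero]

/-- The legs have opposite weights `-ν` and `ν`. -/
theorem theta_q (h : Module.Dual ℤ P) (ν : D.Deg) :
    D.pureTensor (D.qpow h) (D.qpow h) * D.theta ν =
      D.theta ν * D.pureTensor (D.qpow h) (D.qpow h) := by
  have hz : ∀ z, D.pureTensor (D.qpow h) (D.qpow h) * D.tmap D.minus D.plus z =
      D.tmap D.minus D.plus (TensorProduct.map (D.scalV (D.wt (-h))) LinearMap.id
        (TensorProduct.map LinearMap.id (D.scalV (D.wt h)) z)) *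
        D.pureTensor (D.qpow h) (D.qpow h) := fun z => by
    induction z using TensorProduct.induction_on with
    | zero => simp only [map_zero, mul_zero, zero_mul]
    | add z z' hz hz' => simp only [map_add, mul_add, add_mul, hz, hz']
    | tmul x y =>
      simp only [TensorProduct.map_tmul, tmap_tmul, D.pt_mul_of_even_right (D.qpow_mem h),
        D.pt_mul_of_even_left (D.qpow_mem h), qpow_mul_plus, qpow_mul_minus]
      rfl
  have hs : ∀ z : D.FmodR ⊗[QField] D.FmodR, TensorProduct.map (D.scalV (D.wt (-h))) LinearMap.id
      (TensorProduct.map (D.scalV (D.wt h)) LinearMap.id z) = z := fun z => by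
    rw [← LinearMap.comp_apply, ← TensorProduct.map_comp, LinearMap.comp_id,
      show D.scalV (D.wt (-h)) ∘ₗ D.scalV (D.wt h) = LinearMap.id from
        LinearMap.ext fun x => D.scalV_wt_neg h x, TensorProduct.map_id, LinearMap.id_apply]
  rw [theta, mul_smul_comm, smul_mul_assoc, gammaU, hz, map_id_scalV_casimir,
    ← map_scalV_casimir, hs]

theorem theta_mem (ν : D.Deg) : D.theta ν ∈ D.tens (D.Uneg ν) (D.Upos ν) := by
  refine Submodule.smul_mem _ _ ?_
  rw [gammaU, casimir, map_sum]
  exact Submodule.sum_mem _ fun k _ =>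
    D.pt_mem_tens ⟨_, Subtype.mem _, rfl⟩ ⟨_, Subtype.mem _, rfl⟩

theorem theta_eq {ν : D.Deg} {ι : Type*} [Fintype ι]
    {B B' : Module.Basis ι QField (D.FmodRdeg ν)} (h : D.IsDual B B') :
    D.theta ν = ((-1) ^ (D.ht ν + D.e ν) : QField) •
      ∑ k, D.pureTensor (D.minus (B k)) (D.plus (B' k)) := by
  rw [theta, gammaU, D.casimir_eq h, map_sum]
  rfl

theorem projV_zero_eq (y : D.FmodR) : D.projV 0 y = D.formR (D.cls 1) y • D.cls 1 := by
  induction y using D.V_induction with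
  | one =>
    have h1 : D.cls 1 ∈ D.FmodRdeg 0 := ⟨1, Submodule.subset_span ⟨[], by simp, by simp⟩, rfl⟩
    rw [D.projV_self h1, formR_cls, form_one, map_one FreeAlgebra.algebraMapInv, one_smul]
  | add x y hx hy => rw [map_add, hx, hy, map_add, add_smul]
  | smul r x hx => rw [map_smul, hx, map_smul, smul_assoc]
  | mul g x hx =>
    rw [projV_lmV_eq_zero D rfl, ← formR_contrV, contrV_cls, contr_one, map_zero, map_zero,
      LinearMap.zero_apply, zero_smul]

theorem theta_zero : D.theta 0 = D.pureTensor 1 1 := by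
  have h1 : D.casimir 0 = D.cls 1 ⊗ₜ D.cls 1 :=
    D.tensor_ext fun y => by rw [ctr_casimir, ctr_tmul, projV_zero_eq]
  rw [theta, gammaU, h1, tmap_tmul, minus_cls, plus_cls, map_one, map_one]
  simp [thetaSign, ht, e]

/-! ### The action of `U ⊗ U` on its completion -/

theorem continuous_leftMul (z : D.UU) : Continuous (D.leftMul z) :=
  UniformSpace.Completion.continuous_map

theorem continuous_rightMul (z : D.UU) : Continuous (D.rightMul z) :=
  UniformSpace.Completion.continuous_map

theorem leftMul_coe (z w : D.UU) : D.leftMul z (w : D.UUhat) = ((z * w : D.UU) : D.UUhat) :=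
  UniformSpace.Completion.map_coe (D.uniformContinuous_mul_left z) w

theorem rightMul_coe (z w : D.UU) : D.rightMul z (w : D.UUhat) = ((w * z : D.UU) : D.UUhat) :=
  UniformSpace.Completion.map_coe (D.uniformContinuous_mul_right z) w

theorem leftMul_add (z w : D.UU) (x : D.UUhat) :
    D.leftMul (z + w) x = D.leftMul z x + D.leftMul w x := by
  induction x using UniformSpace.Completion.induction_on with
  | hp =>
    exact isClosed_eq (D.continuous_leftMul _)
      ((D.continuous_leftMul _).add (D.continuous_leftMul _))
  | ih x => rw [leftMul_coe, leftMul_coe, leftMul_coe, add_mul, UniformSpace.Completion.coe_add]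

theorem rightMul_add (z w : D.UU) (x : D.UUhat) :
    D.rightMul (z + w) x = D.rightMul z x + D.rightMul w x := by
  induction x using UniformSpace.Completion.induction_on with
  | hp =>
    exact isClosed_eq (D.continuous_rightMul _)
      ((D.continuous_rightMul _).add (D.continuous_rightMul _))
  | ih x => rw [rightMul_coe, rightMul_coe, rightMul_coe, mul_add, UniformSpace.Completion.coe_add]

theorem leftMul_mul (z w : D.UU) (x : D.UUhat) :
    D.leftMul (z * w) x = D.leftMul z (D.leftMul w x) := by
  induction x using UniformSpace.Completion.induction_on with
  | hp =>
    exact isClosed_eq (D.continuous_leftMul _)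
      ((D.continuous_leftMul _).comp (D.continuous_leftMul _))
  | ih x => rw [leftMul_coe, leftMul_coe, leftMul_coe, mul_assoc]

theorem rightMul_mul (z w : D.UU) (x : D.UUhat) :
    D.rightMul (z * w) x = D.rightMul w (D.rightMul z x) := by
  induction x using UniformSpace.Completion.induction_on with
  | hp =>
    exact isClosed_eq (D.continuous_rightMul _)
      ((D.continuous_rightMul _).comp (D.continuous_rightMul _))
  | ih x => rw [rightMul_coe, rightMul_coe, rightMul_coe, mul_assoc]

theorem leftMul_rightMul (z w : D.UU) (x : D.UUhat) :
    D.leftMul z (D.rightMul w x) = D.rightMul w (D.leftMul z x) := by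
  induction x using UniformSpace.Completion.induction_on with
  | hp =>
    exact isClosed_eq ((D.continuous_leftMul _).comp (D.continuous_rightMul _))
      ((D.continuous_rightMul _).comp (D.continuous_leftMul _))
  | ih x => rw [leftMul_coe, rightMul_coe, leftMul_coe, rightMul_coe, mul_assoc]

theorem leftMul_smul_one (r : QField) (x : D.UUhat) :
    D.leftMul (r • 1) x = D.rightMul (r • 1) x := by
  induction x using UniformSpace.Completion.induction_on with
  | hp =>
    exact isClosed_eq (D.continuous_leftMul _) (D.continuous_rightMul _)
  | ih x => rw [leftMul_coe, rightMul_coe, smul_mul_assoc, mul_smul_comm, one_mul, mul_one]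

/-- The intertwining property holds as soon as it holds for the generators. -/
theorem intertwines_of_gen {Δ Δ' : D.U →ₐ[QField] D.UU} {x : D.UUhat}
    (ha : ∀ g, D.leftMul (Δ (D.a g)) x = D.rightMul (Δ' (D.a g)) x)
    (hb : ∀ g, D.leftMul (Δ (D.b g)) x = D.rightMul (Δ' (D.b g)) x)
    (hq : ∀ h, D.leftMul (Δ (D.qpow h)) x = D.rightMul (Δ' (D.qpow h)) x) (u : D.U) :
    D.leftMul (Δ u) x = D.rightMul (Δ' u) x := by
  induction u using D.U_induction with
  | one =>
    rw [map_one, map_one]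
    simpa only [one_smul] using D.leftMul_smul_one 1 x
  | add u v hu hv => rw [map_add, map_add, leftMul_add, rightMul_add, hu, hv]
  | smul r u hu =>
    -- A scalar is treated as multiplication by the central element `r • 1`, so no module structure
    -- on the completion is needed.
    have e1 : Δ (r • u) = (r • 1) * Δ u := by rw [map_smul, smul_mul_assoc, one_mul]
    have e2 : Δ' (r • u) = Δ' u * (r • 1) := by rw [map_smul, mul_smul_comm, mul_one]
    rw [e1, e2, leftMul_mul, rightMul_mul, hu, leftMul_smul_one]
  | mul u v hu hv =>
    rw [map_mul, map_mul, leftMul_mul, rightMul_mul, hv, leftMul_rightMul, hu]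
  | a g => exact ha g
  | b g => exact hb g
  | q h => exact hq h

theorem hasSum_commutator {Θ : D.Deg → D.UU} {x : D.UUhat}
    (h : HasSum (fun ν => (Θ ν : D.UUhat)) x) (A B : D.UU) :
    HasSum (fun ν => ((A * Θ ν - Θ ν * B : D.UU) : D.UUhat)) (D.leftMul A x - D.rightMul B x) := by
  have hl := h.map ((AddMonoidHom.mulLeft A).completion (D.uniformContinuous_mul_left A).continuous)
    (AddMonoidHom.continuous_completion _ _)
  have hr := h.map
    ((AddMonoidHom.mulRight B).completion (D.uniformContinuous_mul_right B).continuous)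
    (AddMonoidHom.continuous_completion _ _)
  have e : (fun ν => ((A * Θ ν - Θ ν * B : D.UU) : D.UUhat)) =
      fun ν => D.leftMul A (Θ ν) - D.rightMul B (Θ ν) :=
    funext fun ν => by rw [leftMul_coe, rightMul_coe, UniformSpace.Completion.coe_sub]
  rw [e]
  exact hl.sub hr

theorem tens_le_H {S : Finset D.Deg} {ν : D.Deg} (hν : ν ∉ S) :
    D.tens (D.Uneg ν) (D.Upos ν) ≤ D.H S := by
  refine Submodule.span_le.mpr ?_
  rintro _ ⟨_, ⟨y, hy, rfl⟩, v, -, rfl⟩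
  refine D.pt_mem_H_left ?_ v
  have h := D.mem_negTail hν (D.cls 1) 0 hy
  rwa [plus_cls, map_one, D.cartanRels_U.q_zero, one_mul, one_mul] at h

/-- The components of a family `Θ_ν ∈ U⁻_ν ⊗ U⁺_ν` can be summed in the completion. -/
theorem summable_of_mem {Θ : D.Deg → D.UU} (h : ∀ ν, Θ ν ∈ D.tens (D.Uneg ν) (D.Upos ν)) :
    ∃ x : D.UUhat, HasSum (fun ν => (Θ ν : D.UUhat)) x := by
  have hc : CauchySeq fun s : Finset D.Deg => ∑ ν ∈ s, Θ ν := by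
    refine cauchySeq_finset_iff_sum_vanishing.mpr fun e he => ?_
    obtain ⟨S, -, hS⟩ := D.nhds_zero_hasBasis.mem_iff.mp he
    exact ⟨S, fun t ht => hS (Submodule.sum_mem _ fun ν hν =>
      D.tens_le_H (Finset.disjoint_left.mp ht hν) (h ν))⟩
  have hc' := (UniformSpace.Completion.uniformContinuous_coe D.UU).comp_cauchySeq hc
  obtain ⟨x, hx⟩ := cauchySeq_tendsto_of_complete hc'
  refine ⟨x, ?_⟩
  have e : ∀ s : Finset D.Deg, ((∑ ν ∈ s, Θ ν : D.UU) : D.UUhat) = ∑ ν ∈ s, (Θ ν : D.UUhat) :=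
    fun s => map_sum UniformSpace.Completion.toCompl Θ s
  simpa only [Function.comp_def, HasSum, SummationFilter.unconditional_filter, e] using hx

/-- The `A`, `B` terms in degree `κ+g` cancel the `A'`, `B'` terms in degree `κ`. Reindexing along
the injection `κ ↦ κ + g` loses nothing, since degrees that do not contain `g` contribute zero. -/
theorem intertwines_gen {Θ : D.Deg → D.UU} {x : D.UUhat} (h : HasSum (fun ν => (Θ ν : D.UUhat)) x)
    {A A' B B' : D.UU} (g : D.Iinf)
    (h₁ : ∀ κ, A * Θ (κ + Finsupp.single g 1) - Θ (κ + Finsupp.single g 1) * B =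
      -(A' * Θ κ - Θ κ * B'))
    (h₀ : ∀ ν : D.Deg, ν g = 0 → A * Θ ν - Θ ν * B = 0) :
    D.leftMul (A + A') x = D.rightMul (B + B') x := by
  have hP := D.hasSum_commutator h A B
  have hN := (D.hasSum_commutator h A' B').neg
  have hinj : Function.Injective fun κ : D.Deg => κ + Finsupp.single g 1 := fun _ _ e =>
    add_right_cancel e
  rw [← hinj.hasSum_iff] at hP
  · have e : D.leftMul A x - D.rightMul B x = -(D.leftMul A' x - D.rightMul B' x) := by
      refine hP.unique ?_
      convert hN using 2 with κ
      rw [Function.comp_apply, h₁, UniformSpace.Completion.coe_neg]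
    rw [leftMul_add, rightMul_add, ← sub_eq_zero, add_sub_add_comm, e, neg_add_cancel]
  · intro ν hν
    rw [h₀ ν, UniformSpace.Completion.coe_zero]
    by_contra hg
    obtain ⟨κ, rfl⟩ := D.exists_eq_add_single hg
    exact hν ⟨κ, rfl⟩

theorem isQuasiR_theta {Δ Δ' : D.U →ₐ[QField] D.UU} (hΔ : D.IsComul Δ) (hΔ' : D.IsBarComul Δ') :
    D.IsQuasiR Δ Δ' D.theta where
  mem := D.theta_mem
  zero := D.theta_zero
  intertwines := by
    obtain ⟨x, hx⟩ := D.summable_of_mem D.theta_mem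
    refine ⟨x, hx, D.intertwines_of_gen (fun g => ?_) (fun g => ?_) fun h => ?_⟩
    · rw [hΔ.a, hΔ'.a]
      exact D.intertwines_gen hx g (fun κ => D.theta_a κ g) fun ν hν => D.theta_a_eq_zero hν
    · rw [hΔ.b, hΔ'.b, add_comm, add_comm (D.pureTensor (D.b g) _)]
      exact D.intertwines_gen hx g (fun κ => D.theta_b κ g) fun ν hν => D.theta_b_eq_zero hν
    · rw [hΔ.q, hΔ'.q, ← sub_eq_zero]
      refine (D.hasSum_commutator hx _ _).unique ?_
      convert hasSum_zero using 2 with ν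
      rw [theta_q, sub_self, UniformSpace.Completion.coe_zero]

/-! ### Separating functionals on `U ⊗ U` -/

theorem psiNeg_a_mul (Λ : P) (g : D.Iinf) (u : D.U) : D.psiNeg Λ (D.a g * u) = 0 := by
  have h1 : D.a g = D.plus (D.lmV g (D.cls 1)) := by
    rw [← a_mul_plus, plus_cls, map_one, mul_one]
  rw [h1, psiNeg_plus_mul, formR_lmV, contrV_cls, contr_one, map_zero, map_zero, zero_smul]

/-- The part of `Ψ_Λ(x⁻ a_g)` coming from the right contraction. -/
noncomputable def rightPart (g : D.Iinf) : D.FmodR →ₗ[QField] D.FmodR :=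
  D.scalV (D.wt (-D.cow g)) ∘ₗ D.scalV (D.sig g) ∘ₗ D.contrRV g ∘ₗ D.scalV (D.sig g)

/-- The weight `Λ` enters only through opposite powers of `q` on the right and left contraction
parts, so varying `Λ` separates them. -/
theorem psiNeg_minus_mul_a (Λ : P) (g : D.Iinf) (x : D.FmodR) :
    D.psiNeg Λ (D.minus x * D.a g) = qVar ^ (-D.cow g Λ) • D.rightPart g x -
      qVar ^ D.cow g Λ • D.contrV g (D.scalV (D.sig g) x) := by
  have e := D.a_mul_minus g (D.scalV (D.sig g) x)
  rw [scalV_sig_sig, eq_sub_iff_add_eq, ← sub_eq_iff_eq_add] at e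
  have e2 := D.minus_mul_qpow (-D.cow g) (D.scalV (D.sig g) (D.contrRV g (D.scalV (D.sig g) x)))
  rw [Kinv, e2] at e
  rw [← e, map_sub, map_add, psiNeg_a_mul, zero_add, K, psiNeg_qpow_mul, psiNeg_qpow_mul,
    psiNeg_minus, psiNeg_minus, LinearMap.neg_apply]
  rfl

/-- The map `x₁⁺ q^h y⁻ ⊗ y₁⁻ q^{h'} x⁺ ↦ ε(x₁) ε(y₁) q^{h(Λ)} y_κ ⊗ x_ν` from `U ⊗ U` to
`F / ℛ ⊗ F / ℛ`. -/
noncomputable def sep (Λ : P) (κ ν : D.Deg) : D.UU →ₗ[QField] D.FmodR ⊗[QField] D.FmodR :=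
  TensorProduct.map (D.projV κ ∘ₗ D.psiNeg Λ) (D.projV ν ∘ₗ D.psiPos) ∘ₗ
    (GradedTensorProduct.of QField D.parity D.parity).symm.toLinearMap

theorem sep_pt (Λ : P) (κ ν : D.Deg) (x y : D.U) : D.sep Λ κ ν (D.pureTensor x y) =
    D.projV κ (D.psiNeg Λ x) ⊗ₜ D.projV ν (D.psiPos y) := rfl

theorem posTail_le {S : Finset D.Deg} {N : Submodule QField D.U}
    (H : ∀ ν ∉ S, ∀ x h, ∀ y ∈ D.FmodRdeg ν, D.minus x * D.qpow h * D.plus y ∈ N) :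
    D.posTail S ≤ N := by
  rw [← map_omega_negTail]
  refine Submodule.map_le_iff_le_comap.mpr (D.negTail_le fun ν hν x h y hy => ?_)
  rw [Submodule.mem_comap, AlgHom.toLinearMap_apply, map_mul, map_mul, omega_plus, omega_qpow,
    omega_minus]
  exact H ν hν _ _ y hy

/-- `psiNeg` and `psiPos` reduce an element of a tail to its last factor, whose degree lies outside
`S` and is removed by the projections onto `κ` and `ν`. -/
theorem sep_eq_zero (Λ : P) {κ ν : D.Deg} {S : Finset D.Deg} (hκ : κ ∈ S) (hν : ν ∈ S)
    {z : D.UU} (hz : z ∈ D.H S) : D.sep Λ κ ν z = 0 := by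
  have hN : D.negTail S ≤ LinearMap.ker (D.projV κ ∘ₗ D.psiNeg Λ) :=
    D.negTail_le fun μ hμ x h y hy => by
      rw [LinearMap.mem_ker, LinearMap.comp_apply, mul_assoc, psiNeg_plus_mul, psiNeg_qpow_mul,
        psiNeg_minus, map_smul, map_smul, D.projV_ne (μ := μ) (ν := κ) (fun e => hμ (e ▸ hκ)) hy, smul_zero,
        smul_zero]
  have hP : D.posTail S ≤ LinearMap.ker (D.projV ν ∘ₗ D.psiPos) :=
    D.posTail_le fun μ hμ x h y hy => by
      rw [LinearMap.mem_ker, LinearMap.comp_apply, mul_assoc, psiPos_minus_mul, psiPos_qpow_mul,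
        psiPos_plus, map_smul, D.projV_ne (μ := μ) (ν := ν) (fun e => hμ (e ▸ hν)) hy, smul_zero]
  have hH : D.H S ≤ LinearMap.ker (D.sep Λ κ ν) := by
    refine D.H_le (fun x hx y => ?_) fun x y hy => ?_
    · have h := LinearMap.mem_ker.mp (hN hx)
      rw [LinearMap.comp_apply] at h
      rw [LinearMap.mem_ker, sep_pt, h, TensorProduct.zero_tmul]
    · have h := LinearMap.mem_ker.mp (hP hy)
      rw [LinearMap.comp_apply] at h
      rw [LinearMap.mem_ker, sep_pt, h, TensorProduct.tmul_zero]
  exact hH hz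

theorem sep_tmap (Λ : P) (κ ν : D.Deg) (f : D.FmodR →ₗ[QField] D.U)
    (r : D.FmodR →ₗ[QField] D.FmodR) (z : D.FmodR ⊗[QField] D.FmodR) :
    D.sep Λ κ ν (D.tmap f (D.plus ∘ₗ r) z) =
      TensorProduct.map (D.projV κ ∘ₗ D.psiNeg Λ ∘ₗ f) (D.projV ν ∘ₗ r) z := by
  induction z using TensorProduct.induction_on with
  | zero => simp only [map_zero]
  | add z z' hz hz' => simp only [map_add, hz, hz']
  | tmul x y =>
    rw [tmap_tmul, sep_pt, TensorProduct.map_tmul]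
    simp only [LinearMap.comp_apply, psiPos_plus]

/-! ### Bihomogeneous tensors and the uniqueness of `Θ` -/

/-- The tensor `z` has degree `(ν, ν)`. -/
def IsBihom (ν : D.Deg) (z : D.FmodR ⊗[QField] D.FmodR) : Prop :=
  TensorProduct.map (D.projV ν) (D.projV ν) z = z

variable {D}

theorem IsBihom.map_congr {ν : D.Deg} {z : D.FmodR ⊗[QField] D.FmodR} (hz : D.IsBihom ν z)
    {W : Type*} [AddCommGroup W] [Module QField W] {W' : Type*} [AddCommGroup W'] [Module QField W']
    {f f' : D.FmodR →ₗ[QField] W} {h h' : D.FmodR →ₗ[QField] W'}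
    (hf : ∀ x ∈ D.FmodRdeg ν, f x = f' x) (hh : ∀ x ∈ D.FmodRdeg ν, h x = h' x) :
    TensorProduct.map f h z = TensorProduct.map f' h' z := by
  have e1 : f ∘ₗ D.projV ν = f' ∘ₗ D.projV ν := LinearMap.ext fun x => hf _ (D.projV_mem ν x)
  have e2 : h ∘ₗ D.projV ν = h' ∘ₗ D.projV ν := LinearMap.ext fun x => hh _ (D.projV_mem ν x)
  rw [← show TensorProduct.map (D.projV ν) (D.projV ν) z = z from hz, ← LinearMap.comp_apply,
    ← LinearMap.comp_apply, ← TensorProduct.map_comp, ← TensorProduct.map_comp, e1, e2]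

theorem IsBihom.sep_tmap_eq_zero {μ : D.Deg} {z : D.FmodR ⊗[QField] D.FmodR} (hz : D.IsBihom μ z)
    (Λ : P) {κ ν : D.Deg} (f : D.FmodR →ₗ[QField] D.U) {r : D.FmodR →ₗ[QField] D.FmodR}
    (hr : ∀ x ∈ D.FmodRdeg μ, D.projV ν (r x) = 0) :
    D.sep Λ κ ν (D.tmap f (D.plus ∘ₗ r) z) = 0 := by
  rw [sep_tmap, hz.map_congr (f' := D.projV κ ∘ₗ D.psiNeg Λ ∘ₗ f) (h' := 0) (fun _ _ => rfl)
    fun x hx => hr x hx, TensorProduct.map_zero_right, LinearMap.zero_apply]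

variable (D)

/-- The defect of the intertwining relation for `a_g` at `z`. -/
noncomputable def defect (g : D.Iinf) (w : D.UU) : D.UU :=
  (D.pureTensor (D.a g) 1 + D.pureTensor (D.K g) (D.a g)) * w -
    w * (D.pureTensor (D.a g) 1 + D.pureTensor (D.Kinv g) (D.a g))

theorem sep_a_one_mul (Λ : P) (κ ν : D.Deg) (g : D.Iinf) (z : D.FmodR ⊗[QField] D.FmodR) :
    D.sep Λ κ ν (D.pureTensor (D.a g) 1 * D.tmap D.minus D.plus z) = 0 := by
  induction z using TensorProduct.induction_on with
  | zero => simp only [map_zero, mul_zero]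
  | add z z' hz hz' => simp only [map_add, mul_add, hz, hz', add_zero]
  | tmul x y =>
    rw [tmap_tmul, D.pt_mul_of_even_left D.one_mem_parity, sep_pt, psiNeg_a_mul, map_zero,
      TensorProduct.zero_tmul]

variable {D}

theorem IsBihom.sep_tmap_mul_a_one {μ : D.Deg} {z : D.FmodR ⊗[QField] D.FmodR}
    (hz : D.IsBihom μ z) (Λ : P) (κ : D.Deg) {ν : D.Deg} (hν : μ ≠ ν) (g : D.Iinf) :
    D.sep Λ κ ν (D.tmap D.minus D.plus z * D.pureTensor (D.a g) 1) = 0 := by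
  rw [tmap_mul_a_one, tmap_map_right]
  exact hz.sep_tmap_eq_zero Λ _ fun x hx => D.projV_ne hν (D.scalV_mem _ hx)

theorem IsBihom.sep_K_a_mul {μ : D.Deg} {z : D.FmodR ⊗[QField] D.FmodR} (hz : D.IsBihom μ z)
    (Λ : P) (κ' : D.Deg) {κ : D.Deg} (hκ : μ ≠ κ) (g : D.Iinf) :
    D.sep Λ κ' (κ + Finsupp.single g 1)
      (D.pureTensor (D.K g) (D.a g) * D.tmap D.minus D.plus z) = 0 := by
  have hl : LinearMap.mulLeft QField (D.a g) ∘ₗ D.plus = D.plus ∘ₗ D.lmV g :=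
    LinearMap.ext fun x => D.a_mul_plus g x
  rw [K_a_mul_tmap, tmap_map_left, hl]
  exact hz.sep_tmap_eq_zero Λ _ fun x hx =>
    D.projV_ne (fun e => hκ (add_right_cancel e)) (D.lmV_mem g hx)

theorem IsBihom.sep_mul_Kinv_a {μ : D.Deg} {z : D.FmodR ⊗[QField] D.FmodR} (hz : D.IsBihom μ z)
    (Λ : P) (κ' : D.Deg) {κ : D.Deg} (hκ : μ ≠ κ) (g : D.Iinf) :
    D.sep Λ κ' (κ + Finsupp.single g 1)
      (D.tmap D.minus D.plus z * D.pureTensor (D.Kinv g) (D.a g)) = 0 := by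
  have hr : LinearMap.mulRight QField (D.a g) ∘ₗ D.plus = D.plus ∘ₗ D.rmV g :=
    LinearMap.ext fun x => D.plus_mul_a g x
  rw [tmap_mul_Kinv_a, hr]
  exact hz.sep_tmap_eq_zero Λ _ fun x hx =>
    D.projV_ne (fun e => hκ (add_right_cancel e)) (D.rmV_mem g hx)

/-- The separating functional applied to the defect sees only the right multiplication by
`a_g ⊗ 1`. -/
theorem IsBihom.sep_defect {μ : D.Deg} {z : D.FmodR ⊗[QField] D.FmodR} (hz : D.IsBihom μ z)
    (Λ : P) {κ : D.Deg} (hκ : μ ≠ κ) (g : D.Iinf) :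
    D.sep Λ κ (κ + Finsupp.single g 1) (D.defect g (D.tmap D.minus D.plus z)) =
      -D.sep Λ κ (κ + Finsupp.single g 1)
        (D.tmap D.minus D.plus z * D.pureTensor (D.a g) 1) := by
  rw [defect, add_mul, mul_add, map_sub, map_add, map_add, sep_a_one_mul, hz.sep_K_a_mul Λ κ hκ,
    hz.sep_mul_Kinv_a Λ κ hκ, add_zero, add_zero, zero_sub]

/-- The hypothesis says `q^{-n} X = q^n Y` for every `Λ`, where `n = ⟨l d_i h_i, Λ⟩`, `X` comes from
the right contraction and `Y` is the left contraction of `z`. Two values of `n` force `Y = 0`. -/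
theorem IsBihom.map_contrV_eq_zero {κ : D.Deg} {g : D.Iinf} {z : D.FmodR ⊗[QField] D.FmodR}
    (hz : D.IsBihom (κ + Finsupp.single g 1) z)
    (h : ∀ Λ, D.sep Λ κ (κ + Finsupp.single g 1)
      (D.tmap D.minus D.plus z * D.pureTensor (D.a g) 1) = 0) :
    TensorProduct.map (D.contrV g) LinearMap.id z = 0 := by
  set ν := κ + Finsupp.single g 1 with hν
  set c := D.charDeg (D.sig g) ν
  have hc : c * c = 1 := D.charDeg_sig_mul_self g ν
  -- The sign twists on the two legs give the same sign `c`, and `c² = 1`.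
  have hY : TensorProduct.map (D.projV κ ∘ₗ D.contrV g ∘ₗ D.scalV (D.sig g))
      (D.projV ν ∘ₗ D.scalV (D.sig g)) z = TensorProduct.map (D.contrV g) LinearMap.id z := by
    rw [hz.map_congr (f' := c • D.contrV g) (h' := c • LinearMap.id), TensorProduct.map_smul_left,
      TensorProduct.map_smul_right, smul_smul, hc, one_smul]
    · intro x hx
      rw [LinearMap.comp_apply, LinearMap.comp_apply, D.scalV_of_mem _ hx, map_smul, map_smul,
        D.projV_self (D.contrV_mem g hx)]
      rfl
    · intro x hx
      rw [LinearMap.comp_apply, D.scalV_of_mem _ hx, map_smul, D.projV_self hx]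
      rfl
  set X := TensorProduct.map (D.projV κ ∘ₗ D.rightPart g) (D.projV ν ∘ₗ D.scalV (D.sig g)) z
  have key : ∀ Λ, qVar ^ (-D.cow g Λ) • X =
      qVar ^ D.cow g Λ • TensorProduct.map (D.contrV g) LinearMap.id z := fun Λ => by
    have e := h Λ
    rw [tmap_mul_a_one, tmap_map_right, sep_tmap] at e
    have hm : qVar ^ (-D.cow g Λ) • (D.projV κ ∘ₗ D.rightPart g) =
        D.projV κ ∘ₗ D.psiNeg Λ ∘ₗ LinearMap.mulRight QField (D.a g) ∘ₗ D.minus +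
          qVar ^ D.cow g Λ • (D.projV κ ∘ₗ D.contrV g ∘ₗ D.scalV (D.sig g)) :=
      LinearMap.ext fun x => by
        have e1 := congrArg (D.projV κ) (D.psiNeg_minus_mul_a Λ g x)
        rw [map_sub, map_smul, map_smul] at e1
        exact eq_add_of_sub_eq e1.symm
    have e2 := congrArg (fun f => TensorProduct.map f (D.projV ν ∘ₗ D.scalV (D.sig g)) z) hm
    simp only [TensorProduct.map_add_left, LinearMap.add_apply, TensorProduct.map_smul_left,
      LinearMap.smul_apply] at e2
    rw [e, hY, zero_add] at e2
    exact e2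
  -- `Λ = 0` gives `X = Y`; the fundamental weight gives `n = l d_i > 0`, hence `q^{-n} Y = q^n Y`.
  obtain ⟨Λ, hΛ⟩ := D.exists_fundamental (D.idx g)
  have h0 := key 0
  rw [map_zero, neg_zero, zpow_zero, one_smul, one_smul] at h0
  have h1 := key Λ
  have hn : D.cow g Λ = ((D.lev g * D.d (D.idx g) : ℕ) : ℤ) := by
    rw [cow, LinearMap.smul_apply, (hΛ (D.idx g)).1 rfl, nsmul_eq_mul, mul_one]
  have hpos : 0 < D.lev g * D.d (D.idx g) := Nat.mul_pos g.2.1 (D.d_pos _)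
  rw [h0] at h1
  by_contra hY0
  have e : qVar ^ (-D.cow g Λ) = qVar ^ D.cow g Λ := smul_left_injective QField hY0 h1
  rw [hn, zpow_neg, inv_eq_iff_eq_inv, ← mul_eq_one_iff_eq_inv₀
    (zpow_ne_zero _ qVar_ne_zero), zpow_natCast, ← pow_add] at e
  have := qVar_pow_injective (e.trans (pow_zero qVar).symm)
  omega

/-- Pair the first leg with `w`: a factor `a_g` of `w` moves over as a contraction, which is zero by
assumption, and `w = 1` is orthogonal to the nonzero degree `ν`. -/
theorem IsBihom.eq_zero {ν : D.Deg} (hν : ν ≠ 0) {z : D.FmodR ⊗[QField] D.FmodR}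
    (hz : D.IsBihom ν z) (h : ∀ g, TensorProduct.map (D.contrV g) LinearMap.id z = 0) : z = 0 := by
  refine D.tensor_eq_zero fun y => D.eq_zero_of_formR fun w => ?_
  induction w using D.V_induction with
  | one =>
    have h1 : D.cls 1 ∈ D.FmodRdeg 0 := ⟨1, Submodule.subset_span ⟨[], by simp, by simp⟩, rfl⟩
    rw [← show TensorProduct.map (D.projV ν) (D.projV ν) z = z from hz,
      D.ctr_map _ fun z => D.formR_projV ν z y, formR_projV, D.projV_ne hν.symm h1, map_zero]
  | add x y hx hy => rw [map_add, hx, hy, add_zero]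
  | smul r x hx => rw [map_smul, hx, smul_zero]
  | mul g x hx =>
    rw [← formR_contrV, ← ctr_map_left, h g, map_zero, map_zero, LinearMap.zero_apply]

variable (D)

theorem exists_isBihom {ν : D.Deg} {w : D.UU} (hw : w ∈ D.tens (D.Uneg ν) (D.Upos ν)) :
    ∃ z, D.IsBihom ν z ∧ D.tmap D.minus D.plus z = w := by
  induction hw using Submodule.span_induction with
  | mem w hw =>
    obtain ⟨_, ⟨x, hx, rfl⟩, _, ⟨y, hy, rfl⟩, rfl⟩ := hw
    refine ⟨x ⊗ₜ y, ?_, rfl⟩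
    rw [IsBihom, TensorProduct.map_tmul, D.projV_self hx, D.projV_self hy]
  | zero => exact ⟨0, map_zero _, map_zero _⟩
  | add w w' _ _ hw hw' =>
    obtain ⟨z, hz, rfl⟩ := hw
    obtain ⟨z', hz', rfl⟩ := hw'
    exact ⟨z + z', by rw [IsBihom, map_add, hz, hz'], map_add _ _ _⟩
  | smul r w _ hw =>
    obtain ⟨z, hz, rfl⟩ := hw
    exact ⟨r • z, by rw [IsBihom, map_smul, hz], map_smul _ _ _⟩

/-- A convergent sum in the completion with value zero has finite partial sums in every `H_S`. -/
theorem exists_sum_mem_H {f : D.Deg → D.UU} (h : HasSum (fun ν => (f ν : D.UUhat)) 0)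
    (S : Finset D.Deg) : ∃ T₀ : Finset D.Deg, ∀ T, T₀ ⊆ T → ∑ ν ∈ T, f ν ∈ D.H S := by
  have e : ∀ s : Finset D.Deg, ((∑ ν ∈ s, f ν : D.UU) : D.UUhat) = ∑ ν ∈ s, (f ν : D.UUhat) :=
    fun s => map_sum UniformSpace.Completion.toCompl f s
  have h' : Filter.Tendsto (fun s : Finset D.Deg => ∑ ν ∈ s, f ν) Filter.atTop (nhds 0) := by
    -- `U ⊗ U` carries the topology induced from its completion, so the partial sums already tend to
    -- zero in `U ⊗ U`.
    rw [(UniformSpace.Completion.isUniformInducing_coe D.UU).isInducing.tendsto_nhds_iff]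
    simpa only [Function.comp_def, HasSum, SummationFilter.unconditional_filter, e,
      UniformSpace.Completion.coe_zero] using h
  exact Filter.eventually_atTop.mp (h'.eventually (D.nhds_zero_hasBasis.mem_of_mem trivial))

variable {D}

theorem IsQuasiR.hasSum_defect {Δ Δ' : D.U →ₐ[QField] D.UU} (hΔ : D.IsComul Δ)
    (hΔ' : D.IsBarComul Δ') {Θ : D.Deg → D.UU} (h : D.IsQuasiR Δ Δ' Θ) (g : D.Iinf) :
    HasSum (fun ν => (D.defect g (Θ ν) : D.UUhat)) 0 := by
  obtain ⟨x, hx, hi⟩ := h.intertwines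
  have e := D.hasSum_commutator hx (Δ (D.a g)) (Δ' (D.a g))
  rw [hi, sub_self, hΔ.a, hΔ'.a] at e
  exact e

/-- The difference of two solutions has defects summing to zero for each `a_g`, and vanishes in
degree 0. Induction on the height uses only the relations for `a_g`; those for `b_g` and `q^h` play
no role. -/
theorem IsQuasiR.unique {Δ Δ' : D.U →ₐ[QField] D.UU} (hΔ : D.IsComul Δ) (hΔ' : D.IsBarComul Δ')
    {Θ Θ' : D.Deg → D.UU} (h : D.IsQuasiR Δ Δ' Θ) (h' : D.IsQuasiR Δ Δ' Θ') : Θ = Θ' := by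
  classical
  have hz : ∀ ν, ∃ z, D.IsBihom ν z ∧ D.tmap D.minus D.plus z = Θ ν - Θ' ν := fun ν =>
    D.exists_isBihom (sub_mem (h.mem ν) (h'.mem ν))
  choose z hz hzδ using hz
  have hsum : ∀ g, HasSum (fun ν => (D.defect g (D.tmap D.minus D.plus (z ν)) : D.UUhat)) 0 :=
    fun g => by
      have e := (h.hasSum_defect hΔ hΔ' g).sub (h'.hasSum_defect hΔ hΔ' g)
      rw [sub_zero] at e
      convert e using 2 with ν
      rw [hzδ, ← UniformSpace.Completion.coe_sub]
      congr 1
      simp only [defect, mul_sub, sub_mul]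
      abel
  suffices hmain : ∀ n, ∀ ν, D.ht ν = n → D.tmap D.minus D.plus (z ν) = 0 from
    funext fun ν => sub_eq_zero.mp ((hzδ ν).symm.trans (hmain _ ν rfl))
  intro n
  induction n using Nat.strong_induction_on with
  | _ n ih =>
    rintro ν rfl
    by_cases h0 : ν = 0
    · rw [hzδ, h0, h.zero, h'.zero, sub_self]
    rw [(hz ν).eq_zero h0 fun g => ?_, map_zero]
    by_cases hg : ν g = 0
    · rw [(hz ν).map_congr (f' := 0) (h' := LinearMap.id)
        (fun x hx => D.contrV_eq_zero hg hx) fun _ _ => rfl, TensorProduct.map_zero_left,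
        LinearMap.zero_apply]
    obtain ⟨κ, rfl⟩ := D.exists_eq_add_single hg
    have hκ : D.tmap D.minus D.plus (z κ) = 0 := by
      refine ih (D.ht κ) ?_ κ rfl
      rw [ht, ht, Finsupp.sum_add_index' (by simp) (by intros; rfl)]
      simp
    have hne : κ + Finsupp.single g 1 ≠ κ := fun e => by
      have := DFunLike.congr_fun e g
      simp at this
    refine (hz _).map_contrV_eq_zero fun Λ => ?_
    -- Both degrees tested by `sep` must belong to `S`. The partial sum is then taken over a set
    -- enlarged so as to contain `κ + g`.
    obtain ⟨T₀, hT₀⟩ := D.exists_sum_mem_H (hsum g) {κ, κ + Finsupp.single g 1}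
    have e := D.sep_eq_zero Λ (κ := κ) (ν := κ + Finsupp.single g 1) (by simp) (by simp)
      (hT₀ (insert (κ + Finsupp.single g 1) T₀) (Finset.subset_insert _ _))
    rw [map_sum, Finset.sum_eq_single (κ + Finsupp.single g 1)] at e
    · rw [(hz _).sep_defect Λ hne, neg_eq_zero] at e
      exact e
    · intro μ _ hμ
      -- Degree `κ` vanishes by the induction hypothesis. For any other `μ ≠ κ + g`, only
      -- multiplication by `a_g ⊗ 1` on the right could contribute, and it leaves the second leg in
      -- degree `μ`.
      by_cases hμκ : μ = κ
      · rw [hμκ, hκ, defect, mul_zero, zero_mul, sub_zero, map_zero]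
      · rw [(hz μ).sep_defect Λ hμκ, (hz μ).sep_tmap_mul_a_one Λ κ hμ, neg_zero]
    · intro hn
      exact absurd (Finset.mem_insert_self _ _) hn

end SuperBorcherdsCartanDatum

theorem mainTheorem5 {I : Type*} {P : Type*} [AddCommGroup P] [Module.Free ℤ P]
    (D : SuperBorcherdsCartanDatum I P) :
    (∃! Δ : D.U →ₐ[QField] D.UU, D.IsComul Δ) ∧
    (∃! Δ' : D.U →ₐ[QField] D.UU, D.IsBarComul Δ') ∧
    ∀ Δ Δ' : D.U →ₐ[QField] D.UU, D.IsComul Δ → D.IsBarComul Δ' →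
      (∃! Θ : D.Deg → D.UU, D.IsQuasiR Δ Δ' Θ) ∧
      ∀ Θ : D.Deg → D.UU, D.IsQuasiR Δ Δ' Θ → ∀ ν : D.Deg,
        Module.Finite QField (D.FmodRdeg ν) ∧
        ∀ {ι : Type*} [Fintype ι] (B : Module.Basis ι QField (D.FmodRdeg ν)),
          ∃ B' : Module.Basis ι QField (D.FmodRdeg ν),
            (∀ j k, (j = k → D.formR (B j) (B' k) = 1) ∧ (j ≠ k → D.formR (B j) (B' k) = 0)) ∧
            Θ ν = ((-1) ^ (D.ht ν + D.e ν) : QField) •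
              ∑ k, D.pureTensor (D.minus (B k)) (D.plus (B' k)) := by
  refine ⟨D.existsUnique_comul, D.existsUnique_barComul, fun Δ Δ' hΔ hΔ' => ?_⟩
  have hθ := D.isQuasiR_theta hΔ hΔ'
  refine ⟨⟨D.theta, hθ, fun Θ h => h.unique hΔ hΔ' hθ⟩,
    fun Θ h ν => ⟨D.finite_FmodRdeg ν, fun B => ?_⟩⟩
  obtain ⟨B', hB⟩ := D.exists_isDual B
  rw [h.unique hΔ hΔ' hθ]
  exact ⟨B', hB, D.theta_eq hB⟩
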